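/- Let $V_6$ be a complex vector space of dimension $6$, and let $G(4,\wedge^2V_6)$ be the Grassmannian of four-dimensional subspaces of $\wedge^2V_6$, with its Zariski topology (induced by the Plücker embedding). For a four-dimensional subspace $H\subset\wedge^2V_6$, let $\mathrm{Sym}^2H\to\wedge^4V_6$ be the linear map $a\cdot b\mapsto a\wedge b$, and regard elements of $\mathrm{Sym}^2H$ as quadratic forms on $H^*$. Let $\mathcal V\subset G(4,\wedge^2V_6)$ be the set of all $H$ such that 1. the map $\mathrm{Sym}^2H\to\wedge^4V_6$ has rank exactly $9$ (equivalently, its kernel is one-dimensional), and 2. its kernel is generated by a non-degenerate quadratic form on $H^*$. Then $\mathcal V$ is a subvariety (that is, a Zariski locally closed subset) of $G(4,\wedge^2V_6)$, it is irreducible (in particular non-empty), and its dimension is $38$. -/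

import Mathlib

open Module
open scoped TensorProduct LinearAlgebra.Projectivization

noncomputable section

namespace SkewForms

/-! ### The Zariski topology on projective space and on Grassmannians -/

/-- The value at a vector `x` of a polynomial `f` in the linear forms on `M`. -/
def polyEval {M : Type*} [AddCommGroup M] [Module ℂ M] (x : M)
    (f : MvPolynomial (Dual ℂ M) ℂ) : ℂ :=
  MvPolynomial.eval (fun φ : Dual ℂ M => φ x) f

/-- The zero locus in `ℙ(M)` of a set of (homogeneous) polynomials in the linear forms on `M`.
For homogeneous polynomials the choice of the representative vector is irrelevant. -/
def projZeroLocus {M : Type*} [AddCommGroup M] [Module ℂ M]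
    (S : Set (MvPolynomial (Dual ℂ M) ℂ)) : Set (ℙ ℂ M) :=
  {p | ∀ f ∈ S, polyEval p.rep f = 0}

/-- The Zariski topology on the projective space `ℙ(M)`: the closed sets are the zero loci of sets
of homogeneous polynomials. -/
@[reducible]
def projZariski (M : Type*) [AddCommGroup M] [Module ℂ M] : TopologicalSpace (ℙ ℂ M) :=
  TopologicalSpace.ofClosed
    {Z | ∃ S : Set (MvPolynomial (Dual ℂ M) ℂ),
      (∀ f ∈ S, ∃ d : ℕ, f.IsHomogeneous d) ∧ Z = projZeroLocus S}
    (by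
      refine ⟨{1}, ?_, ?_⟩
      · rintro f rfl
        exact ⟨0, MvPolynomial.isHomogeneous_one _ _⟩
      · ext p
        simp [projZeroLocus, polyEval])
    (by
      intro A hA
      have hA' : ∀ Z : Set (ℙ ℂ M), ∃ S : Set (MvPolynomial (Dual ℂ M) ℂ), Z ∈ A →
          (∀ f ∈ S, ∃ d : ℕ, f.IsHomogeneous d) ∧ Z = projZeroLocus S := by
        intro Z
        by_cases hZA : Z ∈ A
        · obtain ⟨S, hS⟩ := hA hZA
          exact ⟨S, fun _ => hS⟩
        · exact ⟨∅, fun h => absurd h hZA⟩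
      choose S hS using hA'
      refine ⟨⋃ Z ∈ A, S Z, ?_, ?_⟩
      · intro f hf
        simp only [Set.mem_iUnion] at hf
        obtain ⟨Z, hZA, hf⟩ := hf
        exact (hS Z hZA).1 f hf
      · ext p
        simp only [Set.mem_sInter, projZeroLocus, Set.mem_iUnion, Set.mem_ofPred_eq]
        constructor
        · rintro h f ⟨Z, hZA, hf⟩
          have hp := h Z hZA
          rw [(hS Z hZA).2] at hp
          exact hp f hf
        · intro h Z hZA
          rw [(hS Z hZA).2]
          exact fun f hf => h f ⟨Z, hZA, hf⟩)
    (by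
      rintro _ ⟨S, hS, rfl⟩ _ ⟨T, hT, rfl⟩
      refine ⟨{h | ∃ f ∈ S, ∃ g ∈ T, h = f * g}, ?_, ?_⟩
      · rintro _ ⟨f, hf, g, hg, rfl⟩
        obtain ⟨d, hd⟩ := hS f hf
        obtain ⟨e, he⟩ := hT g hg
        exact ⟨d + e, hd.mul he⟩
      · ext p
        simp only [projZeroLocus, Set.mem_union, Set.mem_ofPred_eq]
        constructor
        · rintro (h | h) _ ⟨f, hf, g, hg, rfl⟩
          · simpa [polyEval] using Or.inl (h f hf)
          · simpa [polyEval] using Or.inr (h g hg)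
        · intro h
          by_contra hne
          push Not at hne
          obtain ⟨⟨f, hf, hf0⟩, ⟨g, hg, hg0⟩⟩ := hne
          have := h _ ⟨f, hf, g, hg, rfl⟩
          simp only [polyEval, map_mul, mul_eq_zero] at this
          exact this.elim hf0 hg0)

/-- The Grassmannian `G(k, W)` of `k`-dimensional subspaces of `W`. -/
def Gr (k : ℕ) (W : Type*) [AddCommGroup W] [Module ℂ W] : Type _ :=
  {H : Submodule ℂ W // finrank ℂ H = k}

/-- The `k`-vector `h₁ ∧ ⋯ ∧ hₖ` of a chosen basis `h₁, …, hₖ` of `H`. -/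
def pluckerVector {k : ℕ} {W : Type*} [AddCommGroup W] [Module ℂ W] [FiniteDimensional ℂ W]
    (H : Gr k W) : ⋀[ℂ]^k W :=
  exteriorPower.ιMulti ℂ k (fun i => (finBasisOfFinrankEq ℂ H.1 H.2 i : W))

theorem pluckerVector_ne_zero {k : ℕ} {W : Type*} [AddCommGroup W] [Module ℂ W]
    [FiniteDimensional ℂ W] (H : Gr k W) : pluckerVector H ≠ 0 := by
  have hli : LinearIndependent ℂ (fun i => (finBasisOfFinrankEq ℂ H.1 H.2 i : W)) :=
    (finBasisOfFinrankEq ℂ H.1 H.2).linearIndependent.map' H.1.subtype (Submodule.ker_subtype _)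
  have h := (exteriorPower.ιMulti_family_linearIndependent_field (n := k) hli).ne_zero
    (Set.powersetCard.ofFinEmbEquiv (RelEmbedding.refl _))
  rw [exteriorPower.ιMulti_family, Equiv.symm_apply_apply] at h
  exact h

/-- The Plücker embedding `G(k, W) → ℙ(⋀ᵏ W)`. -/
def plucker {k : ℕ} {W : Type*} [AddCommGroup W] [Module ℂ W] [FiniteDimensional ℂ W]
    (H : Gr k W) : ℙ ℂ (⋀[ℂ]^k W) :=
  Projectivization.mk ℂ (pluckerVector H) (pluckerVector_ne_zero H)

/-- The Zariski topology on the Grassmannian, induced by the Plücker embedding. -/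
instance grZariski (k : ℕ) (W : Type*) [AddCommGroup W] [Module ℂ W] [FiniteDimensional ℂ W] :
    TopologicalSpace (Gr k W) :=
  TopologicalSpace.induced plucker (projZariski (⋀[ℂ]^k W))

/-! ### The map `Sym² H → ⋀⁴ V` -/

/-- The wedge product `⋀² V × ⋀² V → ⋀⁴ V`. -/
def wedge (V : Type*) [AddCommGroup V] [Module ℂ V] :
    ⋀[ℂ]^2 V →ₗ[ℂ] ⋀[ℂ]^2 V →ₗ[ℂ] ⋀[ℂ]^4 V :=
  LinearMap.mk₂ ℂ
    (fun a b => ⟨(a : ExteriorAlgebra ℂ V) * b,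
      SetLike.mul_mem_graded (A := fun n : ℕ => ⋀[ℂ]^n V) a.2 b.2⟩)
    (fun a a' b => Subtype.ext (by simp [add_mul]))
    (fun c a b => Subtype.ext (by simp))
    (fun a b b' => Subtype.ext (by simp [mul_add]))
    (fun c a b => Subtype.ext (by simp))

/-- `Sym² H`, realized as the space of symmetric tensors in `H ⊗ H`; the monomial `a · b`
corresponds to `(a ⊗ b + b ⊗ a) / 2`. -/
def SymSq (H : Type*) [AddCommGroup H] [Module ℂ H] : Submodule ℂ (H ⊗[ℂ] H) :=
  LinearMap.eqLocus (TensorProduct.comm ℂ H H).toLinearMap LinearMap.id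

/-- The natural map `Sym² H → ⋀⁴ V`, `a · b ↦ a ∧ b`, for a subspace `H` of `⋀² V`. -/
def symWedge {V : Type*} [AddCommGroup V] [Module ℂ V] (H : Submodule ℂ (⋀[ℂ]^2 V)) :
    SymSq H →ₗ[ℂ] ⋀[ℂ]^4 V :=
  (TensorProduct.lift ((wedge V).compl₁₂ H.subtype H.subtype)).domRestrict (SymSq H)

/-- The symmetric bilinear form on `H*` given by an element of `Sym² H`: it is the polarization of
the corresponding quadratic form, and sends `(φ, ψ)` to `(φ ⊗ ψ)(q)`. -/
def dualForm {H : Type*} [AddCommGroup H] [Module ℂ H] (q : SymSq H) :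
    LinearMap.BilinForm ℂ (Dual ℂ H) :=
  LinearMap.mk₂ ℂ (fun φ ψ => TensorProduct.dualDistrib ℂ H H (φ ⊗ₜ[ℂ] ψ) (q : H ⊗[ℂ] H))
    (fun φ φ' ψ => by simp [TensorProduct.add_tmul])
    (fun c φ ψ => by rw [← TensorProduct.smul_tmul', map_smul]; rfl)
    (fun φ ψ ψ' => by simp [TensorProduct.tmul_add])
    (fun c φ ψ => by simp)

/-- The locus `𝒱` of the four-planes `H` in `⋀² V` such that `Sym² H → ⋀⁴ V` has rank exactly nine
and its kernel is generated by a non-degenerate quadratic form on `H*`. -/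
def VV (V : Type*) [AddCommGroup V] [Module ℂ V] : Set (Gr 4 (⋀[ℂ]^2 V)) :=
  {H | finrank ℂ (LinearMap.range (symWedge H.1)) = 9 ∧
    ∃ q : SymSq H.1, LinearMap.ker (symWedge H.1) = Submodule.span ℂ {q} ∧
      (dualForm q).Nondegenerate}

end SkewForms

end

/-! Over ℂ every non-degenerate quadratic form in four variables is equivalent to x₀x₃ − x₁x₂. Hence
`H` lies in `VV` exactly when it has a frame a, b, c, d whose only quadratic relation is a ∧ d = b ∧
c (`IsHyperbolic`, `exists_isHyperbolic`, `IsHyperbolic.spanGr_mem`). The Zariski topology of the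
Grassmannian is handled through nonvanishing of polynomial functions of frames.

Local closedness. The planes carrying some quadratic relation form a closed set `degen ⊥`. Near a
hyperbolic frame Cramer's rule gives the only possible relation as a polynomial function of the
frame (`relVec`), and its non-degeneracy is an open condition. So `VV` is open in `degen ⊥`.

Irreducibility. If Pf(a) ≠ 0, then a ∧ · is an isomorphism from ⋀² to ⋀⁴, so a ∧ d = b ∧ c
determines d from (a, b, c), and the planes spanned by such frames (`incid e ⊥`) are parametrized by
an open subset of a vector space. These planes come arbitrarily close to every point of `VV`: the
map h ↦ (a ∧ d − b ∧ c, Pf a) is a submersion at a hyperbolic frame unless a nonzero bivector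
annihilates a, b and c, and the implicit function theorem then makes Pf(a) nonzero while keeping the
relation. In the exceptional case a and d are exchanged. This works because the bivectors
annihilating b and c form at most a line (`exists_smul_eq_of_annihilates`) and no nonzero one
annihilates the whole frame (`eq_zero_of_annihilates`).

Dimension. The Grassmannian has dimension 4 · (15 − 4) = 44. For ten monomials in a 15-dimensional
space, the first nine being independent, dependence amounts to 15 − 9 = 6 equations, so Krull's
height theorem gives dimension at least 38. Conversely, relax the relation to a ∧ d − b ∧ c ∈ M,
with M growing in six steps inside a complement of the nine monomials. The closures of the sets
`incid e M` form a strictly increasing chain of irreducible closed sets, which gives dimension at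
most 38. -/

noncomputable section

namespace SkewForms

/-! ### Polynomial functions and polynomial maps -/

section Poly

variable {M N T : Type*} [AddCommGroup M] [Module ℂ M] [AddCommGroup N] [Module ℂ N]
  [AddCommGroup T] [Module ℂ T]

/-- A function on `M` is polynomial if it is a polynomial in linear forms. -/
def IsPoly (f : M → ℂ) : Prop :=
  ∃ p : MvPolynomial (Dual ℂ M) ℂ, ∀ x, f x = polyEval x p

/-- A map is polynomial if its composition with every linear form is polynomial. -/
def IsPolyMap (F : M → N) : Prop := ∀ φ : Dual ℂ N, IsPoly fun x => φ (F x)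

theorem IsPoly.const (c : ℂ) : IsPoly fun _ : M => c :=
  ⟨MvPolynomial.C c, fun x => by simp [polyEval]⟩

theorem IsPoly.linear (φ : Dual ℂ M) : IsPoly fun x : M => φ x :=
  ⟨MvPolynomial.X φ, fun x => by simp [polyEval]⟩

theorem IsPoly.add {f g : M → ℂ} (hf : IsPoly f) (hg : IsPoly g) : IsPoly fun x => f x + g x := by
  obtain ⟨p, hp⟩ := hf
  obtain ⟨q, hq⟩ := hg
  exact ⟨p + q, fun x => by simp [polyEval, hp, hq]⟩

theorem IsPoly.mul {f g : M → ℂ} (hf : IsPoly f) (hg : IsPoly g) : IsPoly fun x => f x * g x := by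
  obtain ⟨p, hp⟩ := hf
  obtain ⟨q, hq⟩ := hg
  exact ⟨p * q, fun x => by simp [polyEval, hp, hq]⟩

theorem IsPoly.neg {f : M → ℂ} (hf : IsPoly f) : IsPoly fun x => -f x := by
  simpa using (IsPoly.const (-1)).mul hf

theorem IsPoly.sub {f g : M → ℂ} (hf : IsPoly f) (hg : IsPoly g) : IsPoly fun x => f x - g x := by
  simpa [sub_eq_add_neg] using hf.add hg.neg

theorem IsPoly.sum {ι : Type*} (s : Finset ι) {f : ι → M → ℂ} (hf : ∀ i ∈ s, IsPoly (f i)) :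
    IsPoly fun x => ∑ i ∈ s, f i x := by
  classical
  induction s using Finset.induction_on with
  | empty => simpa using IsPoly.const 0
  | insert i s hi ih =>
    simp only [Finset.sum_insert hi]
    exact (hf i (Finset.mem_insert_self _ _)).add
      (ih fun j hj => hf j (Finset.mem_insert_of_mem hj))

theorem IsPoly.prod {ι : Type*} (s : Finset ι) {f : ι → M → ℂ} (hf : ∀ i ∈ s, IsPoly (f i)) :
    IsPoly fun x => ∏ i ∈ s, f i x := by
  classical
  induction s using Finset.induction_on with
  | empty => simpa using IsPoly.const 1
  | insert i s hi ih =>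
    simp only [Finset.prod_insert hi]
    exact (hf i (Finset.mem_insert_self _ _)).mul
      (ih fun j hj => hf j (Finset.mem_insert_of_mem hj))

theorem IsPoly.det {n : Type*} [Fintype n] [DecidableEq n] {A : M → Matrix n n ℂ}
    (hA : ∀ i j, IsPoly fun x => A x i j) : IsPoly fun x => (A x).det := by
  simp only [Matrix.det_apply']
  exact IsPoly.sum _ fun σ _ => (IsPoly.const _).mul (IsPoly.prod _ fun i _ => hA _ _)

theorem IsPoly.adjugate {n : Type*} [Fintype n] [DecidableEq n] {A : M → Matrix n n ℂ}
    (hA : ∀ i j, IsPoly fun x => A x i j) (i j : n) : IsPoly fun x => (A x).adjugate i j := by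
  simp only [Matrix.adjugate_apply]
  refine IsPoly.det fun k l => ?_
  by_cases h : k = j
  · subst h
    simpa using IsPoly.const _
  · simpa [Matrix.updateRow_apply, h] using hA k l

/-- Induction principle for polynomial functions. -/
theorem IsPoly.induction {P : (M → ℂ) → Prop} (hc : ∀ c, P fun _ => c)
    (hl : ∀ φ : Dual ℂ M, P fun x => φ x) (ha : ∀ f g, P f → P g → P fun x => f x + g x)
    (hm : ∀ f g, P f → P g → P fun x => f x * g x) {f : M → ℂ} (hf : IsPoly f) : P f := by
  obtain ⟨p, hp⟩ := hf
  obtain rfl : f = fun x => polyEval x p := funext hp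
  clear hp
  induction p using MvPolynomial.induction_on with
  | C c => simpa [polyEval] using hc c
  | add p q hp hq => simpa [polyEval] using ha _ _ hp hq
  | mul_X p φ hp => simpa [polyEval] using hm _ _ hp (hl φ)

theorem IsPoly.comp {f : N → ℂ} (hf : IsPoly f) {F : M → N} (hF : IsPolyMap F) :
    IsPoly fun x => f (F x) := by
  exact IsPoly.induction (P := fun f => IsPoly fun x => f (F x)) IsPoly.const hF
    (fun _ _ hf hg => hf.add hg) (fun _ _ hf hg => hf.mul hg) hf

theorem IsPolyMap.comp {F : N → T} (hF : IsPolyMap F) {G : M → N} (hG : IsPolyMap G) :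
    IsPolyMap fun x => F (G x) := fun φ => (hF φ).comp hG

theorem IsPolyMap.linear (L : M →ₗ[ℂ] N) : IsPolyMap fun x => L x :=
  fun φ => IsPoly.linear (φ.comp L)

theorem IsPolyMap.id : IsPolyMap fun x : M => x := IsPolyMap.linear LinearMap.id

theorem IsPolyMap.const (y : N) : IsPolyMap fun _ : M => y := fun φ => IsPoly.const (φ y)

theorem IsPolyMap.add {F G : M → N} (hF : IsPolyMap F) (hG : IsPolyMap G) :
    IsPolyMap fun x => F x + G x := fun φ => by simpa using (hF φ).add (hG φ)

theorem IsPolyMap.sub {F G : M → N} (hF : IsPolyMap F) (hG : IsPolyMap G) :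
    IsPolyMap fun x => F x - G x := fun φ => by simpa using (hF φ).sub (hG φ)

theorem IsPolyMap.smul {f : M → ℂ} {F : M → N} (hf : IsPoly f) (hF : IsPolyMap F) :
    IsPolyMap fun x => f x • F x := fun φ => by simpa using hf.mul (hF φ)

theorem IsPolyMap.sum {ι : Type*} (s : Finset ι) {F : ι → M → N}
    (hF : ∀ i ∈ s, IsPolyMap (F i)) : IsPolyMap fun x => ∑ i ∈ s, F i x := fun φ => by
  simpa using IsPoly.sum s fun i hi => hF i hi φ

theorem IsPolyMap.pi {ι : Type*} [Fintype ι] {F : M → ι → N}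
    (hF : ∀ i, IsPolyMap fun x => F x i) : IsPolyMap F := by
  classical
  intro φ
  have h : ∀ x, φ (F x) = ∑ i, φ.comp (LinearMap.single ℂ (fun _ => N) i) (F x i) := by
    intro x
    conv_lhs => rw [← Finset.univ_sum_single (F x)]
    simp
  simp only [h]
  exact IsPoly.sum _ fun i _ => hF i _

theorem IsPolyMap.apply {ι : Type*} {F : M → ι → N} (hF : IsPolyMap F) (i : ι) :
    IsPolyMap fun x => F x i :=
  (IsPolyMap.linear (LinearMap.proj (R := ℂ) (φ := fun _ => N) i)).comp hF

theorem IsPolyMap.bilin [FiniteDimensional ℂ N] {N' : Type*} [AddCommGroup N'] [Module ℂ N']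
    (B : N →ₗ[ℂ] N' →ₗ[ℂ] T) {F : M → N} {G : M → N'} (hF : IsPolyMap F) (hG : IsPolyMap G) :
    IsPolyMap fun x => B (F x) (G x) := by
  intro φ
  let b := finBasis ℂ N
  have h : ∀ x, φ (B (F x) (G x)) = ∑ i, b.coord i (F x) * (φ.comp (B (b i))) (G x) := by
    intro x
    conv_lhs => rw [← b.sum_repr (F x)]
    simp only [map_sum, map_smul, LinearMap.sum_apply, LinearMap.smul_apply, smul_eq_mul,
      Basis.coord_apply, LinearMap.comp_apply]
  simp only [h]
  exact IsPoly.sum _ fun i _ => (hF _).mul (hG _)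

theorem IsPolyMap.multilinear [FiniteDimensional ℂ N] {k : ℕ}
    (f : MultilinearMap ℂ (fun _ : Fin k => N) T) : IsPolyMap fun h : Fin k → N => f h := by
  intro φ
  let b := finBasis ℂ N
  have h : ∀ x : Fin k → N, φ (f x) =
      ∑ r : Fin k → Fin (finrank ℂ N), (∏ i, b.coord (r i) (x i)) * φ (f fun i => b (r i)) := by
    intro x
    have : x = fun i => ∑ j, b.coord j (x i) • b j := by
      ext i
      exact (b.sum_repr (x i)).symm
    conv_lhs => rw [this, f.map_sum]
    simp only [MultilinearMap.map_smul_univ, map_sum, map_smul, smul_eq_mul]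
  rw [show (fun x : Fin k → N => φ (f x)) = _ from funext h]
  exact IsPoly.sum _ fun r _ => (IsPoly.prod _ fun i _ => IsPolyMap.id.apply i _).mul
    (IsPoly.const _)

/-- A polynomial function restricted to a line is a polynomial in one variable. -/
theorem IsPoly.exists_line {f : M → ℂ} (hf : IsPoly f) (x v : M) :
    ∃ p : Polynomial ℂ, ∀ t : ℂ, f (x + t • v) = p.eval t := by
  refine IsPoly.induction (P := fun f => ∃ p : Polynomial ℂ, ∀ t : ℂ, f (x + t • v) = p.eval t)
    (fun c => ⟨Polynomial.C c, by simp⟩)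
    (fun φ => ⟨Polynomial.C (φ x) + Polynomial.C (φ v) * Polynomial.X, fun t => by simp; ring⟩)
    ?_ ?_ hf
  · rintro f g ⟨p, hp⟩ ⟨q, hq⟩
    exact ⟨p + q, by simp [hp, hq]⟩
  · rintro f g ⟨p, hp⟩ ⟨q, hq⟩
    exact ⟨p * q, by simp [hp, hq]⟩

/-- On the line through `x` and `y` both functions become nonzero polynomials in one variable. This
is the irreducibility of a vector space, in the form used for parametrizations. -/
theorem IsPoly.exists_ne_zero_of_mul {f g : M → ℂ} (hf : IsPoly f) (hg : IsPoly g) {x y : M}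
    (hx : f x ≠ 0) (hy : g y ≠ 0) : ∃ z, f z ≠ 0 ∧ g z ≠ 0 := by
  obtain ⟨p, hp⟩ := hf.exists_line x (y - x)
  obtain ⟨q, hq⟩ := hg.exists_line x (y - x)
  have hp0 : p ≠ 0 := by
    rintro rfl
    exact hx (by simpa using hp 0)
  have hq0 : q ≠ 0 := by
    rintro rfl
    exact hy (by simpa using hq 1)
  obtain ⟨t, ht⟩ : ∃ t, (p * q).eval t ≠ 0 := by
    by_contra! h
    exact mul_ne_zero hp0 hq0 (Polynomial.funext (by simpa using h))
  rw [Polynomial.eval_mul, ← hp, ← hq] at ht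
  exact ⟨_, left_ne_zero_of_mul ht, right_ne_zero_of_mul ht⟩

/-- A linearly independent family has a dual family of linear forms. -/
theorem exists_dual_family {ι : Type*} [Fintype ι] [DecidableEq ι] {v : ι → T}
    (hv : LinearIndependent ℂ v) :
    ∃ θ : T →ₗ[ℂ] (ι → ℂ), ∀ i, θ (v i) = Pi.single i 1 := by
  obtain ⟨θ, hθ⟩ := (Fintype.linearCombination ℂ v).exists_leftInverse_of_injective
    (LinearMap.ker_eq_bot.2 hv.fintypeLinearCombination_injective)
  refine ⟨θ, fun i => ?_⟩
  have := LinearMap.congr_fun hθ (Pi.single i 1)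
  simpa [Fintype.linearCombination_apply_single] using this

theorem linearIndependent_of_det_ne_zero {ι : Type*} [Fintype ι] [DecidableEq ι] {v : ι → T}
    (θ : T →ₗ[ℂ] (ι → ℂ)) (h : (Matrix.of fun i j => θ (v j) i).det ≠ 0) :
    LinearIndependent ℂ v := by
  have h1 : LinearIndependent ℂ (Matrix.of fun i j => θ (v j) i).col :=
    Matrix.linearIndependent_cols_of_det_ne_zero h
  exact LinearIndependent.of_comp θ h1

/-- Linear independence of polynomially varying vectors is a Zariski open condition. -/
theorem exists_isPoly_linearIndependent {ι : Type*} [Fintype ι] {F : ι → M → T}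
    (hF : ∀ i, IsPolyMap (F i)) {x : M} (hx : LinearIndependent ℂ fun i => F i x) :
    ∃ G : M → ℂ, IsPoly G ∧ G x ≠ 0 ∧ ∀ y, G y ≠ 0 → LinearIndependent ℂ fun i => F i y := by
  classical
  -- `θ` is dual to the family at `x`, so the minor that it defines equals 1 there.
  obtain ⟨θ, hθ⟩ := exists_dual_family hx
  refine ⟨fun y => (Matrix.of fun i j => θ (F j y) i).det, IsPoly.det fun i j => ?_, ?_,
    fun y hy => linearIndependent_of_det_ne_zero θ hy⟩
  · exact hF j ((LinearMap.proj i).comp θ)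
  · have : (Matrix.of fun i j => θ (F j x) i) = (1 : Matrix ι ι ℂ) := by
      ext i j
      simp [hθ, Matrix.one_apply, Pi.single_apply]
    simp [this]

end Poly

/-! ### The Zariski topology of a Grassmannian in terms of frames -/

section Grassmannian

set_option linter.unusedSectionVars false

variable {k : ℕ} {W : Type*} [AddCommGroup W] [Module ℂ W] [FiniteDimensional ℂ W]

/-- The point of the Grassmannian spanned by a linearly independent family. -/
def spanGr (h : Fin k → W) (hh : LinearIndependent ℂ h) : Gr k W :=
  ⟨Submodule.span ℂ (Set.range h), by simpa using finrank_span_eq_card hh⟩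

theorem spanGr_congr {h h' : Fin k → W} (hh : LinearIndependent ℂ h)
    (hh' : LinearIndependent ℂ h') (hs : ∀ i, h i ∈ Submodule.span ℂ (Set.range h')) :
    spanGr h hh = spanGr h' hh' := by
  refine Subtype.ext (Submodule.eq_of_le_of_finrank_eq ?_ ?_)
  · exact Submodule.span_le.2 (by rintro _ ⟨i, rfl⟩; exact hs i)
  · exact (spanGr h hh).2.trans (spanGr h' hh').2.symm

theorem exists_spanGr_eq (H : Gr k W) :
    ∃ h : Fin k → W, ∃ hh : LinearIndependent ℂ h, spanGr h hh = H := by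
  let b := finBasisOfFinrankEq ℂ H.1 H.2
  refine ⟨fun i => (b i : W), b.linearIndependent.map' H.1.subtype (Submodule.ker_subtype _),
    Subtype.ext ?_⟩
  change Submodule.span ℂ (Set.range (H.1.subtype ∘ b)) = H.1
  rw [Set.range_comp, Submodule.span_image, b.span_eq, Submodule.map_top, Submodule.range_subtype]

/-- The wedge of any frame is a nonzero multiple of the Plücker vector. -/
theorem exists_smul_pluckerVector (h : Fin k → W) (hh : LinearIndependent ℂ h) :
    ∃ c : ℂ, c ≠ 0 ∧ pluckerVector (spanGr h hh) = c • exteriorPower.ιMulti ℂ k h := by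
  set H := spanGr h hh
  let b := finBasisOfFinrankEq ℂ H.1 H.2
  let b' : Basis (Fin k) ℂ H.1 := Basis.span hh
  have hb' : ∀ i, (b' i : W) = h i := fun i => congrArg Subtype.val (Basis.span_apply hh i)
  let f : H.1 [⋀^Fin k]→ₗ[ℂ] ⋀[ℂ]^k W := (exteriorPower.ιMulti ℂ k).compLinearMap H.1.subtype
  -- Alternating `k`-forms on a `k`-dimensional space are multiples of the determinant, so `f` is
  -- determined by its value on the basis `b'`.
  have hf : f = (LinearMap.toSpanSingleton ℂ _ (f b')).compAlternatingMap b'.det := by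
    refine Basis.ext_alternating b' fun v hv => ?_
    let σ := Equiv.ofBijective v (Finite.injective_iff_bijective.1 hv)
    have h1 : (fun i => b' (v i)) = b' ∘ σ := rfl
    rw [h1, AlternatingMap.map_perm, AlternatingMap.map_perm]
    simp [Basis.det_self]
  have h2 : pluckerVector H = f b := rfl
  have h3 : f b' = exteriorPower.ιMulti ℂ k h := by
    change exteriorPower.ιMulti ℂ k (fun i => (b' i : W)) = _
    simp only [hb']
  refine ⟨b'.det b, (b'.isUnit_det b).ne_zero, ?_⟩
  rw [h2, hf, ← h3]
  rfl

theorem polyEval_smul {M : Type*} [AddCommGroup M] [Module ℂ M] (c : ℂ) (x : M)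
    {f : MvPolynomial (Dual ℂ M) ℂ} {d : ℕ} (hf : f.IsHomogeneous d) :
    polyEval (c • x) f = c ^ d * polyEval x f := by
  have : (fun φ : Dual ℂ M => φ (c • x)) = fun φ => c * φ x := by
    ext φ
    simp
  rw [polyEval, polyEval, this, MvPolynomial.eval_eq, MvPolynomial.eval_eq, Finset.mul_sum]
  refine Finset.sum_congr rfl fun m hm => ?_
  have h1 : ∑ i ∈ m.support, m i = d := by
    rw [← hf (MvPolynomial.mem_support_iff.1 hm), Finsupp.weight_apply]
    simp [Finsupp.sum]
  simp only [mul_pow, Finset.prod_mul_distrib, Finset.prod_pow_eq_pow_sum, h1]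
  ring

theorem polyEval_smul_eq_zero_iff {M : Type*} [AddCommGroup M] [Module ℂ M] {c : ℂ} (hc : c ≠ 0)
    (x : M) {f : MvPolynomial (Dual ℂ M) ℂ} {d : ℕ} (hf : f.IsHomogeneous d) :
    polyEval (c • x) f = 0 ↔ polyEval x f = 0 := by
  simp [polyEval_smul c x hf, hc]

/-- Frees homogeneous equations from two arbitrary choices: the basis inside `pluckerVector` and the
representative of the projective point. -/
theorem polyEval_plucker_rep (h : Fin k → W) (hh : LinearIndependent ℂ h)
    {f : MvPolynomial (Dual ℂ (⋀[ℂ]^k W)) ℂ} {d : ℕ} (hf : f.IsHomogeneous d) :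
    polyEval (plucker (spanGr h hh)).rep f = 0 ↔
      polyEval (exteriorPower.ιMulti ℂ k h) f = 0 := by
  obtain ⟨c, hc, hc'⟩ := exists_smul_pluckerVector h hh
  obtain ⟨a, ha⟩ := Projectivization.exists_smul_eq_mk_rep ℂ (pluckerVector (spanGr h hh))
    (pluckerVector_ne_zero _)
  have h1 : (plucker (spanGr h hh)).rep = ((a : ℂ) * c) • exteriorPower.ιMulti ℂ k h := by
    rw [plucker, ← ha, hc', Units.smul_def, smul_smul]
  rw [h1, polyEval_smul_eq_zero_iff (mul_ne_zero a.ne_zero hc) _ hf]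

theorem isClosed_projZariski_iff {M : Type*} [AddCommGroup M] [Module ℂ M] {Z : Set (ℙ ℂ M)} :
    @IsClosed _ (projZariski M) Z ↔ ∃ S : Set (MvPolynomial (Dual ℂ M) ℂ),
      (∀ f ∈ S, ∃ d : ℕ, f.IsHomogeneous d) ∧ Z = projZeroLocus S := by
  rw [← @isOpen_compl_iff _ _ (projZariski M)]
  change Zᶜᶜ ∈ _ ↔ _
  rw [compl_compl]
  rfl

theorem isOpen_polyEval_ne_zero {f : MvPolynomial (Dual ℂ (⋀[ℂ]^k W)) ℂ} {d : ℕ}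
    (hf : f.IsHomogeneous d) : IsOpen {H : Gr k W | polyEval (plucker H).rep f ≠ 0} := by
  let _ := projZariski (⋀[ℂ]^k W)
  have h1 : IsClosed (projZeroLocus {f}) :=
    isClosed_projZariski_iff.2 ⟨{f}, by rintro _ rfl; exact ⟨d, hf⟩, rfl⟩
  have h2 := (h1.preimage (continuous_induced_dom (f := plucker (k := k) (W := W)))).isOpen_compl
  convert! h2 using 1
  ext H
  simp [projZeroLocus]

/-- The preimage in the space of frames of an open subset of the Grassmannian is open. -/
theorem exists_isPoly_of_isOpen {O : Set (Gr k W)} (hO : IsOpen O) (h : Fin k → W)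
    (hh : LinearIndependent ℂ h) (hmem : spanGr h hh ∈ O) :
    ∃ G : (Fin k → W) → ℂ, IsPoly G ∧ G h ≠ 0 ∧
      ∀ h' (hh' : LinearIndependent ℂ h'), G h' ≠ 0 → spanGr h' hh' ∈ O := by
  let _ := projZariski (⋀[ℂ]^k W)
  obtain ⟨O', hO', rfl⟩ := isOpen_induced_iff.1 hO
  obtain ⟨S, hS, hSO⟩ := isClosed_projZariski_iff.1 hO'.isClosed_compl
  have h1 : plucker (spanGr h hh) ∉ projZeroLocus S := by
    rw [← hSO]
    simpa using hmem
  obtain ⟨f, hf, hf0⟩ : ∃ f ∈ S, polyEval (plucker (spanGr h hh)).rep f ≠ 0 := by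
    simpa [projZeroLocus] using h1
  obtain ⟨d, hd⟩ := hS f hf
  refine ⟨fun h => polyEval (exteriorPower.ιMulti ℂ k h) f,
    IsPoly.comp ⟨f, fun _ => rfl⟩
      (IsPolyMap.multilinear (exteriorPower.ιMulti ℂ k).toMultilinearMap),
    (polyEval_plucker_rep h hh hd).not.1 hf0, fun h' hh' hne => ?_⟩
  by_contra hcon
  have h2 : plucker (spanGr h' hh') ∈ projZeroLocus S := by
    rw [← hSO]
    simpa using hcon
  exact hne ((polyEval_plucker_rep h' hh' hd).1 (h2 f hf))

/-- The matrix of the values of `k` linear forms on `k` vectors. -/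
def evalMatrix (π : Fin k → Dual ℂ W) (h : Fin k → W) : Matrix (Fin k) (Fin k) ℂ :=
  Matrix.of fun i j => π i (h j)

/-- The combination of the vectors `h` by the inverse of the matrix `evalMatrix π h`. -/
def normalizeFrame (π : Fin k → Dual ℂ W) (h : Fin k → W) : Fin k → W :=
  fun j => ∑ i, (evalMatrix π h)⁻¹ i j • h i

/-- The linear form on `⋀ᵏ W` given by `k` linear forms on `W`. -/
def wedgeForm (π : Fin k → Dual ℂ W) : Dual ℂ (⋀[ℂ]^k W) :=
  exteriorPower.pairingDual ℂ W k (exteriorPower.ιMulti ℂ k π)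

theorem wedgeForm_ιMulti (π : Fin k → Dual ℂ W) (h : Fin k → W) :
    wedgeForm π (exteriorPower.ιMulti ℂ k h) = (evalMatrix π h).det := by
  rw [wedgeForm, exteriorPower.pairingDual_ιMulti_ιMulti, ← Matrix.det_transpose]
  rfl

theorem evalMatrix_update (π : Fin k → Dual ℂ W) (h : Fin k → W) (j : Fin k) (ℓ : Dual ℂ W) :
    evalMatrix (Function.update π j ℓ) h = (evalMatrix π h).updateRow j fun i => ℓ (h i) := by
  ext a b
  by_cases hab : a = j
  · subst hab
    simp [evalMatrix]
  · simp [evalMatrix, hab]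

/-- Cramer's rule: the coordinates of the normalized frame are quotients of two Plücker coordinates,
the numerator having `ℓ` in place of `π j`. -/
theorem apply_normalizeFrame (π : Fin k → Dual ℂ W) (h : Fin k → W)
    (hd : (evalMatrix π h).det ≠ 0) (ℓ : Dual ℂ W) (j : Fin k) :
    ℓ (normalizeFrame π h j) * (evalMatrix π h).det =
      (evalMatrix (Function.update π j ℓ) h).det := by
  rw [evalMatrix_update, ← Matrix.cramer_transpose_apply, Matrix.cramer_eq_adjugate_mulVec,
    ← Matrix.adjugate_transpose]
  simp only [normalizeFrame, map_sum, map_smul, smul_eq_mul, Matrix.mulVec, dotProduct,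
    Matrix.transpose_apply, Finset.sum_mul, Matrix.inv_def, Ring.inverse_eq_inv', Matrix.smul_apply]
  refine Finset.sum_congr rfl fun i _ => ?_
  field_simp

theorem evalMatrix_normalizeFrame (π : Fin k → Dual ℂ W) (h : Fin k → W)
    (hd : (evalMatrix π h).det ≠ 0) (i j : Fin k) :
    π i (normalizeFrame π h j) = if i = j then 1 else 0 := by
  have h1 : evalMatrix π h * (evalMatrix π h)⁻¹ = 1 :=
    Matrix.mul_nonsing_inv _ (Ne.isUnit hd)
  have h2 := congrFun (congrFun h1 i) j
  rw [Matrix.one_apply] at h2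
  rw [← h2, Matrix.mul_apply]
  simp [normalizeFrame, evalMatrix, mul_comm]

theorem linearIndependent_of_dual {π : Fin k → Dual ℂ W} {h : Fin k → W}
    (hπ : ∀ i j, π i (h j) = if i = j then 1 else 0) : LinearIndependent ℂ h := by
  refine linearIndependent_of_det_ne_zero (LinearMap.pi π) ?_
  have : (Matrix.of fun i j => LinearMap.pi π (h j) i) = (1 : Matrix (Fin k) (Fin k) ℂ) := by
    ext i j
    simp [hπ, Matrix.one_apply]
  rw [this, Matrix.det_one]
  exact one_ne_zero

theorem spanGr_normalizeFrame (π : Fin k → Dual ℂ W) (h : Fin k → W) (hh : LinearIndependent ℂ h)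
    (hd : (evalMatrix π h).det ≠ 0) :
    spanGr (normalizeFrame π h) (linearIndependent_of_dual (evalMatrix_normalizeFrame π h hd)) =
      spanGr h hh :=
  spanGr_congr _ _ fun _ => Submodule.sum_mem _ fun i _ =>
    Submodule.smul_mem _ _ (Submodule.subset_span ⟨i, rfl⟩)

theorem normalizeFrame_of_dual {π : Fin k → Dual ℂ W} {h : Fin k → W}
    (hπ : ∀ i j, π i (h j) = if i = j then 1 else 0) :
    evalMatrix π h = 1 ∧ normalizeFrame π h = h := by
  have h1 : evalMatrix π h = 1 := by
    ext i j
    simp [evalMatrix, hπ, Matrix.one_apply]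
  refine ⟨h1, funext fun j => ?_⟩
  simp [normalizeFrame, h1, Matrix.one_apply]

/-- A polynomial function of the normalized frame is a quotient of homogeneous polynomials in the
Plücker coordinates. -/
theorem exists_homogeneous_normalizeFrame (π : Fin k → Dual ℂ W) {f : (Fin k → W) → ℂ}
    (hf : IsPoly f) :
    ∃ (N : ℕ) (F : MvPolynomial (Dual ℂ (⋀[ℂ]^k W)) ℂ), F.IsHomogeneous N ∧
      ∀ h, (evalMatrix π h).det ≠ 0 →
        polyEval (exteriorPower.ιMulti ℂ k h) F =
          (evalMatrix π h).det ^ N * f (normalizeFrame π h) := by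
  have hX : ∀ h, polyEval (exteriorPower.ιMulti ℂ k h) (MvPolynomial.X (wedgeForm π)) =
      (evalMatrix π h).det := fun h => by simp [polyEval, wedgeForm_ιMulti]
  refine IsPoly.induction (P := fun f => ∃ (N : ℕ) (F : MvPolynomial (Dual ℂ (⋀[ℂ]^k W)) ℂ),
    F.IsHomogeneous N ∧ ∀ h, (evalMatrix π h).det ≠ 0 →
        polyEval (exteriorPower.ιMulti ℂ k h) F =
          (evalMatrix π h).det ^ N * f (normalizeFrame π h)) ?_ ?_ ?_ ?_ hf
  · exact fun c => ⟨0, MvPolynomial.C c, MvPolynomial.isHomogeneous_C _ _,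
      fun h _ => by simp [polyEval]⟩
  · intro ℓ
    let ℓ' : Fin k → Dual ℂ W := fun j => ℓ.comp (LinearMap.single ℂ (fun _ => W) j)
    refine ⟨1, MvPolynomial.X (∑ j, wedgeForm (Function.update π j (ℓ' j))),
      MvPolynomial.isHomogeneous_X _ _, fun h hd => ?_⟩
    have h1 : ℓ (normalizeFrame π h) = ∑ j, ℓ' j (normalizeFrame π h j) := by
      conv_lhs => rw [← Finset.univ_sum_single (normalizeFrame π h)]
      simp [ℓ']
    simp only [polyEval, MvPolynomial.eval_X, LinearMap.sum_apply, wedgeForm_ιMulti, h1, pow_one,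
      Finset.mul_sum]
    exact Finset.sum_congr rfl fun j _ => by rw [← apply_normalizeFrame π h hd, mul_comm]
  · rintro f g ⟨N, F, hF, hF'⟩ ⟨N', F', hG, hG'⟩
    -- Powers of the denominator bring both summands to the common degree `N + N'`.
    refine ⟨N + N', F * MvPolynomial.X (wedgeForm π) ^ N' + F' * MvPolynomial.X (wedgeForm π) ^ N,
      (hF.mul (MvPolynomial.isHomogeneous_X_pow _ _)).add ?_, fun h hd => ?_⟩
    · rw [add_comm N N']
      exact hG.mul (MvPolynomial.isHomogeneous_X_pow _ _)
    · have h1 := hF' h hd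
      have h2 := hG' h hd
      have h3 := hX h
      simp only [polyEval, map_add, map_mul, map_pow] at h1 h2 h3 ⊢
      rw [h1, h2, h3]
      ring
  · rintro f g ⟨N, F, hF, hF'⟩ ⟨N', F', hG, hG'⟩
    refine ⟨N + N', F * F', hF.mul hG, fun h hd => ?_⟩
    have h1 := hF' h hd
    have h2 := hG' h hd
    simp only [polyEval, map_mul] at h1 h2 ⊢
    rw [h1, h2]
    ring

theorem exists_dual_frame {h : Fin k → W} (hh : LinearIndependent ℂ h) :
    ∃ π : Fin k → Dual ℂ W, ∀ i j, π i (h j) = if i = j then 1 else 0 := by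
  obtain ⟨θ, hθ⟩ := exists_dual_family hh
  refine ⟨fun i => (LinearMap.proj i).comp θ, fun i j => ?_⟩
  simp [hθ, Pi.single_apply]

/-- Nonvanishing of a polynomial function of the normalized frame is an open condition. -/
theorem exists_isOpen_normalizeFrame (π : Fin k → Dual ℂ W) {f : (Fin k → W) → ℂ}
    (hf : IsPoly f) :
    ∃ O : Set (Gr k W), IsOpen O ∧ ∀ h (hh : LinearIndependent ℂ h),
      spanGr h hh ∈ O ↔ (evalMatrix π h).det ≠ 0 ∧ f (normalizeFrame π h) ≠ 0 := by
  obtain ⟨N, F, hF, hF'⟩ := exists_homogeneous_normalizeFrame π hf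
  -- The extra factor is the denominator itself, so that nonvanishing of the product includes
  -- `(evalMatrix π h).det ≠ 0`.
  have hom : (F * MvPolynomial.X (wedgeForm π)).IsHomogeneous (N + 1) :=
    hF.mul (MvPolynomial.isHomogeneous_X _ _)
  refine ⟨_, isOpen_polyEval_ne_zero hom, fun h hh => ?_⟩
  change polyEval (plucker (spanGr h hh)).rep _ ≠ 0 ↔ _
  rw [(polyEval_plucker_rep h hh hom).ne]
  by_cases hd : (evalMatrix π h).det = 0
  · simp [polyEval, wedgeForm_ιMulti, hd]
  · have h1 := hF' h hd
    simp only [polyEval, map_mul, MvPolynomial.eval_X, wedgeForm_ιMulti] at h1 ⊢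
    rw [h1]
    simp [hd]

/-- A subset of the Grassmannian is open if its preimage in the space of frames is. -/
theorem isOpen_of_forall_exists_isPoly {E : Set (Gr k W)}
    (hE : ∀ H ∈ E, ∃ (h : Fin k → W) (hh : LinearIndependent ℂ h), spanGr h hh = H ∧
      ∃ G : (Fin k → W) → ℂ, IsPoly G ∧ G h ≠ 0 ∧
        ∀ h' (hh' : LinearIndependent ℂ h'), G h' ≠ 0 → spanGr h' hh' ∈ E) : IsOpen E := by
  refine isOpen_iff_forall_mem_open.2 fun H hH => ?_
  obtain ⟨h, hh, rfl, G, hG, hGh, hGE⟩ := hE H hH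
  -- `G` need not be invariant under change of frame. It is therefore evaluated at the frame
  -- normalized by `π`, which has the same span and is `h` itself at the given point.
  obtain ⟨π, hπ⟩ := exists_dual_frame hh
  obtain ⟨O, hO, hO'⟩ := exists_isOpen_normalizeFrame π hG
  refine ⟨O, fun H' hH' => ?_, hO, ?_⟩
  · obtain ⟨h', hh', rfl⟩ := exists_spanGr_eq H'
    obtain ⟨hd, hne⟩ := (hO' h' hh').1 hH'
    rw [← spanGr_normalizeFrame π h' hh' hd]
    exact hGE _ _ hne
  · rw [hO' h hh, (normalizeFrame_of_dual hπ).1, (normalizeFrame_of_dual hπ).2]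
    simpa using hGh

end Grassmannian

/-! ### Affine space with its Zariski topology -/

section Affine

open MvPolynomial

/-- The affine space `ℂⁿ`, with the Zariski topology. -/
structure AffSp (n : ℕ) where
  /-- The coordinates of a point. -/
  coords : Fin n → ℂ

/-- Points are sent to their maximal ideals, so that the dimension theory of polynomial rings
applies. The wrapper type keeps this topology apart from the classical one on `Fin n → ℂ`, which is
needed for the implicit function theorem. -/
instance affZariski (n : ℕ) : TopologicalSpace (AffSp n) :=
  TopologicalSpace.induced (fun x => pointToPoint (k := ℂ) (K := ℂ) x.coords) inferInstance

/-- The value of a polynomial at a point of affine space. -/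
def affEval {n : ℕ} (x : AffSp n) (f : MvPolynomial (Fin n) ℂ) : ℂ := eval x.coords f

variable {n : ℕ}

theorem isOpen_affSp_iff {O : Set (AffSp n)} :
    IsOpen O ↔ ∀ x ∈ O, ∃ f : MvPolynomial (Fin n) ℂ, affEval x f ≠ 0 ∧
      ∀ y, affEval y f ≠ 0 → y ∈ O := by
  have hb := PrimeSpectrum.isTopologicalBasis_basic_opens (R := MvPolynomial (Fin n) ℂ)
  have hb' := hb.induced fun x : AffSp n => pointToPoint (k := ℂ) (K := ℂ) x.coords
  have key : ∀ (f : MvPolynomial (Fin n) ℂ) (x : AffSp n),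
      x ∈ (fun x : AffSp n => pointToPoint (k := ℂ) (K := ℂ) x.coords) ⁻¹'
        (PrimeSpectrum.basicOpen f) ↔
        affEval x f ≠ 0 := by
    intro f x
    change f ∉ vanishingIdeal ℂ {x.coords} ↔ _
    rw [mem_vanishingIdeal_singleton_iff]
    rfl
  rw [hb'.isOpen_iff]
  refine forall₂_congr fun x _ => ⟨?_, ?_⟩
  · rintro ⟨_, ⟨_, ⟨f, rfl⟩, rfl⟩, hx, hO⟩
    exact ⟨f, (key f x).1 hx, fun y hy => hO ((key f y).2 hy)⟩
  · rintro ⟨f, hx, hO⟩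
    exact ⟨_, ⟨_, ⟨f, rfl⟩, rfl⟩, (key f x).2 hx, fun y hy => hO y ((key f y).1 hy)⟩

theorem isClosed_affEval_eq_zero (f : MvPolynomial (Fin n) ℂ) :
    IsClosed {x : AffSp n | affEval x f = 0} := by
  rw [← isOpen_compl_iff, isOpen_affSp_iff]
  exact fun x hx => ⟨f, hx, fun y hy => hy⟩

theorem IsPoly.exists_eval {f : (Fin n → ℂ) → ℂ} (hf : IsPoly f) :
    ∃ p : MvPolynomial (Fin n) ℂ, ∀ x : Fin n → ℂ, f x = eval x p := by
  refine IsPoly.induction (P := fun f => ∃ p : MvPolynomial (Fin n) ℂ,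
    ∀ x : Fin n → ℂ, f x = eval x p) (fun c => ⟨C c, by simp⟩) ?_ ?_ ?_ hf
  · refine fun φ => ⟨∑ i, C (φ (Pi.single i 1)) * X i, fun x => ?_⟩
    conv_lhs => rw [pi_eq_sum_univ' x]
    simp only [map_sum, map_smul, smul_eq_mul, map_mul, eval_C, eval_X]
    exact Finset.sum_congr rfl fun i _ => mul_comm _ _
  · rintro f g ⟨p, hp⟩ ⟨q, hq⟩
    exact ⟨p + q, fun x => by simp [hp, hq]⟩
  · rintro f g ⟨p, hp⟩ ⟨q, hq⟩
    exact ⟨p * q, fun x => by simp [hp, hq]⟩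

theorem isPoly_eval (p : MvPolynomial (Fin n) ℂ) :
    IsPoly fun x : Fin n → ℂ => eval x p := by
  induction p using MvPolynomial.induction_on with
  | C c => simpa using IsPoly.const c
  | add p q hp hq => simpa using hp.add hq
  | mul_X p i hp => simpa using hp.mul (IsPoly.linear (LinearMap.proj i))

theorem topologicalKrullDim_affSp_le (n : ℕ) : topologicalKrullDim (AffSp n) ≤ n := by
  have h1 : Topology.IsInducing (fun x : AffSp n => pointToPoint (k := ℂ) (K := ℂ) x.coords) :=
    ⟨rfl⟩
  refine h1.topologicalKrullDim_le.trans ?_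
  rw [PrimeSpectrum.topologicalKrullDim_eq_ringKrullDim, ringKrullDim_of_isNoetherianRing,
    ringKrullDim_eq_zero_of_field]
  simp

/-- Translation of polynomials. -/
def translateEquiv (v : Fin n → ℂ) : MvPolynomial (Fin n) ℂ ≃ₐ[ℂ] MvPolynomial (Fin n) ℂ :=
  AlgEquiv.ofAlgHom (aeval fun i => X i + C (v i)) (aeval fun i => X i - C (v i))
    (by ext i; simp) (by ext i; simp)

/-- By the Nullstellensatz all maximal ideals are ideals of points, and translations permute the
points transitively. So all have the same height, which must be the Krull dimension `n` of the ring.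
-/
theorem height_vanishingIdeal_singleton (x : Fin n → ℂ) :
    (vanishingIdeal ℂ {x} : Ideal (MvPolynomial (Fin n) ℂ)).height = n := by
  have hdim : ringKrullDim (MvPolynomial (Fin n) ℂ) = n := by
    rw [ringKrullDim_of_isNoetherianRing, ringKrullDim_eq_zero_of_field]
    simp
  have htr : ∀ y : Fin n → ℂ, (vanishingIdeal ℂ {y} : Ideal (MvPolynomial (Fin n) ℂ)).height =
      (vanishingIdeal ℂ {x} : Ideal (MvPolynomial (Fin n) ℂ)).height := by
    intro y
    rw [← (translateEquiv (x - y)).toRingEquiv.height_comap (vanishingIdeal ℂ {y})]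
    congr 1
    ext f
    rw [Ideal.mem_comap, mem_vanishingIdeal_singleton_iff, mem_vanishingIdeal_singleton_iff]
    have : aeval y ((translateEquiv (x - y)) f) = aeval x f := by
      have h2 : (aeval y).comp (translateEquiv (x - y)).toAlgHom =
          (aeval x : MvPolynomial (Fin n) ℂ →ₐ[ℂ] ℂ) := by
        ext i
        simp [translateEquiv]
      exact DFunLike.congr_fun h2 f
    change aeval y ((translateEquiv (x - y)) f) = 0 ↔ _
    rw [this]
  have hle : ((vanishingIdeal ℂ {x} : Ideal (MvPolynomial (Fin n) ℂ)).height : WithBot ℕ∞) ≤ n := by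
    rw [← hdim]
    exact Ideal.height_le_ringKrullDim_of_ne_top (Ideal.IsPrime.ne_top inferInstance)
  have hge : (n : WithBot ℕ∞) ≤
      ((vanishingIdeal ℂ {x} : Ideal (MvPolynomial (Fin n) ℂ)).height : WithBot ℕ∞) := by
    rw [← hdim, ringKrullDim_le_iff_isMaximal_height_le]
    intro I hI
    obtain ⟨y, rfl⟩ := eq_vanishingIdeal_singleton_of_isMaximal ℂ hI
    rw [htr y]
  have := le_antisymm hle hge
  exact_mod_cast this

/-- A nonempty principal open subset of the zero locus of `r` polynomials in `ℂⁿ` has dimension at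
least `n - r`. -/
theorem le_topologicalKrullDim_zeroLocus (s : Set (MvPolynomial (Fin n) ℂ))
    (g : MvPolynomial (Fin n) ℂ) (x : AffSp n) (hs : ∀ f ∈ s, affEval x f = 0)
    (hg : affEval x g ≠ 0) :
    (n : WithBot ℕ∞) ≤ topologicalKrullDim
      {y : AffSp n | (∀ f ∈ s, affEval y f = 0) ∧ affEval y g ≠ 0} + (s.encard : WithBot ℕ∞) := by
  set T := {y : AffSp n | (∀ f ∈ s, affEval y f = 0) ∧ affEval y g ≠ 0}
  set m : Ideal (MvPolynomial (Fin n) ℂ) := vanishingIdeal ℂ {x.coords}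
  have hsm : s ⊆ m := fun f hf => (mem_vanishingIdeal_singleton_iff _ _).2 (hs f hf)
  have hmp : m.IsPrime := inferInstanceAs (vanishingIdeal ℂ {x.coords}).IsPrime
  -- Krull's height theorem: modulo `s` the height of `m` drops by at most the number of equations.
  -- It remains to turn chains of primes below `m` in the quotient into chains of closed subsets of
  -- `T`.
  have h1 := Ideal.height_le_height_add_encard_of_subset s hsm
  rw [height_vanishingIdeal_singleton] at h1
  set I := Ideal.span s
  have hIm : I ≤ m := Ideal.span_le.2 hsm
  let mk := Ideal.Quotient.mk I
  have hmk : Function.Surjective mk := Ideal.Quotient.mk_surjective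
  have hprime : (m.map mk).IsPrime := Ideal.map_isPrime_of_surjective hmk (by
    rw [Ideal.mk_ker]
    exact hIm)
  let q : PrimeSpectrum (MvPolynomial (Fin n) ℂ ⧸ I) := ⟨m.map mk, hprime⟩
  have hq : (m.map mk).height = Order.height q := PrimeSpectrum.height_eq_orderHeight q
  have hcomap : ∀ P : Set.Iic q, P.1.asIdeal.comap mk ≤ m := by
    intro P
    have h2 : P.1.asIdeal ≤ m.map mk := P.2
    refine (Ideal.comap_mono h2).trans ?_
    rw [Ideal.comap_map_of_surjective mk hmk, ← RingHom.ker_eq_comap_bot, Ideal.mk_ker]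
    exact sup_le le_rfl hIm
  have hIP : ∀ P : Set.Iic q, I ≤ P.1.asIdeal.comap mk := by
    intro P
    conv_lhs => rw [← Ideal.mk_ker (I := I), RingHom.ker_eq_comap_bot]
    exact Ideal.comap_mono bot_le
  -- Since `g` does not vanish at `x`, removing its zeros loses none of the primes contained in the
  -- ideal of `x`.
  have hgP : ∀ P : Set.Iic q, g ∉ P.1.asIdeal.comap mk := fun P hP =>
    hg ((mem_vanishingIdeal_singleton_iff _ _).1 (hcomap P hP))
  -- Nullstellensatz: a polynomial outside a prime is nonzero at some point of its zero locus.
  -- Applied to products, it gives irreducibility; applied to `f * g`, strictness of the chain.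
  have hnull : ∀ (P : Set.Iic q) (f : MvPolynomial (Fin n) ℂ), f ∉ P.1.asIdeal.comap mk →
      ∃ y : AffSp n, (∀ f' ∈ P.1.asIdeal.comap mk, affEval y f' = 0) ∧ affEval y f ≠ 0 := by
    intro P f hf
    by_contra! hcon
    apply hf
    have hPr : (P.1.asIdeal.comap mk).IsPrime := Ideal.IsPrime.comap mk
    rw [← IsPrime.vanishingIdeal_zeroLocus (K := ℂ) (P.1.asIdeal.comap mk)]
    exact fun y hy => hcon ⟨y⟩ hy
  have hT : ∀ (P : Set.Iic q) (y : AffSp n), (∀ f' ∈ P.1.asIdeal.comap mk, affEval y f' = 0) →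
      affEval y g ≠ 0 → y ∈ T := fun P y hy hgy =>
    ⟨fun f hf => hy f (hIP P (Ideal.subset_span hf)), hgy⟩
  let Z : Set.Iic q → TopologicalSpace.IrreducibleCloseds T := fun P =>
    { carrier := {y | ∀ f ∈ P.1.asIdeal.comap mk, affEval y.1 f = 0}
      isIrreducible' := by
        have hPr : (P.1.asIdeal.comap mk).IsPrime := Ideal.IsPrime.comap mk
        constructor
        · obtain ⟨y, hy, hy'⟩ := hnull P g (hgP P)
          exact ⟨⟨y, hT P y hy hy'⟩, hy⟩
        · rintro _ _ ⟨O₁, hO₁, rfl⟩ ⟨O₂, hO₂, rfl⟩ ⟨y₁, hy₁, hy₁'⟩ ⟨y₂, hy₂, hy₂'⟩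
          obtain ⟨f₁, hf₁, hf₁'⟩ := isOpen_affSp_iff.1 hO₁ _ hy₁'
          obtain ⟨f₂, hf₂, hf₂'⟩ := isOpen_affSp_iff.1 hO₂ _ hy₂'
          have h3 : f₁ * f₂ * g ∉ P.1.asIdeal.comap mk := by
            intro h
            rcases hPr.mem_or_mem h with h | h
            · rcases hPr.mem_or_mem h with h | h
              · exact hf₁ (hy₁ f₁ h)
              · exact hf₂ (hy₂ f₂ h)
            · exact hgP P h
          obtain ⟨y, hy, hy'⟩ := hnull P _ h3
          simp only [affEval, map_mul] at hy'
          exact ⟨⟨y, hT P y hy (right_ne_zero_of_mul hy')⟩, hy,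
            hf₁' y (left_ne_zero_of_mul (left_ne_zero_of_mul hy')),
            hf₂' y (right_ne_zero_of_mul (left_ne_zero_of_mul hy'))⟩
      isClosed' := by
        have : {y : T | ∀ f ∈ P.1.asIdeal.comap mk, affEval y.1 f = 0} =
            ⋂ f ∈ P.1.asIdeal.comap mk, Subtype.val ⁻¹' {y : AffSp n | affEval y f = 0} := by
          ext y
          simp
        rw [this]
        exact isClosed_biInter fun f _ => (isClosed_affEval_eq_zero f).preimage
          continuous_subtype_val }
  -- Larger primes have smaller zero loci, hence the order dual; the Krull dimension of an order is
  -- unaffected by it.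
  have hZ : StrictMono fun P : Set.Iic q => OrderDual.toDual (Z P) := by
    intro P Q hPQ
    refine lt_of_le_not_ge ?_ ?_
    · intro y hy f hf
      exact hy f (Ideal.comap_mono (show P.1.asIdeal ≤ Q.1.asIdeal from hPQ.le) hf)
    · intro hle
      apply hPQ.not_ge
      change Q.1.asIdeal ≤ P.1.asIdeal
      have hPr : (P.1.asIdeal.comap mk).IsPrime := Ideal.IsPrime.comap mk
      intro z hz
      obtain ⟨f, rfl⟩ := hmk z
      by_contra hfP
      have h4 : f * g ∉ P.1.asIdeal.comap mk := fun h =>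
        (hPr.mem_or_mem h).elim hfP (hgP P)
      obtain ⟨y, hy, hy'⟩ := hnull P _ h4
      simp only [affEval, map_mul] at hy'
      have h5 : (⟨y, hT P y hy (right_ne_zero_of_mul hy')⟩ : T) ∈ Z P := hy
      exact left_ne_zero_of_mul hy' (hle h5 f hz)
  have h6 := Order.krullDim_le_of_strictMono _ hZ
  rw [Order.krullDim_orderDual, ← Order.height_eq_krullDim_Iic, ← hq] at h6
  calc (n : WithBot ℕ∞) = ((n : ℕ∞) : WithBot ℕ∞) := rfl
    _ ≤ (((m.map mk).height + s.encard : ℕ∞) : WithBot ℕ∞) := WithBot.coe_le_coe.2 h1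
    _ = ((m.map mk).height : WithBot ℕ∞) + (s.encard : WithBot ℕ∞) := rfl
    _ ≤ _ := add_le_add h6 le_rfl

end Affine

/-- The dimension of a space covered by open embeddings. -/
theorem topologicalKrullDim_le_of_forall_exists_isOpenEmbedding {X Y : Type*} [TopologicalSpace X]
    [TopologicalSpace Y] (h : ∀ x : X, ∃ f : Y → X, Topology.IsOpenEmbedding f ∧ x ∈ Set.range f) :
    topologicalKrullDim X ≤ topologicalKrullDim Y := by
  refine iSup_le fun p => ?_
  -- A chart around a point of the smallest member meets every member of the chain, and irreducible
  -- closed sets meeting an open set correspond to those of the open set.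
  obtain ⟨x, hx⟩ := p.head.isIrreducible.nonempty
  obtain ⟨f, hf, y, rfl⟩ := h x
  have hmem : ∀ i, p i ∈ {V : TopologicalSpace.IrreducibleCloseds X | (f ⁻¹' V).Nonempty} :=
    fun i => ⟨y, p.head_le i hx⟩
  let e := TopologicalSpace.IrreducibleCloseds.orderIsoOfIsOpenEmbedding f hf
  let p' : LTSeries (TopologicalSpace.IrreducibleCloseds Y) :=
    { length := p.length
      toFun := fun i => e.symm ⟨p i, hmem i⟩
      step := fun i => e.symm.strictMono (p.step i) }
  exact Order.LTSeries.length_le_krullDim p'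

/-! ### Affine charts of a Grassmannian -/

section Charts

set_option linter.unusedSectionVars false

variable {k n : ℕ} {W : Type*} [AddCommGroup W] [Module ℂ W] [FiniteDimensional ℂ W]
  {π : Fin k → Dual ℂ W} {h : Fin k → W}

theorem dual_add_ker (hπ : ∀ i j, π i (h j) = if i = j then 1 else 0)
    (x : Fin k → LinearMap.ker (LinearMap.pi π)) (i j : Fin k) :
    π i (h j + (x j : W)) = if i = j then 1 else 0 := by
  have := congrFun (LinearMap.mem_ker.1 (x j).2) i
  rw [LinearMap.pi_apply] at this
  rw [map_add, hπ, this]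
  simp

/-- The affine chart of the Grassmannian around the span of `h`. -/
def chart (hπ : ∀ i j, π i (h j) = if i = j then 1 else 0)
    (e : (Fin n → ℂ) ≃ₗ[ℂ] (Fin k → LinearMap.ker (LinearMap.pi π))) (x : AffSp n) : Gr k W :=
  spanGr (fun j => h j + (e x.coords j : W))
    (linearIndependent_of_dual (dual_add_ker hπ (e x.coords)))

/-- The projection to the common kernel of the linear forms `π` along the span of `h`. -/
def kerProj (hπ : ∀ i j, π i (h j) = if i = j then 1 else 0) :
    W →ₗ[ℂ] LinearMap.ker (LinearMap.pi π) :=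
  LinearMap.codRestrict _ (LinearMap.id - ∑ i, (π i).smulRight (h i)) (by
    intro w
    rw [LinearMap.mem_ker]
    ext j
    simp [hπ])

theorem isPolyMap_chartFrame (e : (Fin n → ℂ) ≃ₗ[ℂ] (Fin k → LinearMap.ker (LinearMap.pi π))) :
    IsPolyMap fun (x : Fin n → ℂ) (j : Fin k) => h j + (e x j : W) :=
  IsPolyMap.pi fun j => (IsPolyMap.const (h j)).add (IsPolyMap.linear
    ((LinearMap.ker (LinearMap.pi π)).subtype.comp ((LinearMap.proj j).comp e.toLinearMap)))

/-- A plane on which the forms `π` are independent has exactly one frame dual to `π`, and `r` reads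
the chart coordinates off that frame. Continuity pulls polynomials back along the chart frame;
openness pulls them back along `normalizeFrame`. -/
theorem isOpenEmbedding_chart (hπ : ∀ i j, π i (h j) = if i = j then 1 else 0)
    (e : (Fin n → ℂ) ≃ₗ[ℂ] (Fin k → LinearMap.ker (LinearMap.pi π))) :
    Topology.IsOpenEmbedding (chart hπ e) := by
  let r : (Fin k → W) →ₗ[ℂ] (Fin n → ℂ) :=
    e.symm.toLinearMap.comp (LinearMap.pi fun j => (kerProj hπ).comp (LinearMap.proj j))
  have hr : ∀ h', (∀ i j, π i (h' j) = if i = j then 1 else 0) →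
      (fun j => h j + (e (r h') j : W)) = h' := by
    intro h' hh'
    ext j
    simp [r, kerProj, hh']
  have hr' : ∀ x : Fin n → ℂ, r (fun j => h j + (e x j : W)) = x := by
    intro x
    apply e.injective
    ext j
    have := congrFun (LinearMap.mem_ker.1 (e x j).2)
    simp only [LinearMap.pi_apply, Pi.zero_apply] at this
    simp [r, kerProj, hπ, this]
  refine .of_continuous_injective_isOpenMap ?_ ?_ ?_
  · refine continuous_def.2 fun O hO => isOpen_affSp_iff.2 fun x hx => ?_
    obtain ⟨G, hG, hGx, hGO⟩ := exists_isPoly_of_isOpen hO _ _ hx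
    obtain ⟨p, hp⟩ := (hG.comp (isPolyMap_chartFrame (h := h) e)).exists_eval
    refine ⟨p, ?_, fun y hy => hGO _ _ ?_⟩
    · rw [affEval, ← hp]
      exact hGx
    · rwa [affEval, ← hp] at hy
  · rintro ⟨x⟩ ⟨y⟩ hxy
    have h2 : ∀ j, h j + (e y j : W) = h j + (e x j : W) := by
      intro j
      have hmem : h j + (e y j : W) ∈
          Submodule.span ℂ (Set.range fun j => h j + (e x j : W)) := by
        have h3 : (chart hπ e ⟨x⟩).1 = (chart hπ e ⟨y⟩).1 := by rw [hxy]
        change h j + (e y j : W) ∈ (chart hπ e ⟨x⟩).1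
        rw [h3]
        exact Submodule.subset_span ⟨j, rfl⟩
      obtain ⟨c, hc⟩ := (Submodule.mem_span_range_iff_exists_fun ℂ).1 hmem
      have h4 : ∀ i, c i = if i = j then 1 else 0 := by
        intro i
        have h5 := congrArg (π i) hc
        rw [dual_add_ker hπ (e y) i j, map_sum] at h5
        simpa only [map_smul, dual_add_ker hπ (e x), smul_eq_mul, mul_ite, mul_one, mul_zero,
          Finset.sum_ite_eq, Finset.mem_univ, if_true] using h5
      rw [← hc]
      simp only [h4, ite_smul, one_smul, zero_smul, Finset.sum_ite_eq', Finset.mem_univ, if_true]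
    have h6 : (fun j => h j + (e y j : W)) = fun j => h j + (e x j : W) := funext h2
    rw [AffSp.mk.injEq, ← hr' x, ← hr' y, h6]
  · intro O hO
    refine isOpen_iff_forall_mem_open.2 ?_
    rintro _ ⟨x, hx, rfl⟩
    obtain ⟨f, hf, hfO⟩ := isOpen_affSp_iff.1 hO x hx
    obtain ⟨E, hE, hE'⟩ := exists_isOpen_normalizeFrame π
      ((isPoly_eval f).comp (IsPolyMap.linear r))
    refine ⟨E, fun H hH => ?_, hE, ?_⟩
    · obtain ⟨h', hh', rfl⟩ := exists_spanGr_eq H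
      obtain ⟨hd, hne⟩ := (hE' h' hh').1 hH
      refine ⟨⟨r (normalizeFrame π h')⟩, hfO _ hne, ?_⟩
      rw [← spanGr_normalizeFrame π h' hh' hd]
      simp only [chart, hr _ (evalMatrix_normalizeFrame π h' hd)]
    · have hd := normalizeFrame_of_dual (dual_add_ker hπ (e x.coords))
      rw [chart, hE', hd.1, hd.2, hr']
      simpa [affEval] using hf

theorem chart_zero (hπ : ∀ i j, π i (h j) = if i = j then 1 else 0)
    (e : (Fin n → ℂ) ≃ₗ[ℂ] (Fin k → LinearMap.ker (LinearMap.pi π)))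
    (hh : LinearIndependent ℂ h) : chart hπ e ⟨0⟩ = spanGr h hh := by
  simp [chart]

theorem finrank_ker_pi (hπ : ∀ i j, π i (h j) = if i = j then 1 else 0) :
    finrank ℂ (LinearMap.ker (LinearMap.pi π)) = finrank ℂ W - k := by
  have h1 := (LinearMap.pi π).finrank_range_add_finrank_ker
  have h2 : LinearMap.range (LinearMap.pi π) = ⊤ := by
    rw [LinearMap.range_eq_top]
    intro c
    refine ⟨∑ j, c j • h j, ?_⟩
    ext i
    simp [hπ]
  rw [h2, finrank_top, finrank_fin_fun] at h1
  omega

theorem exists_chartEquiv (hπ : ∀ i j, π i (h j) = if i = j then 1 else 0)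
    (hn : n = k * (finrank ℂ W - k)) :
    Nonempty ((Fin n → ℂ) ≃ₗ[ℂ] (Fin k → LinearMap.ker (LinearMap.pi π))) :=
  ⟨LinearEquiv.ofFinrankEq _ _ (by
    rw [finrank_fin_fun, finrank_pi_fintype]
    simp [finrank_ker_pi hπ, hn])⟩

theorem topologicalKrullDim_gr_le (k : ℕ) (W : Type*) [AddCommGroup W] [Module ℂ W]
    [FiniteDimensional ℂ W] :
    topologicalKrullDim (Gr k W) ≤ (k * (finrank ℂ W - k) : ℕ) := by
  refine le_trans (topologicalKrullDim_le_of_forall_exists_isOpenEmbedding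
    (Y := AffSp (k * (finrank ℂ W - k))) fun H => ?_) (topologicalKrullDim_affSp_le _)
  obtain ⟨h, hh, rfl⟩ := exists_spanGr_eq H
  obtain ⟨π, hπ⟩ := exists_dual_frame hh
  obtain ⟨e⟩ := exists_chartEquiv hπ rfl
  exact ⟨chart hπ e, isOpenEmbedding_chart hπ e, _, chart_zero hπ e hh⟩

end Charts

/-! ### Coordinates on the exterior powers of a six-dimensional space -/

section Coordinates

variable {V : Type*} [AddCommGroup V] [Module ℂ V]

/-- The bivector `v ∧ w`. -/
def biv (v w : V) : ⋀[ℂ]^2 V := exteriorPower.ιMulti ℂ 2 ![v, w]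

/-- The linear form `φ ∧ ψ` on bivectors. -/
def pairForm (φ ψ : Dual ℂ V) : Dual ℂ (⋀[ℂ]^2 V) :=
  exteriorPower.pairingDual ℂ V 2 (exteriorPower.ιMulti ℂ 2 ![φ, ψ])

/-- The coordinates of a bivector. -/
def c2 (e : Basis (Fin 6) ℂ V) (i j : Fin 6) : Dual ℂ (⋀[ℂ]^2 V) :=
  pairForm (e.coord i) (e.coord j)

/-- The coordinates of a four-vector. -/
def c4 (e : Basis (Fin 6) ℂ V) (i j k l : Fin 6) : Dual ℂ (⋀[ℂ]^4 V) :=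
  exteriorPower.pairingDual ℂ V 4
    (exteriorPower.ιMulti ℂ 4 ![e.coord i, e.coord j, e.coord k, e.coord l])

variable (e : Basis (Fin 6) ℂ V)

theorem pairForm_ιMulti (φ ψ : Dual ℂ V) (v : Fin 2 → V) :
    pairForm φ ψ (exteriorPower.ιMulti ℂ 2 v) = φ (v 0) * ψ (v 1) - φ (v 1) * ψ (v 0) := by
  rw [pairForm, exteriorPower.pairingDual_ιMulti_ιMulti, Matrix.det_fin_two]
  simp
  ring

theorem c2_ιMulti (i j : Fin 6) (v : Fin 2 → V) :
    c2 e i j (exteriorPower.ιMulti ℂ 2 v) =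
      e.coord i (v 0) * e.coord j (v 1) - e.coord i (v 1) * e.coord j (v 0) :=
  pairForm_ιMulti _ _ _

theorem c2_biv (i j : Fin 6) (v w : V) :
    c2 e i j (biv v w) = e.coord i v * e.coord j w - e.coord i w * e.coord j v := by
  rw [biv, c2_ιMulti]
  simp

theorem c2_swap (i j : Fin 6) (a : ⋀[ℂ]^2 V) : c2 e j i a = -c2 e i j a := by
  have : c2 e j i = -c2 e i j := by
    apply exteriorPower.linearMap_ext
    ext v
    simp only [LinearMap.compAlternatingMap_apply, LinearMap.neg_apply, c2_ιMulti]
    ring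
  rw [this, LinearMap.neg_apply]

theorem c2_self (i : Fin 6) (a : ⋀[ℂ]^2 V) : c2 e i i a = 0 := by
  have := c2_swap e i i a
  linear_combination this / 2

theorem wedge_ιMulti (v w : Fin 2 → V) :
    wedge V (exteriorPower.ιMulti ℂ 2 v) (exteriorPower.ιMulti ℂ 2 w) =
      exteriorPower.ιMulti ℂ 4 ![v 0, v 1, w 0, w 1] := by
  apply Subtype.ext
  simp only [wedge, LinearMap.mk₂_apply, exteriorPower.ιMulti_apply_coe,
    ExteriorAlgebra.ιMulti_apply, List.ofFn_succ, List.ofFn_zero, List.prod_cons, List.prod_nil]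
  simp [mul_assoc]

theorem bivector_induction {P : ⋀[ℂ]^2 V → Prop} (h1 : ∀ v, P (exteriorPower.ιMulti ℂ 2 v))
    (h2 : ∀ a b, P a → P b → P (a + b)) (h3 : ∀ (c : ℂ) a, P a → P (c • a)) (a : ⋀[ℂ]^2 V) :
    P a := by
  have ha : a ∈ Submodule.span ℂ (Set.range (exteriorPower.ιMulti ℂ 2 (M := V))) := by
    rw [exteriorPower.ιMulti_span]
    trivial
  induction ha using Submodule.span_induction with
  | mem x hx => obtain ⟨v, rfl⟩ := hx; exact h1 v
  | zero => simpa using h3 0 _ (h1 0)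
  | add x y _ _ hx hy => exact h2 x y hx hy
  | smul c x _ hx => exact h3 c x hx

/-- Both sides are bilinear, and on decomposable bivectors this is the Laplace expansion of a 4 × 4
determinant by 2 × 2 minors. It reduces the later identities between wedge products to polynomial
arithmetic. -/
theorem c4_wedge (i j k l : Fin 6) (a b : ⋀[ℂ]^2 V) :
    c4 e i j k l (wedge V a b) =
      c2 e i j a * c2 e k l b - c2 e i k a * c2 e j l b + c2 e i l a * c2 e j k b +
        c2 e j k a * c2 e i l b - c2 e j l a * c2 e i k b + c2 e k l a * c2 e i j b := by
  induction a using bivector_induction with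
  | h1 v =>
    induction b using bivector_induction with
    | h1 w =>
      rw [wedge_ιMulti, c4, exteriorPower.pairingDual_ιMulti_ιMulti, Matrix.det_succ_row_zero]
      simp only [c2_ιMulti]
      simp [Fin.sum_univ_succ, Matrix.det_fin_three, Fin.succAbove]
      ring
    | h2 a b ha hb => simp only [map_add, ha, hb]; ring
    | h3 c a ha => simp only [map_smul, smul_eq_mul, ha]; ring
  | h2 a b ha hb => simp only [map_add, LinearMap.add_apply, ha, hb]; ring
  | h3 c a ha => simp only [map_smul, LinearMap.smul_apply, smul_eq_mul, ha]; ring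

theorem c2_ext {a b : ⋀[ℂ]^2 V} (h : ∀ i j, i < j → c2 e i j a = c2 e i j b) : a = b := by
  refine (e.exteriorPower 2).ext_elem fun s => ?_
  rw [exteriorPower.basis_repr_apply, exteriorPower.basis_repr_apply]
  have h1 : exteriorPower.ιMultiDual ℂ _ e s = c2 e ((Set.powersetCard.ofFinEmbEquiv.symm s) 0)
      ((Set.powersetCard.ofFinEmbEquiv.symm s) 1) := by
    rw [exteriorPower.ιMultiDual, exteriorPower.ιMulti_family, c2, pairForm]
    congr 2
  rw [h1]
  exact h _ _ ((Set.powersetCard.ofFinEmbEquiv.symm s).strictMono (by decide))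

theorem c4_ext {a b : ⋀[ℂ]^4 V}
    (h : ∀ i j k l, i < j → j < k → k < l → c4 e i j k l a = c4 e i j k l b) : a = b := by
  refine (e.exteriorPower 4).ext_elem fun s => ?_
  rw [exteriorPower.basis_repr_apply, exteriorPower.basis_repr_apply]
  have h1 : exteriorPower.ιMultiDual ℂ _ e s = c4 e ((Set.powersetCard.ofFinEmbEquiv.symm s) 0)
      ((Set.powersetCard.ofFinEmbEquiv.symm s) 1) ((Set.powersetCard.ofFinEmbEquiv.symm s) 2)
      ((Set.powersetCard.ofFinEmbEquiv.symm s) 3) := by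
    rw [exteriorPower.ιMultiDual, exteriorPower.ιMulti_family, c4]
    congr 2
  rw [h1]
  exact h _ _ _ _ ((Set.powersetCard.ofFinEmbEquiv.symm s).strictMono (by decide))
    ((Set.powersetCard.ofFinEmbEquiv.symm s).strictMono (by decide))
    ((Set.powersetCard.ofFinEmbEquiv.symm s).strictMono (by decide))

theorem wedge_comm (a b : ⋀[ℂ]^2 V) (e : Basis (Fin 6) ℂ V) : wedge V a b = wedge V b a := by
  refine c4_ext e fun i j k l _ _ _ => ?_
  rw [c4_wedge, c4_wedge]
  ring

theorem forall_pair {P : Fin 6 → Fin 6 → Prop} (h01 : P 0 1) (h02 : P 0 2) (h03 : P 0 3)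
    (h04 : P 0 4) (h05 : P 0 5) (h12 : P 1 2) (h13 : P 1 3) (h14 : P 1 4) (h15 : P 1 5)
    (h23 : P 2 3) (h24 : P 2 4) (h25 : P 2 5) (h34 : P 3 4) (h35 : P 3 5) (h45 : P 4 5)
    (i j : Fin 6) (hij : i < j) : P i j := by
  fin_cases i <;> fin_cases j <;> first | assumption | exact absurd hij (by decide)

theorem quadruple_cases : ∀ i j k l : Fin 6, i < j → j < k → k < l →
    (i, j, k, l) ∈ ([(0, 1, 2, 3), (0, 1, 2, 4), (0, 1, 2, 5), (0, 1, 3, 4), (0, 1, 3, 5),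
      (0, 1, 4, 5), (0, 2, 3, 4), (0, 2, 3, 5), (0, 2, 4, 5), (0, 3, 4, 5), (1, 2, 3, 4),
      (1, 2, 3, 5), (1, 2, 4, 5), (1, 3, 4, 5), (2, 3, 4, 5)] :
        List (Fin 6 × Fin 6 × Fin 6 × Fin 6)) := by
  decide

theorem forall_quadruple {P : Fin 6 → Fin 6 → Fin 6 → Fin 6 → Prop} (h0123 : P 0 1 2 3)
    (h0124 : P 0 1 2 4) (h0125 : P 0 1 2 5) (h0134 : P 0 1 3 4) (h0135 : P 0 1 3 5)
    (h0145 : P 0 1 4 5) (h0234 : P 0 2 3 4) (h0235 : P 0 2 3 5) (h0245 : P 0 2 4 5)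
    (h0345 : P 0 3 4 5) (h1234 : P 1 2 3 4) (h1235 : P 1 2 3 5) (h1245 : P 1 2 4 5)
    (h1345 : P 1 3 4 5) (h2345 : P 2 3 4 5) (i j k l : Fin 6) (hij : i < j) (hjk : j < k)
    (hkl : k < l) : P i j k l := by
  have h := quadruple_cases i j k l hij hjk hkl
  simp only [List.mem_cons, Prod.mk.injEq, List.not_mem_nil, or_false] at h
  rcases h with h | h | h | h | h | h | h | h | h | h | h | h | h | h | h <;>
    obtain ⟨rfl, rfl, rfl, rfl⟩ := h <;> assumption

/-- The pairing of four-vectors with bivectors. -/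
def pr : ⋀[ℂ]^4 V →ₗ[ℂ] Dual ℂ (⋀[ℂ]^2 V) :=
  -- The signs are those of the shuffles: `pr e y x` is the coefficient of y ∧ x on e₀ ∧ ⋯ ∧ e₅.
  (c4 e 0 1 2 3).smulRight (c2 e 4 5) - (c4 e 0 1 2 4).smulRight (c2 e 3 5) +
  (c4 e 0 1 2 5).smulRight (c2 e 3 4) + (c4 e 0 1 3 4).smulRight (c2 e 2 5) -
  (c4 e 0 1 3 5).smulRight (c2 e 2 4) + (c4 e 0 1 4 5).smulRight (c2 e 2 3) -
  (c4 e 0 2 3 4).smulRight (c2 e 1 5) + (c4 e 0 2 3 5).smulRight (c2 e 1 4) -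
  (c4 e 0 2 4 5).smulRight (c2 e 1 3) + (c4 e 0 3 4 5).smulRight (c2 e 1 2) +
  (c4 e 1 2 3 4).smulRight (c2 e 0 5) - (c4 e 1 2 3 5).smulRight (c2 e 0 4) +
  (c4 e 1 2 4 5).smulRight (c2 e 0 3) - (c4 e 1 3 4 5).smulRight (c2 e 0 2) +
  (c4 e 2 3 4 5).smulRight (c2 e 0 1)

theorem pr_apply (y : ⋀[ℂ]^4 V) (x : ⋀[ℂ]^2 V) : pr e y x =
    c4 e 0 1 2 3 y * c2 e 4 5 x - c4 e 0 1 2 4 y * c2 e 3 5 x + c4 e 0 1 2 5 y * c2 e 3 4 x +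
    c4 e 0 1 3 4 y * c2 e 2 5 x - c4 e 0 1 3 5 y * c2 e 2 4 x + c4 e 0 1 4 5 y * c2 e 2 3 x -
    c4 e 0 2 3 4 y * c2 e 1 5 x + c4 e 0 2 3 5 y * c2 e 1 4 x - c4 e 0 2 4 5 y * c2 e 1 3 x +
    c4 e 0 3 4 5 y * c2 e 1 2 x + c4 e 1 2 3 4 y * c2 e 0 5 x - c4 e 1 2 3 5 y * c2 e 0 4 x +
    c4 e 1 2 4 5 y * c2 e 0 3 x - c4 e 1 3 4 5 y * c2 e 0 2 x + c4 e 2 3 4 5 y * c2 e 0 1 x := by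
  simp only [pr, LinearMap.add_apply, LinearMap.sub_apply, LinearMap.smulRight_apply,
    LinearMap.smul_apply, smul_eq_mul]

/-- The value is the coefficient of a ∧ b ∧ c, and elements of even degree commute. -/
theorem pr_wedge_swap (a b c : ⋀[ℂ]^2 V) : pr e (wedge V a b) c = pr e (wedge V a c) b := by
  simp only [pr_apply, c4_wedge]
  ring

theorem c2_biv_basis (i j p q : Fin 6) : c2 e i j (biv (e p) (e q)) =
    (if p = i then 1 else 0) * (if q = j then 1 else 0) -
      (if q = i then 1 else 0) * (if p = j then 1 else 0) := by
  simp only [c2_biv, Basis.coord_apply, Basis.repr_self, Finsupp.single_apply]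

theorem pr_injective : Function.Injective (pr e) := by
  rw [← LinearMap.ker_eq_bot, LinearMap.ker_eq_bot']
  intro y hy
  have h : ∀ p q, pr e y (biv (e p) (e q)) = 0 := fun p q => by rw [hy]; rfl
  simp only [pr_apply, c2_biv_basis] at h
  have h01 := h 0 1
  have h02 := h 0 2
  have h03 := h 0 3
  have h04 := h 0 4
  have h05 := h 0 5
  have h12 := h 1 2
  have h13 := h 1 3
  have h14 := h 1 4
  have h15 := h 1 5
  have h23 := h 2 3
  have h24 := h 2 4
  have h25 := h 2 5
  have h34 := h 3 4
  have h35 := h 3 5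
  have h45 := h 4 5
  simp at h01 h02 h03 h04 h05 h12 h13 h14 h15 h23 h24 h25 h34 h35 h45
  refine c4_ext e (forall_quadruple ?_ ?_ ?_ ?_ ?_ ?_ ?_ ?_ ?_ ?_ ?_ ?_ ?_ ?_ ?_) <;>
    simpa only [map_zero]

theorem finiteDimensional_of_basis (e : Basis (Fin 6) ℂ V) : FiniteDimensional ℂ V :=
  Module.Finite.of_basis e

theorem finrank_bivector (e : Basis (Fin 6) ℂ V) : finrank ℂ (⋀[ℂ]^2 V) = 15 := by
  have := finiteDimensional_of_basis e
  rw [exteriorPower.finrank_eq, finrank_eq_card_basis e]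
  rfl

theorem finrank_fourvector (e : Basis (Fin 6) ℂ V) : finrank ℂ (⋀[ℂ]^4 V) = 15 := by
  have := finiteDimensional_of_basis e
  rw [exteriorPower.finrank_eq, finrank_eq_card_basis e]
  rfl

/-- Every linear form on four-vectors is the pairing with a bivector. -/
theorem exists_pr_eq (ℓ : Dual ℂ (⋀[ℂ]^4 V)) : ∃ b : ⋀[ℂ]^2 V, ∀ y, ℓ y = pr e y b := by
  have := finiteDimensional_of_basis e
  have hs : Function.Surjective (pr e) :=
    (LinearMap.injective_iff_surjective_of_finrank_eq_finrank
      (by rw [Subspace.dual_finrank_eq, finrank_bivector e, finrank_fourvector e])).1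
      (pr_injective e)
  let P := LinearEquiv.ofBijective (pr e) ⟨pr_injective e, hs⟩
  let E := evalEquiv ℂ (⋀[ℂ]^2 V)
  refine ⟨E.symm (ℓ.comp P.symm.toLinearMap), fun y => ?_⟩
  have h1 : ∀ φ : Dual ℂ (⋀[ℂ]^2 V), φ (E.symm (ℓ.comp P.symm.toLinearMap)) = ℓ (P.symm φ) :=
    fun φ => by simp [E]
  rw [h1]
  congr 1
  exact (P.symm_apply_apply y).symm

/-- By symmetry of the trilinear form, a functional `b` killing the image of a ∧ · is a bivector
annihilated by a. This is how cokernels of derivatives are identified. -/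
theorem wedge_eq_zero_of_pr {a b : ⋀[ℂ]^2 V} (h : ∀ x, pr e (wedge V a x) b = 0) :
    wedge V b a = 0 := by
  apply pr_injective e
  refine LinearMap.ext fun x => ?_
  rw [map_zero, LinearMap.zero_apply, wedge_comm b a e, ← pr_wedge_swap, h]

end Coordinates

/-! ### Normal form of bivectors -/

section NormalForm

/-- Splitting off the first pair of indices. -/
def consPairEquiv (m : ℕ) : Fin 2 ⊕ (Fin m × Fin 2) ≃ Fin (m + 1) × Fin 2 where
  toFun := Sum.elim (fun x => (0, x)) fun p => (p.1.succ, p.2)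
  invFun p := Fin.cases (motive := fun _ => Fin 2 ⊕ (Fin m × Fin 2)) (Sum.inl p.2)
    (fun i => Sum.inr (i, p.2)) p.1
  left_inv := by rintro (x | ⟨i, x⟩) <;> rfl
  right_inv := by
    rintro ⟨i, x⟩
    induction i using Fin.cases <;> rfl

/-- An alternating form on a space of even dimension is an orthogonal sum of planes. -/
theorem exists_basis_isAlt (m : ℕ) : ∀ (D : Type _) [AddCommGroup D] [Module ℂ D]
    [FiniteDimensional ℂ D] (B : LinearMap.BilinForm ℂ D), B.IsAlt → finrank ℂ D = m * 2 →
    ∃ b : Basis (Fin m × Fin 2) ℂ D, ∀ i j x y, i ≠ j → B (b (i, x)) (b (j, y)) = 0 := by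
  induction m with
  | zero =>
    intro D _ _ _ B _ hD
    exact ⟨(finBasisOfFinrankEq ℂ D hD).reindex finProdFinEquiv.symm, fun i => i.elim0⟩
  | succ m ih =>
    intro D _ _ _ B hB hD
    by_cases h0 : B = 0
    · refine ⟨(finBasisOfFinrankEq ℂ D hD).reindex finProdFinEquiv.symm, ?_⟩
      simp [h0]
    obtain ⟨u, v, huv⟩ : ∃ u v, B u v ≠ 0 := by
      by_contra! h
      exact h0 (LinearMap.ext₂ h)
    have hvu : B v u = -B u v := by rw [← hB.neg_eq]
    have huu : B u u = 0 := hB u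
    have hvv : B v v = 0 := hB v
    have hli : LinearIndependent ℂ ![u, v] := by
      rw [LinearIndependent.pair_iff]
      intro s t hst
      constructor
      · have := congrArg (fun z => B z v) hst
        simpa [hvv, huv] using this
      · have := congrArg (fun z => B z u) hst
        simpa [huu, hvu, huv] using this
    let S := Submodule.span ℂ (Set.range ![u, v])
    let bS : Basis (Fin 2) ℂ S := Basis.span hli
    have hbS : ∀ x, (bS x : D) = ![u, v] x := fun x => congrArg Subtype.val (Basis.span_apply hli x)
    -- As `B u v ≠ 0`, the plane of `u` and `v` is non-degenerate and splits off orthogonally; the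
    -- induction continues on its orthogonal complement.
    have hnd : (B.restrict S).Nondegenerate := by
      have hrefl : (B.restrict S).IsRefl := fun x y h => hB.isRefl x y h
      refine hrefl.nondegenerate_iff_separatingLeft.2 ?_
      intro z hz
      obtain ⟨s, t, hst⟩ : ∃ s t : ℂ, s • u + t • v = (z : D) := by
        have := z.2
        simp only [S, Matrix.range_cons, Matrix.range_empty, Set.union_empty,
          Set.singleton_union, Submodule.mem_span_pair] at this
        exact this
      have h1 := hz (bS 0)
      have h2 := hz (bS 1)
      simp only [LinearMap.BilinForm.restrict_apply, LinearMap.domRestrict_apply, hbS,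
        ← hst] at h1 h2
      simp [huu, hvv, hvu, huv] at h1 h2
      apply Subtype.ext
      rw [← hst, h1, h2]
      simp
    have hc : IsCompl S (B.orthogonal S) :=
      LinearMap.BilinForm.isCompl_orthogonal_of_restrict_nondegenerate hB.isRefl hnd
    have hfr : finrank ℂ (B.orthogonal S) = m * 2 := by
      have h1 := Submodule.finrank_add_eq_of_isCompl hc
      have h2 : finrank ℂ S = 2 := by simpa using finrank_eq_card_basis bS
      omega
    obtain ⟨b, hb⟩ := ih (B.orthogonal S) (B.restrict _) (fun z => hB z) hfr
    let b' := ((bS.prod b).map (Submodule.prodEquivOfIsCompl S _ hc)).reindex (consPairEquiv m)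
    have h0' : ∀ x, b' (0, x) = (bS x : D) := by
      intro x
      have : (consPairEquiv m).symm (0, x) = Sum.inl x := rfl
      simp [b', this]
    have hs' : ∀ i x, b' (i.succ, x) = (b (i, x) : D) := by
      intro i x
      have : (consPairEquiv m).symm (i.succ, x) = Sum.inr (i, x) := rfl
      simp [b', this]
    have horth : ∀ x i y, B (bS x) (b (i, y)) = 0 := fun x i y =>
      (LinearMap.BilinForm.mem_orthogonal_iff.1 (b (i, y)).2) _ (bS x).2
    refine ⟨b', fun i j x y hij => ?_⟩
    induction i using Fin.cases with
    | zero =>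
      induction j using Fin.cases with
      | zero => exact absurd rfl hij
      | succ j => rw [h0', hs', horth]
    | succ i =>
      induction j using Fin.cases with
      | zero => rw [h0', hs', ← hB.neg_eq, horth, neg_zero]
      | succ j =>
        rw [hs', hs']
        exact hb i j x y fun h => hij (by rw [h])

variable {V : Type*} [AddCommGroup V] [Module ℂ V]

/-- The alternating form on the dual space given by a bivector. -/
def bivForm (a : ⋀[ℂ]^2 V) : LinearMap.BilinForm ℂ (Dual ℂ V) :=
  LinearMap.mk₂ ℂ (fun φ ψ => pairForm φ ψ a)
    (fun φ φ' ψ => by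
      induction a using bivector_induction with
      | h1 v => simp only [pairForm_ιMulti, LinearMap.add_apply]; ring
      | h2 a b ha hb => simp only [map_add, ha, hb]; ring
      | h3 c a ha => simp only [map_smul, smul_eq_mul, ha]; ring)
    (fun c φ ψ => by
      induction a using bivector_induction with
      | h1 v => simp only [pairForm_ιMulti, LinearMap.smul_apply, smul_eq_mul]; ring
      | h2 a b ha hb => simp only [map_add, ha, hb, smul_add]
      | h3 d a ha => simp only [map_smul, smul_eq_mul, ha]; ring)
    (fun φ ψ ψ' => by
      induction a using bivector_induction with
      | h1 v => simp only [pairForm_ιMulti, LinearMap.add_apply]; ring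
      | h2 a b ha hb => simp only [map_add, ha, hb]; ring
      | h3 c a ha => simp only [map_smul, smul_eq_mul, ha]; ring)
    (fun c φ ψ => by
      induction a using bivector_induction with
      | h1 v => simp only [pairForm_ιMulti, LinearMap.smul_apply, smul_eq_mul]; ring
      | h2 a b ha hb => simp only [map_add, ha, hb, smul_add]
      | h3 d a ha => simp only [map_smul, smul_eq_mul, ha]; ring)

theorem bivForm_isAlt (a : ⋀[ℂ]^2 V) : (bivForm a).IsAlt := by
  intro φ
  change pairForm φ φ a = 0
  induction a using bivector_induction with
  | h1 v => rw [pairForm_ιMulti]; ring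
  | h2 a b ha hb => rw [map_add, ha, hb, add_zero]
  | h3 c a ha => rw [map_smul, ha, smul_zero]

theorem exists_basis_coord_eq [FiniteDimensional ℂ V] (f : Basis (Fin 6) ℂ (Dual ℂ V)) :
    ∃ e : Basis (Fin 6) ℂ V, ∀ i, e.coord i = f i := by
  refine ⟨f.dualBasis.map (evalEquiv ℂ V).symm, fun i => ?_⟩
  ext v
  simp

/-- The pairs of consecutive indices. -/
def pairEquiv : Fin 3 × Fin 2 ≃ Fin 6 := finProdFinEquiv

theorem pairEquiv_symm_fst : ∀ i j : Fin 6, i.val / 2 ≠ j.val / 2 →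
    (pairEquiv.symm i).1 ≠ (pairEquiv.symm j).1 := by
  decide

/-- Every bivector on a six-dimensional space is a combination of `e₀ ∧ e₁`, `e₂ ∧ e₃`, `e₄ ∧ e₅`
for a suitable basis. -/
theorem exists_basis_c2 [FiniteDimensional ℂ V] (hV : finrank ℂ V = 6) (a : ⋀[ℂ]^2 V) :
    ∃ e : Basis (Fin 6) ℂ V, ∀ i j : Fin 6, i.val / 2 ≠ j.val / 2 → c2 e i j a = 0 := by
  obtain ⟨b, hb⟩ := exists_basis_isAlt 3 (Dual ℂ V) (bivForm a) (bivForm_isAlt a)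
    (by rw [Subspace.dual_finrank_eq, hV])
  obtain ⟨e, he⟩ := exists_basis_coord_eq (b.reindex pairEquiv)
  refine ⟨e, fun i j hij => ?_⟩
  rw [c2, he, he, Basis.reindex_apply, Basis.reindex_apply]
  exact hb _ _ _ _ (pairEquiv_symm_fst i j hij)

theorem c2_reindex (e : Basis (Fin 6) ℂ V) (σ : Fin 6 ≃ Fin 6) (i j : Fin 6) :
    c2 (e.reindex σ) i j = c2 e (σ.symm i) (σ.symm j) := by
  have : ∀ i, (e.reindex σ).coord i = e.coord (σ.symm i) := fun i => by
    ext v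
    simp
  rw [c2, c2, this, this]

end NormalForm

/-! ### Bivectors annihilating a pencil -/

section Annihilators

variable {V : Type*} [AddCommGroup V] [Module ℂ V]

/-- The bivector `a` is a combination of `e₀ ∧ e₁`, `e₂ ∧ e₃` and `e₄ ∧ e₅`. -/
def IsDiag (e : Basis (Fin 6) ℂ V) (a : ⋀[ℂ]^2 V) : Prop :=
  ∀ i j : Fin 6, i.val / 2 ≠ j.val / 2 → c2 e i j a = 0

theorem IsDiag.reindex {e : Basis (Fin 6) ℂ V} {a : ⋀[ℂ]^2 V} (h : IsDiag e a) (σ : Fin 6 ≃ Fin 6)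
    (hσ : ∀ i j : Fin 6, i.val / 2 ≠ j.val / 2 → (σ.symm i).val / 2 ≠ (σ.symm j).val / 2) :
    IsDiag (e.reindex σ) a := fun i j hij => by
  rw [c2_reindex]
  exact h _ _ (hσ i j hij)

theorem wedge_self_eq_zero_of_isDiag {e : Basis (Fin 6) ℂ V} {a : ⋀[ℂ]^2 V} (h : IsDiag e a)
    (h1 : c2 e 0 1 a * c2 e 2 3 a = 0) (h2 : c2 e 0 1 a * c2 e 4 5 a = 0)
    (h3 : c2 e 2 3 a * c2 e 4 5 a = 0) : wedge V a a = 0 := by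
  have z : ∀ i j : Fin 6, i.val / 2 ≠ j.val / 2 → c2 e i j a = 0 := h
  refine c4_ext e (forall_quadruple ?_ ?_ ?_ ?_ ?_ ?_ ?_ ?_ ?_ ?_ ?_ ?_ ?_ ?_ ?_) <;>
    rw [c4_wedge, map_zero] <;>
    simp only [z 0 2 (by decide), z 0 3 (by decide), z 0 4 (by decide), z 0 5 (by decide),
      z 1 2 (by decide), z 1 3 (by decide), z 1 4 (by decide), z 1 5 (by decide),
      z 2 4 (by decide), z 2 5 (by decide), z 3 4 (by decide), z 3 5 (by decide)] <;>
    first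
      | ring1
      | linear_combination 2 * h1
      | linear_combination 2 * h2
      | linear_combination 2 * h3

/-- The coefficients of a ∧ a are twice the pairwise products of the three block entries, so two
entries are nonzero; a permutation of the blocks moves them to the front. -/
theorem exists_isDiag_of_wedge_self_ne_zero [FiniteDimensional ℂ V] (hV : finrank ℂ V = 6)
    {a : ⋀[ℂ]^2 V} (ha : wedge V a a ≠ 0) :
    ∃ e : Basis (Fin 6) ℂ V, IsDiag e a ∧ c2 e 0 1 a ≠ 0 ∧ c2 e 2 3 a ≠ 0 := by
  obtain ⟨e, he⟩ : ∃ e, IsDiag e a := exists_basis_c2 hV a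
  by_cases h1 : c2 e 0 1 a * c2 e 2 3 a = 0
  · by_cases h2 : c2 e 0 1 a * c2 e 4 5 a = 0
    · by_cases h3 : c2 e 2 3 a * c2 e 4 5 a = 0
      · exact absurd (wedge_self_eq_zero_of_isDiag he h1 h2 h3) ha
      · let σ : Fin 6 ≃ Fin 6 := Equiv.swap 0 4 * Equiv.swap 1 5
        refine ⟨e.reindex σ, he.reindex σ (by decide), ?_, ?_⟩
        · rw [c2_reindex]
          exact right_ne_zero_of_mul h3
        · rw [c2_reindex]
          exact left_ne_zero_of_mul h3
    · let σ : Fin 6 ≃ Fin 6 := Equiv.swap 2 4 * Equiv.swap 3 5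
      refine ⟨e.reindex σ, he.reindex σ (by decide), ?_, ?_⟩
      · rw [c2_reindex]
        exact left_ne_zero_of_mul h2
      · rw [c2_reindex]
        exact right_ne_zero_of_mul h2
  · exact ⟨e, he, left_ne_zero_of_mul h1, right_ne_zero_of_mul h1⟩

theorem exists_isDiag_of_ne_zero [FiniteDimensional ℂ V] (hV : finrank ℂ V = 6)
    {a : ⋀[ℂ]^2 V} (ha : a ≠ 0) :
    ∃ e : Basis (Fin 6) ℂ V, IsDiag e a ∧ c2 e 0 1 a ≠ 0 := by
  obtain ⟨e, he⟩ : ∃ e, IsDiag e a := exists_basis_c2 hV a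
  have z : ∀ i j : Fin 6, i.val / 2 ≠ j.val / 2 → c2 e i j a = 0 := he
  by_cases h1 : c2 e 0 1 a = 0
  · by_cases h2 : c2 e 2 3 a = 0
    · by_cases h3 : c2 e 4 5 a = 0
      · refine absurd (c2_ext e (forall_pair ?_ ?_ ?_ ?_ ?_ ?_ ?_ ?_ ?_ ?_ ?_ ?_ ?_ ?_ ?_)) ha <;>
          rw [map_zero] <;> first | assumption | exact z _ _ (by decide)
      · let σ : Fin 6 ≃ Fin 6 := Equiv.swap 0 4 * Equiv.swap 1 5
        refine ⟨e.reindex σ, he.reindex σ (by decide), ?_⟩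
        rw [c2_reindex]
        exact h3
    · let σ : Fin 6 ≃ Fin 6 := Equiv.swap 0 2 * Equiv.swap 1 3
      refine ⟨e.reindex σ, he.reindex σ (by decide), ?_⟩
      rw [c2_reindex]
      exact h2
  · exact ⟨e, he, h1⟩

/-- A nonzero bivector of square zero is decomposable. -/
theorem exists_basis_of_wedge_self_eq_zero [FiniteDimensional ℂ V] (hV : finrank ℂ V = 6)
    {a : ⋀[ℂ]^2 V} (ha : a ≠ 0) (haa : wedge V a a = 0) :
    ∃ e : Basis (Fin 6) ℂ V, IsDiag e a ∧ c2 e 0 1 a ≠ 0 ∧ c2 e 2 3 a = 0 ∧ c2 e 4 5 a = 0 := by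
  obtain ⟨e, he, h1⟩ := exists_isDiag_of_ne_zero hV ha
  have z : ∀ i j : Fin 6, i.val / 2 ≠ j.val / 2 → c2 e i j a = 0 := he
  have h : ∀ i j k l, c4 e i j k l (wedge V a a) = 0 := fun i j k l => by rw [haa, map_zero]
  simp only [c4_wedge] at h
  have h2 := h 0 1 2 3
  have h3 := h 0 1 4 5
  simp only [z 0 2 (by decide), z 0 3 (by decide), z 0 4 (by decide), z 0 5 (by decide)] at h2 h3
  refine ⟨e, he, h1, ?_, ?_⟩
  · have h4 : c2 e 0 1 a * c2 e 2 3 a = 0 := by linear_combination h2 / 2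
    exact (mul_eq_zero.1 h4).resolve_left h1
  · have h4 : c2 e 0 1 a * c2 e 4 5 a = 0 := by linear_combination h3 / 2
    exact (mul_eq_zero.1 h4).resolve_left h1

/-- The listed coordinates are all those with an index 4 or 5, so `b` lies in ⋀² of the span of e₀,
…, e₃. The mixed ones vanish by one equation each. -/
theorem c2_eq_zero_of_wedge_isDiag {e : Basis (Fin 6) ℂ V} {a b : ⋀[ℂ]^2 V} (ha : IsDiag e a)
    (h1 : c2 e 0 1 a ≠ 0) (h2 : c2 e 2 3 a ≠ 0) (hab : wedge V a b = 0) :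
    c2 e 0 4 b = 0 ∧ c2 e 0 5 b = 0 ∧ c2 e 1 4 b = 0 ∧ c2 e 1 5 b = 0 ∧ c2 e 2 4 b = 0 ∧
      c2 e 2 5 b = 0 ∧ c2 e 3 4 b = 0 ∧ c2 e 3 5 b = 0 ∧ c2 e 4 5 b = 0 := by
  have z : ∀ i j : Fin 6, i.val / 2 ≠ j.val / 2 → c2 e i j a = 0 := ha
  have h : ∀ i j k l, c4 e i j k l (wedge V a b) = 0 := fun i j k l => by rw [hab, map_zero]
  simp only [c4_wedge] at h
  have e0124 := h 0 1 2 4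
  have e0125 := h 0 1 2 5
  have e0134 := h 0 1 3 4
  have e0135 := h 0 1 3 5
  have e0234 := h 0 2 3 4
  have e0235 := h 0 2 3 5
  have e1234 := h 1 2 3 4
  have e1235 := h 1 2 3 5
  have e0123 := h 0 1 2 3
  have e0145 := h 0 1 4 5
  have e2345 := h 2 3 4 5
  simp only [z 0 2 (by decide), z 0 3 (by decide), z 0 4 (by decide), z 0 5 (by decide),
      z 1 2 (by decide), z 1 3 (by decide), z 1 4 (by decide), z 1 5 (by decide),
      z 2 4 (by decide), z 2 5 (by decide), z 3 4 (by decide), z 3 5 (by decide), zero_mul,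
      sub_zero, add_zero, zero_add, mul_eq_zero, h1, h2, false_or]
    at e0124 e0125 e0134 e0135 e0234 e0235 e1234 e1235 e0123 e0145 e2345
  refine ⟨e0234, e0235, e1234, e1235, e0124, e0125, e0134, e0135, ?_⟩
  -- The three equations on pairs of blocks are linear in the three block entries of `b`; this
  -- combination eliminates the other two entries.
  have h3 : c2 e 0 1 a * c2 e 2 3 a * c2 e 4 5 b = 0 := by
    linear_combination (c2 e 2 3 a * e0145 + c2 e 0 1 a * e2345 - c2 e 4 5 a * e0123) / 2
  exact (mul_eq_zero.1 h3).resolve_left (mul_ne_zero h1 h2)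

/-- The quadratic monomials in `b` and `c` are linearly independent. -/
def IndepPencil (b c : ⋀[ℂ]^2 V) : Prop :=
  ∀ x y z : ℂ, x • wedge V b b + y • wedge V b c + z • wedge V c c = 0 → x = 0 ∧ y = 0 ∧ z = 0

theorem IndepPencil.wedge_self_ne_zero {b c : ⋀[ℂ]^2 V} (h : IndepPencil b c) :
    wedge V b b ≠ 0 := fun hb => by
  have := (h 1 0 0 (by simp [hb])).1
  exact one_ne_zero this

/-- A bivector annihilating a pencil with independent quadratic monomials is decomposable. -/
theorem wedge_self_eq_zero_of_annihilates [FiniteDimensional ℂ V] (hV : finrank ℂ V = 6)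
    {a b c : ⋀[ℂ]^2 V} (hbc : IndepPencil b c) (hb : wedge V a b = 0) (hc : wedge V a c = 0) :
    wedge V a a = 0 := by
  by_contra haa
  obtain ⟨e, he, h1, h2⟩ := exists_isDiag_of_wedge_self_ne_zero hV haa
  obtain ⟨b04, b05, b14, b15, b24, b25, b34, b35, b45⟩ := c2_eq_zero_of_wedge_isDiag he h1 h2 hb
  obtain ⟨c04, c05, c14, c15, c24, c25, c34, c35, c45⟩ := c2_eq_zero_of_wedge_isDiag he h1 h2 hc
  -- Both `b` and `c` now live on a four-dimensional space, whose ⋀⁴ is a line, so their squares are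
  -- proportional, against independence.
  have key : c4 e 0 1 2 3 (wedge V c c) • wedge V b b + (0 : ℂ) • wedge V b c +
      (-c4 e 0 1 2 3 (wedge V b b)) • wedge V c c = 0 := by
    refine c4_ext e (forall_quadruple ?_ ?_ ?_ ?_ ?_ ?_ ?_ ?_ ?_ ?_ ?_ ?_ ?_ ?_ ?_) <;>
      simp only [map_add, map_smul, map_zero, smul_eq_mul, c4_wedge, b04, b05, b14, b15, b24, b25,
        b34, b35, b45, c04, c05, c14, c15, c24, c25, c34, c35, c45] <;> ring
  have h3 : c4 e 0 1 2 3 (wedge V b b) = 0 := neg_eq_zero.1 (hbc _ _ _ key).2.2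
  apply hbc.wedge_self_ne_zero
  refine c4_ext e (forall_quadruple ?_ ?_ ?_ ?_ ?_ ?_ ?_ ?_ ?_ ?_ ?_ ?_ ?_ ?_ ?_) <;>
    rw [map_zero] <;> first
      | exact h3
      | simp only [c4_wedge, b04, b05, b14, b15, b24, b25, b34, b35, b45]; ring

/-- Here `a` is a nonzero multiple of e₀ ∧ e₁, so the coordinate of a ∧ b on e₀ ∧ e₁ ∧ eₖ ∧ eₗ is a
multiple of that of `b` on eₖ ∧ eₗ. -/
theorem c2_eq_zero_of_wedge_decomposable {e : Basis (Fin 6) ℂ V} {a b : ⋀[ℂ]^2 V}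
    (ha : IsDiag e a) (h1 : c2 e 0 1 a ≠ 0) (h2 : c2 e 2 3 a = 0) (h3 : c2 e 4 5 a = 0)
    (hab : wedge V a b = 0) (k l : Fin 6) (hk : 2 ≤ k) (hkl : k < l) : c2 e k l b = 0 := by
  have z : ∀ i j : Fin 6, i.val / 2 ≠ j.val / 2 → c2 e i j a = 0 := ha
  have h : c4 e 0 1 k l (wedge V a b) = 0 := by rw [hab, map_zero]
  have hl : 2 < l := hk.trans_lt hkl
  have hkk : (0 : Fin 6).val / 2 ≠ k.val / 2 ∧ (1 : Fin 6).val / 2 ≠ k.val / 2 ∧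
    (0 : Fin 6).val / 2 ≠ l.val / 2 ∧ (1 : Fin 6).val / 2 ≠ l.val / 2 := by
    have h4 : 2 ≤ k.val := hk
    have h5 : 2 < l.val := hl
    refine ⟨?_, ?_, ?_, ?_⟩ <;> simp <;> omega
  have hkla : c2 e k l a = 0 := by
    by_cases h6 : k.val / 2 = l.val / 2
    · have h4 : 2 ≤ k.val := hk
      have h5 : k.val < l.val := hkl
      have h7 : (k = 2 ∧ l = 3) ∨ (k = 4 ∧ l = 5) := by
        simp only [Fin.ext_iff]
        have := l.2
        change (k.val = 2 ∧ l.val = 3) ∨ (k.val = 4 ∧ l.val = 5)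
        omega
      rcases h7 with ⟨rfl, rfl⟩ | ⟨rfl, rfl⟩ <;> assumption
    · exact z _ _ h6
  rw [c4_wedge, z 0 k hkk.1, z 1 k hkk.2.1, z 0 l hkk.2.2.1, z 1 l hkk.2.2.2, hkla] at h
  simpa [h1] using h

/-- The bivectors annihilating a pencil with independent quadratic monomials form a space of
dimension at most one. -/
theorem exists_smul_eq_of_annihilates [FiniteDimensional ℂ V] (hV : finrank ℂ V = 6)
    {a a' b c : ⋀[ℂ]^2 V} (hbc : IndepPencil b c) (ha : a ≠ 0) (hb : wedge V a b = 0)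
    (hc : wedge V a c = 0) (hb' : wedge V a' b = 0) (hc' : wedge V a' c = 0) :
    ∃ s : ℂ, a' = s • a := by
  have haa := wedge_self_eq_zero_of_annihilates hV hbc hb hc
  have haa' := wedge_self_eq_zero_of_annihilates hV hbc hb' hc'
  obtain ⟨e, he, h1, h2, h3⟩ := exists_basis_of_wedge_self_eq_zero hV ha haa
  -- The sum a + a' annihilates the pencil too, so it also has square zero; polarization gives the
  -- mixed product.
  have hmix : wedge V a a' = 0 := by
    have h4 := wedge_self_eq_zero_of_annihilates hV hbc (a := a + a')
      (by simp [hb, hb']) (by simp [hc, hc'])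
    simp only [map_add, LinearMap.add_apply, haa, haa', wedge_comm a' a e, zero_add,
      add_zero] at h4
    have h5 : (2 : ℂ) • wedge V a a' = 0 := by rw [two_smul, h4]
    simpa using h5
  have hzero : ∀ g, wedge V a g = 0 → ∀ k l : Fin 6, 2 ≤ k → k < l → c2 e k l g = 0 :=
    fun g hg => c2_eq_zero_of_wedge_decomposable he h1 h2 h3 hg
  have z := hzero a' hmix
  by_contra hne
  obtain ⟨k₀, hk₀, hk₀'⟩ : ∃ k : Fin 6, 2 ≤ k ∧ (c2 e 0 k a' ≠ 0 ∨ c2 e 1 k a' ≠ 0) := by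
    by_contra! hcon
    apply hne
    have za : ∀ i j : Fin 6, i.val / 2 ≠ j.val / 2 → c2 e i j a = 0 := he
    refine ⟨c2 e 0 1 a' / c2 e 0 1 a, c2_ext e
      (forall_pair ?_ ?_ ?_ ?_ ?_ ?_ ?_ ?_ ?_ ?_ ?_ ?_ ?_ ?_ ?_)⟩ <;>
      rw [map_smul, smul_eq_mul]
    · field_simp
    all_goals simp only [(hcon 2 (by decide)).1, (hcon 3 (by decide)).1, (hcon 4 (by decide)).1,
      (hcon 5 (by decide)).1, (hcon 2 (by decide)).2, (hcon 3 (by decide)).2,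
      (hcon 4 (by decide)).2, (hcon 5 (by decide)).2, z 2 3 (by decide) (by decide),
      z 2 4 (by decide) (by decide), z 2 5 (by decide) (by decide), z 3 4 (by decide) (by decide),
      z 3 5 (by decide) (by decide), z 4 5 (by decide) (by decide), za 0 2 (by decide),
      za 0 3 (by decide), za 0 4 (by decide), za 0 5 (by decide), za 1 2 (by decide),
      za 1 3 (by decide), za 1 4 (by decide), za 1 5 (by decide), za 2 4 (by decide),
      za 2 5 (by decide), za 3 4 (by decide), za 3 5 (by decide), h2, h3, mul_zero]
  set x : Fin 6 → ℂ := fun k => c2 e 0 k a' with hx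
  set y : Fin 6 → ℂ := fun k => c2 e 1 k a' with hy
  have hzero' : ∀ g, wedge V a g = 0 → ∀ k l : Fin 6, 2 ≤ k → 2 ≤ l → c2 e k l g = 0 := by
    intro g hg k l hk hl
    rcases lt_trichotomy k l with h | rfl | h
    · exact hzero g hg k l hk h
    · exact c2_self e k g
    · rw [c2_swap, hzero g hg l k hl h, neg_zero]
  -- Decomposability of `a'`: the vectors `x` and `y` are proportional on the indices from 2 on.
  -- Modulo `a`, then, a' = (x_{k₀} e₀ + y_{k₀} e₁) ∧ z for some z.
  have hxy : ∀ k l : Fin 6, 2 ≤ k → 2 ≤ l → x k * y l = x l * y k := by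
    intro k l hk hl
    have h4 : c4 e 0 1 k l (wedge V a' a') = 0 := by rw [haa', map_zero]
    rw [c4_wedge, hzero' a' hmix k l hk hl] at h4
    simp only [hx, hy]
    linear_combination -h4 / 2
  have hg : ∀ g, wedge V a g = 0 → wedge V a' g = 0 → ∀ k l : Fin 6, 2 ≤ k → 2 ≤ l →
      x k * c2 e 1 l g - x l * c2 e 1 k g = y k * c2 e 0 l g - y l * c2 e 0 k g := by
    intro g hg hg' k l hk hl
    have h4 : c4 e 0 1 k l (wedge V a' g) = 0 := by rw [hg', map_zero]
    rw [c4_wedge, hzero' a' hmix k l hk hl, hzero' g hg k l hk hl] at h4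
    simp only [hx, hy]
    linear_combination -h4
  -- If `g` is annihilated by `a` and `a'`, then `w g` is proportional to z on the indices from 2
  -- on, hence governed by the single number `w g k₀`. If that number vanishes, `g` is divisible by
  -- x_{k₀} e₀ + y_{k₀} e₁ and has square zero.
  let w : ⋀[ℂ]^2 V → Fin 6 → ℂ := fun g l => x k₀ * c2 e 1 l g - y k₀ * c2 e 0 l g
  have hw : ∀ g, wedge V a g = 0 → wedge V a' g = 0 → w g k₀ = 0 → wedge V g g = 0 := by
    intro g hag hag' hwg
    have hwl : ∀ l : Fin 6, 2 ≤ l → w g l = 0 := by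
      intro l hl
      have h4 := hg g hag hag' k₀ l hk₀ hl
      have h5 := hxy k₀ l hk₀ hl
      simp only [w] at hwg ⊢
      rcases eq_or_ne (x k₀) 0 with hx0 | hx0
      · have hy0 : y k₀ ≠ 0 := hk₀'.resolve_left (fun h => h hx0)
        rw [hx0] at h4 h5 hwg ⊢
        have hb0 : c2 e 0 k₀ g = 0 := by simpa [hy0] using hwg
        have hxl : x l = 0 := by simpa [hy0] using h5.symm
        rw [hb0, hxl] at h4
        linear_combination h4
      · apply mul_left_cancel₀ hx0
        linear_combination x k₀ * h4 + x l * hwg - c2 e 0 k₀ g * h5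
    have hcross : ∀ k l : Fin 6, 2 ≤ k → 2 ≤ l →
        c2 e 0 k g * c2 e 1 l g = c2 e 0 l g * c2 e 1 k g := by
      intro k l hk hl
      have h4 := hwl k hk
      have h5 := hwl l hl
      simp only [w] at h4 h5
      rcases hk₀' with h | h
      · apply mul_left_cancel₀ h
        change x k₀ * _ = x k₀ * _
        linear_combination c2 e 0 k g * h5 - c2 e 0 l g * h4
      · apply mul_left_cancel₀ h
        change y k₀ * _ = y k₀ * _
        linear_combination -c2 e 1 l g * h4 + c2 e 1 k g * h5
    have zg := hzero g hag
    refine c4_ext e (forall_quadruple ?_ ?_ ?_ ?_ ?_ ?_ ?_ ?_ ?_ ?_ ?_ ?_ ?_ ?_ ?_) <;>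
      rw [c4_wedge, map_zero] <;>
      simp only [zg 2 3 (by decide) (by decide), zg 2 4 (by decide) (by decide),
        zg 2 5 (by decide) (by decide), zg 3 4 (by decide) (by decide),
        zg 3 5 (by decide) (by decide), zg 4 5 (by decide) (by decide)] <;>
      first
        | ring1
        | linear_combination -2 * hcross 2 3 (by decide) (by decide)
        | linear_combination -2 * hcross 2 4 (by decide) (by decide)
        | linear_combination -2 * hcross 2 5 (by decide) (by decide)
        | linear_combination -2 * hcross 3 4 (by decide) (by decide)
        | linear_combination -2 * hcross 3 5 (by decide) (by decide)
        | linear_combination -2 * hcross 4 5 (by decide) (by decide)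
  -- This combination of `b` and `c` lies in the kernel of the linear form g ↦ `w g k₀`, so its
  -- square vanishes. That is a quadratic relation in the pencil, which forces `w b k₀ = 0` and then
  -- b ∧ b = 0.
  have hcomb := hw (w c k₀ • b - w b k₀ • c) (by simp [hb, hc]) (by simp [hb', hc']) (by
    simp only [w, map_sub, map_smul, smul_eq_mul]
    ring)
  have h6 := hbc (w c k₀ * w c k₀) (-2 * (w b k₀ * w c k₀)) (w b k₀ * w b k₀) (by
    rw [← hcomb]
    simp only [map_sub, map_smul, LinearMap.sub_apply, LinearMap.smul_apply, wedge_comm c b e]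
    module)
  have h7 : w b k₀ = 0 := mul_self_eq_zero.1 h6.2.2
  exact hbc.wedge_self_ne_zero (hw b hb hb' h7)

end Annihilators

/-! ### Quadratic monomials in a frame -/

section Monomials

variable {V : Type*} [AddCommGroup V] [Module ℂ V]

/-- The quadratic monomials in four variables; the last one is `x₀ x₃`. -/
def monoIdx : Fin 10 → Fin 4 × Fin 4 :=
  ![(0, 0), (0, 1), (0, 2), (1, 1), (1, 2), (1, 3), (2, 2), (2, 3), (3, 3), (0, 3)]

/-- The quadratic monomials in a frame. -/
def mono (h : Fin 4 → ⋀[ℂ]^2 V) (l : Fin 10) : ⋀[ℂ]^4 V :=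
  wedge V (h (monoIdx l).1) (h (monoIdx l).2)

/-- A frame `a, b, c, d` with `a ∧ d = b ∧ c` such that this is the only relation. -/
structure IsHyperbolic (h : Fin 4 → ⋀[ℂ]^2 V) : Prop where
  rel : wedge V (h 0) (h 3) = wedge V (h 1) (h 2)
  indep : LinearIndependent ℂ (fun l : Fin 9 => mono h l.castSucc)

theorem isPolyMap_mono [FiniteDimensional ℂ V] (l : Fin 10) :
    IsPolyMap (fun h : Fin 4 → ⋀[ℂ]^2 V => mono h l) :=
  IsPolyMap.bilin _ (IsPolyMap.id.apply _) (IsPolyMap.id.apply _)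

theorem sum_smul_mono (h : Fin 4 → ⋀[ℂ]^2 V) (x : Fin 9 → ℂ) :
    ∑ l, x l • mono h l.castSucc = x 0 • wedge V (h 0) (h 0) + x 1 • wedge V (h 0) (h 1) +
      x 2 • wedge V (h 0) (h 2) + x 3 • wedge V (h 1) (h 1) + x 4 • wedge V (h 1) (h 2) +
      x 5 • wedge V (h 1) (h 3) + x 6 • wedge V (h 2) (h 2) + x 7 • wedge V (h 2) (h 3) +
      x 8 • wedge V (h 3) (h 3) := by
  rw [Fin.sum_univ_castSucc, Fin.sum_univ_eight]
  rfl

theorem c4_eq_zero_of_c2 {e : Basis (Fin 6) ℂ V} {g g' : ⋀[ℂ]^2 V}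
    (hg : ∀ k l : Fin 6, 2 ≤ k → k < l → c2 e k l g = 0)
    (hg' : ∀ k l : Fin 6, 2 ≤ k → k < l → c2 e k l g' = 0) (i j k l : Fin 6) (hj : 2 ≤ j)
    (hjk : j < k) (hkl : k < l) : c4 e i j k l (wedge V g g') = 0 := by
  rw [c4_wedge, hg j k hj hjk, hg j l hj (hjk.trans hkl), hg k l (hj.trans hjk.le) hkl,
    hg' j k hj hjk, hg' j l hj (hjk.trans hkl), hg' k l (hj.trans hjk.le) hkl]
  ring

/-- No nonzero bivector annihilates all four members of a frame with independent monomials. -/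
theorem eq_zero_of_annihilates [FiniteDimensional ℂ V] (hV : finrank ℂ V = 6)
    {h : Fin 4 → ⋀[ℂ]^2 V} (hh : LinearIndependent ℂ (fun l : Fin 9 => mono h l.castSucc))
    (hbc : IndepPencil (h 1) (h 2)) {a : ⋀[ℂ]^2 V} (ha : ∀ i, wedge V a (h i) = 0) : a = 0 := by
  by_contra ha0
  obtain ⟨e, he, h1, h2, h3⟩ := exists_basis_of_wedge_self_eq_zero hV ha0
    (wedge_self_eq_zero_of_annihilates hV hbc (ha 1) (ha 2))
  have hz : ∀ i, ∀ k l : Fin 6, 2 ≤ k → k < l → c2 e k l (h i) = 0 := fun i =>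
    c2_eq_zero_of_wedge_decomposable he h1 h2 h3 (ha i)
  let Θ : ⋀[ℂ]^4 V →ₗ[ℂ] (Fin 6 → ℂ) := LinearMap.pi ![c4 e 0 1 2 3, c4 e 0 1 2 4, c4 e 0 1 2 5,
    c4 e 0 1 3 4, c4 e 0 1 3 5, c4 e 0 1 4 5]
  have hspan : ∀ y ∈ Submodule.span ℂ (Set.range fun l : Fin 9 => mono h l.castSucc),
      ∀ i j k l : Fin 6, 2 ≤ j → j < k → k < l → c4 e i j k l y = 0 := by
    intro y hy i j k l hj hjk hkl
    have : Submodule.span ℂ (Set.range fun l : Fin 9 => mono h l.castSucc) ≤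
        LinearMap.ker (c4 e i j k l) := by
      rw [Submodule.span_le]
      rintro _ ⟨m, rfl⟩
      exact c4_eq_zero_of_c2 (hz _) (hz _) i j k l hj hjk hkl
    exact this hy
  have hinj : Set.InjOn Θ (Submodule.span ℂ (Set.range fun l : Fin 9 => mono h l.castSucc)) := by
    intro y hy y' hy' hyy
    have hc : ∀ i, Θ y i = Θ y' i := fun i => by rw [hyy]
    refine c4_ext e (forall_quadruple (hc 0) (hc 1) (hc 2) (hc 3) (hc 4) (hc 5)
      ?_ ?_ ?_ ?_ ?_ ?_ ?_ ?_ ?_) <;>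
      rw [hspan y hy _ _ _ _ (by decide) (by decide) (by decide),
        hspan y' hy' _ _ _ _ (by decide) (by decide) (by decide)]
  -- Only the six coordinates on e₀ ∧ e₁ ∧ eₖ ∧ eₗ survive on the span of the monomials, which has
  -- dimension nine.
  have hcard := (hh.map_injOn Θ hinj).fintype_card_le_finrank
  simp at hcard

theorem indepPencil_of_mono {h : Fin 4 → ⋀[ℂ]^2 V}
    (hh : LinearIndependent ℂ (fun l : Fin 9 => mono h l.castSucc)) :
    IndepPencil (h 1) (h 2) := by
  intro x y z hxyz
  rw [Fintype.linearIndependent_iff] at hh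
  have := hh ![0, 0, 0, x, y, 0, z, 0, 0] (by
    simpa [Fin.sum_univ_succ, mono, monoIdx, add_assoc] using hxyz)
  exact ⟨this 3, this 4, this 6⟩

end Monomials

/-! ### The Pfaffian -/

section Pfaffian

variable {V : Type*} [AddCommGroup V] [Module ℂ V]

theorem wedge_biv_self (e : Basis (Fin 6) ℂ V) (v w : V) : wedge V (biv v w) (biv v w) = 0 := by
  refine c4_ext e fun i j k l _ _ _ => ?_
  rw [c4_wedge, map_zero]
  simp only [c2_biv]
  ring

/-- A sum of two decomposable bivectors has zero cube, since each term repeats a factor of square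
zero. The pairing uses `e₀` and the normal form `e`, so the symmetry of the trilinear form replaces
a computation in coordinates. -/
theorem pr_wedge_eq_zero_of_c2_eq_zero (e₀ : Basis (Fin 6) ℂ V) {e : Basis (Fin 6) ℂ V}
    {a : ⋀[ℂ]^2 V} (ha : IsDiag e a) (h : c2 e 4 5 a = 0) : pr e₀ (wedge V a a) a = 0 := by
  have z : ∀ i j : Fin 6, i.val / 2 ≠ j.val / 2 → c2 e i j a = 0 := ha
  have h1 : a = c2 e 0 1 a • biv (e 0) (e 1) + c2 e 2 3 a • biv (e 2) (e 3) := by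
    refine c2_ext e (forall_pair ?_ ?_ ?_ ?_ ?_ ?_ ?_ ?_ ?_ ?_ ?_ ?_ ?_ ?_ ?_) <;>
      simp only [map_add, map_smul, c2_biv_basis, z 0 2 (by decide), z 0 3 (by decide),
        z 0 4 (by decide), z 0 5 (by decide),
        z 1 2 (by decide), z 1 3 (by decide), z 1 4 (by decide), z 1 5 (by decide),
        z 2 4 (by decide), z 2 5 (by decide), z 3 4 (by decide), z 3 5 (by decide), h] <;>
      simp
  generalize c2 e 0 1 a = s at h1
  generalize c2 e 2 3 a = t at h1
  have h2 := pr_wedge_swap e₀ (biv (e 0) (e 1)) (biv (e 2) (e 3)) (biv (e 0) (e 1))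
  have h3 := pr_wedge_swap e₀ (biv (e 2) (e 3)) (biv (e 0) (e 1)) (biv (e 2) (e 3))
  rw [wedge_biv_self e₀, LinearMap.map_zero, LinearMap.zero_apply] at h2 h3
  rw [wedge_comm _ _ e₀] at h3
  rw [h1]
  simp only [map_add, map_smul, LinearMap.add_apply, LinearMap.smul_apply, wedge_biv_self e₀,
    wedge_comm (biv (e 2) (e 3)) (biv (e 0) (e 1)) e₀, h2, h3, LinearMap.map_zero,
    LinearMap.zero_apply, smul_zero, add_zero]

/-- If the Pfaffian of `a` does not vanish, then `a ∧ ·` is injective on bivectors. -/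
theorem injective_wedge_of_pr_ne_zero [FiniteDimensional ℂ V] (hV : finrank ℂ V = 6)
    (e₀ : Basis (Fin 6) ℂ V) {a : ⋀[ℂ]^2 V} (ha : pr e₀ (wedge V a a) a ≠ 0) :
    Function.Injective (wedge V a) := by
  obtain ⟨e, he⟩ : ∃ e, IsDiag e a := exists_basis_c2 hV a
  have h45 : c2 e 4 5 a ≠ 0 := fun h => ha (pr_wedge_eq_zero_of_c2_eq_zero e₀ he h)
  have h23 : c2 e 2 3 a ≠ 0 := fun h => by
    let σ : Fin 6 ≃ Fin 6 := Equiv.swap 2 4 * Equiv.swap 3 5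
    refine ha (pr_wedge_eq_zero_of_c2_eq_zero e₀ (he.reindex σ (by decide)) ?_)
    rw [c2_reindex]
    exact h
  have h01 : c2 e 0 1 a ≠ 0 := fun h => by
    let σ : Fin 6 ≃ Fin 6 := Equiv.swap 0 4 * Equiv.swap 1 5
    refine ha (pr_wedge_eq_zero_of_c2_eq_zero e₀ (he.reindex σ (by decide)) ?_)
    rw [c2_reindex]
    exact h
  rw [← LinearMap.ker_eq_bot, LinearMap.ker_eq_bot']
  intro b hab
  obtain ⟨b04, b05, b14, b15, b24, b25, b34, b35, b45⟩ :=
    c2_eq_zero_of_wedge_isDiag he h01 h23 hab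
  have z : ∀ i j : Fin 6, i.val / 2 ≠ j.val / 2 → c2 e i j a = 0 := he
  have h : ∀ i j k l, c4 e i j k l (wedge V a b) = 0 := fun i j k l => by rw [hab, map_zero]
  simp only [c4_wedge] at h
  have e0145 := h 0 1 4 5
  have e0245 := h 0 2 4 5
  have e0345 := h 0 3 4 5
  have e1245 := h 1 2 4 5
  have e1345 := h 1 3 4 5
  have e2345 := h 2 3 4 5
  simp only [z 0 2 (by decide), z 0 3 (by decide), z 0 4 (by decide), z 0 5 (by decide),
      z 1 2 (by decide), z 1 3 (by decide), z 1 4 (by decide), z 1 5 (by decide),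
      z 2 4 (by decide), z 2 5 (by decide), z 3 4 (by decide), z 3 5 (by decide), zero_mul,
      sub_zero, add_zero, zero_add, mul_zero, mul_eq_zero, h45, b45, false_or]
    at e0145 e0245 e0345 e1245 e1345 e2345
  refine c2_ext e (forall_pair ?_ ?_ ?_ ?_ ?_ ?_ ?_ ?_ ?_ ?_ ?_ ?_ ?_ ?_ ?_) <;>
    rw [map_zero] <;> assumption

end Pfaffian

/-! ### An example -/

section Example

variable {V : Type*} [AddCommGroup V] [Module ℂ V]

/-- A hyperbolic frame. -/
def exampleFrame (e : Basis (Fin 6) ℂ V) : Fin 4 → ⋀[ℂ]^2 V :=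
  ![biv (e 0) (e 1) + biv (e 2) (e 3) + biv (e 4) (e 5), biv (e 0) (e 3) + biv (e 1) (e 5),
    biv (e 0) (e 2) - biv (e 1) (e 4), biv (e 3) (e 4) - biv (e 2) (e 5)]

theorem isHyperbolic_exampleFrame (e : Basis (Fin 6) ℂ V) : IsHyperbolic (exampleFrame e) := by
  constructor
  · refine c4_ext e (forall_quadruple ?_ ?_ ?_ ?_ ?_ ?_ ?_ ?_ ?_ ?_ ?_ ?_ ?_ ?_ ?_) <;>
      simp [c4_wedge, exampleFrame, c2_biv_basis, -map_add, LinearMap.map_add, LinearMap.map_sub]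
  · have hA : ∀ i j, c2 e i j (exampleFrame e 0) = c2 e i j (biv (e 0) (e 1)) +
      c2 e i j (biv (e 2) (e 3)) + c2 e i j (biv (e 4) (e 5)) := fun i j => by
      simp [exampleFrame]
    have hB : ∀ i j, c2 e i j (exampleFrame e 1) = c2 e i j (biv (e 0) (e 3)) +
      c2 e i j (biv (e 1) (e 5)) := fun i j => by simp [exampleFrame]
    have hC : ∀ i j, c2 e i j (exampleFrame e 2) = c2 e i j (biv (e 0) (e 2)) -
      c2 e i j (biv (e 1) (e 4)) := fun i j => by simp [exampleFrame]
    have hD : ∀ i j, c2 e i j (exampleFrame e 3) = c2 e i j (biv (e 3) (e 4)) -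
      c2 e i j (biv (e 2) (e 5)) := fun i j => by simp [exampleFrame]
    rw [Fintype.linearIndependent_iff]
    intro x hx
    rw [sum_smul_mono] at hx
    have h := fun i j k l => congrArg (c4 e i j k l) hx
    simp only [map_add, map_smul, map_zero] at h
    -- Each of these coordinates isolates one coefficient, except the last, which mixes `x 0` and `x
    -- 8`.
    have e0 := h 0 1 2 3
    have e1 := h 0 3 4 5
    have e2 := h 0 2 4 5
    have e3 := h 0 1 3 5
    have e4 := h 0 1 3 4
    have e5 := h 0 2 3 5
    have e6 := h 0 1 2 4
    have e7 := h 0 2 3 4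
    have e8 := h 2 3 4 5
    simp [c4_wedge, hA, hB, hC, hD, c2_biv_basis] at e0 e1 e2 e3 e4 e5 e6 e7 e8
    intro i
    fin_cases i
    · exact e0
    · exact e1
    · exact e2
    · exact e3.resolve_right (by norm_num)
    · exact e4
    · exact e5
    · exact e6
    · exact e7
    · change x 8 = 0
      linear_combination e0 - e8 / 2

theorem pr_exampleFrame (e : Basis (Fin 6) ℂ V) :
    pr e (wedge V (exampleFrame e 0) (exampleFrame e 0)) (exampleFrame e 0) ≠ 0 := by
  simp [pr_apply, c4_wedge, exampleFrame, c2_biv_basis]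
  norm_num

end Example

/-! ### Symmetric matrices and symmetric tensors -/

section Symmetric

open Matrix

/-- Non-degenerate quadratic forms of equal rank over an algebraically closed field are equivalent;
the rows of `P` are the images of the standard basis under an isometry. -/
theorem exists_eq_mul_mul_transpose {n : Type*} [Fintype n] [DecidableEq n] {M N : Matrix n n ℂ}
    (hM : M.IsSymm) (hN : N.IsSymm) (hM0 : M.det ≠ 0) (hN0 : N.det ≠ 0) :
    ∃ P : Matrix n n ℂ, IsUnit P.det ∧ M = P * N * Pᵀ := by
  have hassoc : ∀ {M : Matrix n n ℂ}, M.IsSymm →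
      QuadraticMap.associated (R := ℂ) (LinearMap.BilinMap.toQuadraticMap (toBilin' M)) =
        toBilin' M := by
    intro M hM
    refine QuadraticMap.associated_left_inverse ℂ fun x y => ?_
    rw [toBilin'_apply', toBilin'_apply', dotProduct_mulVec, dotProduct_comm,
      ← mulVec_transpose, hM.eq]
  obtain ⟨f⟩ := QuadraticForm.equivalent_of_isAlgClosed
    (LinearMap.BilinMap.toQuadraticMap (toBilin' M))
    (LinearMap.BilinMap.toQuadraticMap (toBilin' N))
    (by rw [hassoc hM]; exact (LinearMap.BilinForm.nondegenerate_toBilin'_of_det_ne_zero' M hM0).1)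
    (by rw [hassoc hN]; exact (LinearMap.BilinForm.nondegenerate_toBilin'_of_det_ne_zero' N hN0).1)
  have hf : ∀ x y, toBilin' N (f x) (f y) = toBilin' M x y := by
    intro x y
    have h1 := LinearMap.congr_fun₂ (hassoc hM) x y
    have h2 := LinearMap.congr_fun₂ (hassoc hN) (f x) (f y)
    rw [← h1, ← h2, QuadraticMap.associated_apply, QuadraticMap.associated_apply,
      ← map_add f, f.map_app, f.map_app, f.map_app]
  let P : Matrix n n ℂ := Matrix.of fun i k => f (Pi.single i 1) k
  have hP : M = P * N * Pᵀ := by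
    ext i j
    have h1 := hf (Pi.single i 1) (Pi.single j 1)
    rw [toBilin'_single, toBilin'_apply'] at h1
    rw [← h1, Matrix.mul_assoc, Matrix.mul_apply]
    rfl
  refine ⟨P, ?_, hP⟩
  rw [isUnit_iff_ne_zero]
  intro h0
  apply hM0
  rw [hP, det_mul, det_mul, h0, zero_mul, zero_mul]

/-- The symmetric matrix of a quadratic form given by its coefficients. -/
def symMat (x : Fin 10 → ℂ) : Matrix (Fin 4) (Fin 4) ℂ :=
  !![x 0, x 1 / 2, x 2 / 2, x 9 / 2;
    x 1 / 2, x 3, x 4 / 2, x 5 / 2;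
    x 2 / 2, x 4 / 2, x 6, x 7 / 2;
    x 9 / 2, x 5 / 2, x 7 / 2, x 8]

theorem isSymm_symMat (x : Fin 10 → ℂ) : (symMat x).IsSymm := by
  ext i j
  fin_cases i <;> fin_cases j <;> rfl

/-- The coefficients of the quadratic form of a symmetric matrix. -/
def symCoeff (M : Matrix (Fin 4) (Fin 4) ℂ) : Fin 10 → ℂ :=
  ![M 0 0, 2 * M 0 1, 2 * M 0 2, M 1 1, 2 * M 1 2, 2 * M 1 3, M 2 2, 2 * M 2 3, M 3 3, 2 * M 0 3]

theorem symMat_symCoeff {M : Matrix (Fin 4) (Fin 4) ℂ} (hM : M.IsSymm) :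
    symMat (symCoeff M) = M := by
  have h := hM.apply
  ext i j
  fin_cases i <;> fin_cases j <;> simp [symMat, symCoeff, h 0 1, h 0 2, h 0 3, h 1 2, h 1 3, h 2 3]

theorem symMat_injective : Function.Injective symMat := by
  intro x y hxy
  have h : ∀ i j, symMat x i j = symMat y i j := fun i j => by rw [hxy]
  ext l
  fin_cases l
  · exact h 0 0
  · simpa [symMat] using h 0 1
  · simpa [symMat] using h 0 2
  · exact h 1 1
  · simpa [symMat] using h 1 2
  · simpa [symMat] using h 1 3
  · exact h 2 2
  · simpa [symMat] using h 2 3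
  · exact h 3 3
  · simpa [symMat] using h 0 3

theorem symMat_smul (c : ℂ) (x : Fin 10 → ℂ) : symMat (c • x) = c • symMat x := by
  ext i j
  fin_cases i <;> fin_cases j <;> simp [symMat, mul_div_assoc]

theorem symMat_add (x y : Fin 10 → ℂ) : symMat (x + y) = symMat x + symMat y := by
  ext i j
  fin_cases i <;> fin_cases j <;> simp [symMat, add_div]

variable {H : Type*} [AddCommGroup H] [Module ℂ H]

/-- The symmetric tensor with the given matrix. -/
def matTensor {n : Type*} [Fintype n] (b : n → H) (M : Matrix n n ℂ) : H ⊗[ℂ] H :=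
  ∑ i, ∑ j, M i j • (b i ⊗ₜ[ℂ] b j)

theorem matTensor_mem {n : Type*} [Fintype n] (b : n → H) {M : Matrix n n ℂ} (hM : M.IsSymm) :
    matTensor b M ∈ SymSq H := by
  change TensorProduct.comm ℂ H H (matTensor b M) = matTensor b M
  simp only [matTensor, map_sum, map_smul, TensorProduct.comm_tmul]
  rw [Finset.sum_comm]
  refine Finset.sum_congr rfl fun i _ => Finset.sum_congr rfl fun j _ => ?_
  rw [hM.apply]

theorem matTensor_eq_basis {n : Type*} [Fintype n] (b : Basis n ℂ H) (M : Matrix n n ℂ) :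
    matTensor b M = ∑ p : n × n, M p.1 p.2 • b.tensorProduct b p := by
  simp only [matTensor, Fintype.sum_prod_type, Basis.tensorProduct_apply]

theorem matTensor_injective {n : Type*} [Fintype n] (b : Basis n ℂ H) :
    Function.Injective (matTensor b) := by
  intro M N hMN
  ext i j
  have h1 : ∀ M, (b.tensorProduct b).repr (matTensor b M) (i, j) = M i j := fun M => by
    rw [matTensor_eq_basis, Basis.repr_sum_self]
  rw [← h1 M, ← h1 N, hMN]

theorem exists_matTensor_eq {n : Type*} [Fintype n] (b : Basis n ℂ H) {q : H ⊗[ℂ] H}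
    (hq : q ∈ SymSq H) : ∃ M : Matrix n n ℂ, M.IsSymm ∧ matTensor b M = q := by
  let M : Matrix n n ℂ := Matrix.of fun i j => (b.tensorProduct b).repr q (i, j)
  have h1 : matTensor b M = q := by
    rw [matTensor_eq_basis]
    exact (b.tensorProduct b).sum_repr q
  refine ⟨M, ?_, h1⟩
  apply matTensor_injective b
  rw [h1]
  have h2 : TensorProduct.comm ℂ H H q = q := hq
  conv_rhs => rw [← h2, ← h1]
  simp only [matTensor, map_sum, map_smul, TensorProduct.comm_tmul]
  rw [Finset.sum_comm]
  rfl

theorem dualForm_matTensor_nondegenerate {n : Type*} [Fintype n] [DecidableEq n] (b : Basis n ℂ H)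
    {M : Matrix n n ℂ} (hM : M.IsSymm) :
    (dualForm ⟨matTensor b M, matTensor_mem b hM⟩).Nondegenerate ↔ M.det ≠ 0 := by
  rw [LinearMap.BilinForm.nondegenerate_iff_det_ne_zero b.dualBasis]
  have h1 : LinearMap.BilinForm.toMatrix b.dualBasis (dualForm ⟨matTensor b M, matTensor_mem b hM⟩)
      = M := by
    ext i j
    rw [LinearMap.BilinForm.toMatrix_apply]
    simp [dualForm, matTensor, Finsupp.single_apply]
  rw [h1]

theorem mem_span_matTensor_iff {n : Type*} [Fintype n] (b : Basis n ℂ H) {M₀ M : Matrix n n ℂ}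
    (hM₀ : M₀.IsSymm) (hM : M.IsSymm) : (⟨matTensor b M, matTensor_mem b hM⟩ : SymSq H) ∈
      Submodule.span ℂ {(⟨matTensor b M₀, matTensor_mem b hM₀⟩ : SymSq H)} ↔
        ∃ c : ℂ, M = c • M₀ := by
  rw [Submodule.mem_span_singleton]
  refine exists_congr fun c => ?_
  have h1 : c • matTensor b M₀ = matTensor b (c • M₀) := by
    simp [matTensor, mul_smul, Finset.smul_sum]
  rw [Subtype.ext_iff]
  change c • matTensor b M₀ = matTensor b M ↔ _
  rw [h1, (matTensor_injective b).eq_iff, eq_comm]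

theorem matTensor_ne_zero {n : Type*} [Fintype n] [DecidableEq n] [Nonempty n] (b : Basis n ℂ H)
    {M : Matrix n n ℂ} (hM : M.det ≠ 0) : matTensor b M ≠ 0 := fun h0 => hM (by
  have h2 : M = 0 := by
    apply matTensor_injective b
    rw [h0]
    simp [matTensor]
  rw [h2, det_zero])

/-- Coordinates on the space of symmetric tensors. -/
def symEquiv (b : Basis (Fin 4) ℂ H) : (Fin 10 → ℂ) ≃ₗ[ℂ] SymSq H :=
  LinearEquiv.ofBijective
    { toFun := fun x => ⟨matTensor b (symMat x), matTensor_mem b (isSymm_symMat x)⟩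
      map_add' := fun x y => Subtype.ext (by
        simp [matTensor, symMat_add, add_smul, Finset.sum_add_distrib])
      map_smul' := fun c x => Subtype.ext (by
        simp [matTensor, symMat_smul, mul_smul, Finset.smul_sum]) }
    ⟨fun x y hxy => symMat_injective (matTensor_injective b (Subtype.ext_iff.1 hxy)),
      fun q => by
        obtain ⟨M, hM, hMq⟩ := exists_matTensor_eq b q.2
        exact ⟨symCoeff M, Subtype.ext (by
          change matTensor b (symMat (symCoeff M)) = q
          rw [symMat_symCoeff hM, hMq])⟩⟩

/-- Symmetric tensors become symmetric matrices in a basis. Since `SymSq H` has dimension 10, rank 9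
is automatic once the kernel is a line. -/
theorem ker_symSq_iff {T : Type*} [AddCommGroup T] [Module ℂ T] (b : Basis (Fin 4) ℂ H)
    (L : SymSq H →ₗ[ℂ] T) :
    (finrank ℂ (LinearMap.range L) = 9 ∧
      ∃ q : SymSq H, LinearMap.ker L = Submodule.span ℂ {q} ∧ (dualForm q).Nondegenerate) ↔
      ∃ M₀ : Matrix (Fin 4) (Fin 4) ℂ, M₀.IsSymm ∧ M₀.det ≠ 0 ∧
        ∀ (M : Matrix (Fin 4) (Fin 4) ℂ) (hM : M.IsSymm),
          (L ⟨matTensor b M, matTensor_mem b hM⟩ = 0 ↔ ∃ c : ℂ, M = c • M₀) := by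
  constructor
  · rintro ⟨-, ⟨q, hq⟩, hker, hnd⟩
    obtain ⟨M₀, hM₀, rfl⟩ := exists_matTensor_eq b hq
    refine ⟨M₀, hM₀, (dualForm_matTensor_nondegenerate b hM₀).1 hnd, fun M hM => ?_⟩
    rw [← LinearMap.mem_ker, hker]
    exact mem_span_matTensor_iff b hM₀ hM
  · rintro ⟨M₀, hM₀, hdet, hker⟩
    have hker' : LinearMap.ker L =
        Submodule.span ℂ {⟨matTensor b M₀, matTensor_mem b hM₀⟩} := by
      ext ⟨q, hq⟩
      obtain ⟨M, hM, rfl⟩ := exists_matTensor_eq b hq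
      rw [mem_span_matTensor_iff b hM₀ hM, ← hker M hM, LinearMap.mem_ker]
    refine ⟨?_, _, hker', (dualForm_matTensor_nondegenerate b hM₀).2 hdet⟩
    have : FiniteDimensional ℂ (SymSq H) := Module.Finite.equiv (symEquiv b)
    have h1 := LinearMap.finrank_range_add_finrank_ker L
    rw [hker', ← (symEquiv b).finrank_eq, finrank_span_singleton] at h1
    · simp at h1
      omega
    · exact fun h0 => matTensor_ne_zero b hdet (Subtype.ext_iff.1 h0)

end Symmetric

/-! ### The locus in terms of frames -/

section Frames

open Matrix

variable {V : Type*} [AddCommGroup V] [Module ℂ V]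

/-- The value of the symmetric tensor with matrix `M` in a frame. -/
def quad (h : Fin 4 → ⋀[ℂ]^2 V) (M : Matrix (Fin 4) (Fin 4) ℂ) : ⋀[ℂ]^4 V :=
  ∑ i, ∑ j, M i j • wedge V (h i) (h j)

theorem quad_symMat (e : Basis (Fin 6) ℂ V) (h : Fin 4 → ⋀[ℂ]^2 V) (x : Fin 10 → ℂ) :
    quad h (symMat x) = ∑ l, x l • mono h l := by
  rw [Fin.sum_univ_castSucc, sum_smul_mono]
  simp only [quad, Fin.sum_univ_four, symMat, mono, monoIdx]
  simp [wedge_comm (h 1) (h 0) e, wedge_comm (h 2) (h 0) e, wedge_comm (h 3) (h 0) e,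
    wedge_comm (h 2) (h 1) e, wedge_comm (h 3) (h 1) e, wedge_comm (h 3) (h 2) e]
  module

theorem sum_smul_bilin_sum_smul {n W T : Type*} [Fintype n] [AddCommGroup W] [Module ℂ W]
    [AddCommGroup T] [Module ℂ T] (B : W →ₗ[ℂ] W →ₗ[ℂ] T) (h : n → W) (P M : Matrix n n ℂ) :
    ∑ k, ∑ l, M k l • B (∑ i, P i k • h i) (∑ j, P j l • h j) =
      ∑ i, ∑ j, (P * M * Pᵀ) i j • B (h i) (h j) := by
  simp only [map_sum, map_smul, LinearMap.sum_apply, LinearMap.smul_apply, Finset.smul_sum,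
    smul_smul, Matrix.mul_apply, Finset.sum_mul, Finset.sum_smul, transpose_apply]
  rw [Finset.sum_comm]
  calc _ = ∑ l, ∑ k, ∑ i, ∑ j, (M k l * (P j l * P i k)) • B (h i) (h j) :=
        Finset.sum_congr rfl fun l _ => Finset.sum_congr rfl fun k _ => Finset.sum_comm
    _ = ∑ l, ∑ i, ∑ k, ∑ j, (M k l * (P j l * P i k)) • B (h i) (h j) :=
        Finset.sum_congr rfl fun l _ => Finset.sum_comm
    _ = ∑ i, ∑ l, ∑ k, ∑ j, (M k l * (P j l * P i k)) • B (h i) (h j) := Finset.sum_comm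
    _ = ∑ i, ∑ l, ∑ j, ∑ k, (M k l * (P j l * P i k)) • B (h i) (h j) :=
        Finset.sum_congr rfl fun i _ => Finset.sum_congr rfl fun l _ => Finset.sum_comm
    _ = ∑ i, ∑ j, ∑ l, ∑ k, (M k l * (P j l * P i k)) • B (h i) (h j) :=
        Finset.sum_congr rfl fun i _ => Finset.sum_comm
    _ = _ := by
        refine Finset.sum_congr rfl fun i _ => Finset.sum_congr rfl fun j _ =>
          Finset.sum_congr rfl fun l _ => Finset.sum_congr rfl fun k _ => ?_
        congr 1
        ring

theorem quad_sum_smul (h : Fin 4 → ⋀[ℂ]^2 V) (P M : Matrix (Fin 4) (Fin 4) ℂ) :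
    quad (fun k => ∑ i, P i k • h i) M = quad h (P * M * Pᵀ) :=
  sum_smul_bilin_sum_smul (wedge V) h P M

theorem symWedge_matTensor {H : Submodule ℂ (⋀[ℂ]^2 V)} (b : Basis (Fin 4) ℂ H)
    {M : Matrix (Fin 4) (Fin 4) ℂ} (hM : M.IsSymm) :
    symWedge H ⟨matTensor b M, matTensor_mem b hM⟩ = quad (fun i => (b i : ⋀[ℂ]^2 V)) M := by
  simp only [symWedge, LinearMap.domRestrict_apply, matTensor, map_sum, map_smul,
    TensorProduct.lift.tmul, LinearMap.compl₁₂_apply, Submodule.subtype_apply, quad]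

theorem ker_symWedge_iff {H : Submodule ℂ (⋀[ℂ]^2 V)} (b : Basis (Fin 4) ℂ H) :
    (finrank ℂ (LinearMap.range (symWedge H)) = 9 ∧
      ∃ q : SymSq H, LinearMap.ker (symWedge H) = Submodule.span ℂ {q} ∧
        (dualForm q).Nondegenerate) ↔
      ∃ M₀ : Matrix (Fin 4) (Fin 4) ℂ, M₀.IsSymm ∧ M₀.det ≠ 0 ∧
        ∀ M : Matrix (Fin 4) (Fin 4) ℂ, M.IsSymm →
          (quad (fun i => (b i : ⋀[ℂ]^2 V)) M = 0 ↔ ∃ c : ℂ, M = c • M₀) := by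
  have key := ker_symSq_iff (H := H) (T := ⋀[ℂ]^4 V) b (symWedge H)
  have hL : ∀ (M : Matrix (Fin 4) (Fin 4) ℂ) (hM : M.IsSymm),
      symWedge H ⟨matTensor b M, matTensor_mem b hM⟩ = quad (fun i => (b i : ⋀[ℂ]^2 V)) M :=
    fun M hM => symWedge_matTensor b hM
  constructor
  · rintro ⟨h1, q, hq, hnd⟩
    obtain ⟨M₀, hM₀, hd, h⟩ := key.1 ⟨h1, q, hq, hnd⟩
    refine ⟨M₀, hM₀, hd, fun M hM => ?_⟩
    rw [← hL M hM]
    exact h M hM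
  · rintro ⟨M₀, hM₀, hd, h⟩
    obtain ⟨h1, q, hq, hnd⟩ := key.2 ⟨M₀, hM₀, hd, fun M hM => by
      rw [← h M hM, ← hL M hM]⟩
    exact ⟨h1, q, hq, hnd⟩

theorem spanGr_mem_VV_iff {h : Fin 4 → ⋀[ℂ]^2 V}
    (hh : LinearIndependent ℂ h) : spanGr h hh ∈ VV V ↔
      ∃ M₀ : Matrix (Fin 4) (Fin 4) ℂ, M₀.IsSymm ∧ M₀.det ≠ 0 ∧
        ∀ M : Matrix (Fin 4) (Fin 4) ℂ, M.IsSymm → (quad h M = 0 ↔ ∃ c : ℂ, M = c • M₀) := by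
  have h1 : (fun i => (Basis.span hh i : ⋀[ℂ]^2 V)) = h :=
    funext fun i => congrArg Subtype.val (Basis.span_apply hh i)
  have h2 := ker_symWedge_iff (Basis.span hh)
  rw [h1] at h2
  exact h2

/-- The coefficients of the quadratic form `x₀ x₃ - x₁ x₂`. -/
def hypCoeff : Fin 10 → ℂ := ![0, 0, 0, 0, -1, 0, 0, 0, 0, 1]

theorem det_symMat_hypCoeff : (symMat hypCoeff).det ≠ 0 := by
  simp [symMat, hypCoeff, det_succ_row_zero, Fin.sum_univ_succ, Fin.succAbove]

theorem sum_hypCoeff_smul_mono (h : Fin 4 → ⋀[ℂ]^2 V) :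
    ∑ l, hypCoeff l • mono h l = wedge V (h 0) (h 3) - wedge V (h 1) (h 2) := by
  have h1 := sum_smul_mono h (fun l => hypCoeff l.castSucc)
  rw [Fin.sum_univ_castSucc, h1]
  have h2 : mono h (Fin.last 9) = wedge V (h 0) (h 3) := rfl
  have h3 : hypCoeff (Fin.last 9) = 1 := rfl
  rw [h2, h3]
  simp [hypCoeff]
  module

/-- Multiply a linear relation by `h 1`: all products of `h 1` with the frame are among the nine
monomials, whereas multiplying by `h 0` would bring in the missing x₀x₃. -/
theorem linearIndependent_of_mono (e : Basis (Fin 6) ℂ V) {h : Fin 4 → ⋀[ℂ]^2 V}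
    (hh : LinearIndependent ℂ (fun l : Fin 9 => mono h l.castSucc)) : LinearIndependent ℂ h := by
  rw [Fintype.linearIndependent_iff] at hh ⊢
  intro g hg
  have h1 := congrArg (wedge V (h 1)) hg
  have h2 := hh ![0, g 0, 0, g 1, g 2, g 3, 0, 0, 0] (by
    rw [sum_smul_mono, ← map_zero (wedge V (h 1)), ← h1, wedge_comm (h 0) (h 1) e]
    simp [Fin.sum_univ_four])
  intro i
  fin_cases i
  · exact h2 1
  · exact h2 3
  · exact h2 4
  · exact h2 5

theorem IsHyperbolic.linearIndependent (e : Basis (Fin 6) ℂ V) {h : Fin 4 → ⋀[ℂ]^2 V}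
    (hh : IsHyperbolic h) : LinearIndependent ℂ h := linearIndependent_of_mono e hh.indep

theorem eq_zero_of_sum_smul_mono {h : Fin 4 → ⋀[ℂ]^2 V}
    (hh : LinearIndependent ℂ (fun l : Fin 9 => mono h l.castSucc)) {x : Fin 10 → ℂ}
    (hx : x (Fin.last 9) = 0) (h0 : ∑ l, x l • mono h l = 0) : x = 0 := by
  rw [Fin.sum_univ_castSucc, hx, zero_smul, add_zero] at h0
  have h2 := Fintype.linearIndependent_iff.1 hh _ h0
  funext l
  exact Fin.lastCases hx (fun l => h2 l) l

theorem quad_sub (h : Fin 4 → ⋀[ℂ]^2 V) (M N : Matrix (Fin 4) (Fin 4) ℂ) :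
    quad h (M - N) = quad h M - quad h N := by
  simp only [quad, ← Finset.sum_sub_distrib]
  refine Finset.sum_congr rfl fun i _ => Finset.sum_congr rfl fun j _ => ?_
  rw [Matrix.sub_apply]
  module

theorem quad_smul (h : Fin 4 → ⋀[ℂ]^2 V) (c : ℂ) (M : Matrix (Fin 4) (Fin 4) ℂ) :
    quad h (c • M) = c • quad h M := by
  simp [quad, mul_smul, Finset.smul_sum]

theorem hypCoeff_last : hypCoeff (Fin.last 9) = 1 := rfl

theorem IsHyperbolic.quad_eq_zero_iff (e : Basis (Fin 6) ℂ V) {h : Fin 4 → ⋀[ℂ]^2 V}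
    (hh : IsHyperbolic h) {M : Matrix (Fin 4) (Fin 4) ℂ} (hM : M.IsSymm) :
    quad h M = 0 ↔ ∃ c : ℂ, M = c • symMat hypCoeff := by
  have hq : quad h (symMat hypCoeff) = 0 := by
    rw [quad_symMat e, sum_hypCoeff_smul_mono, hh.rel, sub_self]
  constructor
  · intro h0
    -- Subtracting `c` times the known relation removes x₀x₃ and leaves a relation among the nine
    -- independent monomials.
    set c := symCoeff M (Fin.last 9) with hc
    refine ⟨c, ?_⟩
    have hN : (M - c • symMat hypCoeff).IsSymm := hM.sub ((isSymm_symMat _).smul c)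
    have h1 : quad h (M - c • symMat hypCoeff) = 0 := by
      rw [quad_sub, quad_smul, h0, hq, smul_zero, sub_zero]
    rw [← symMat_symCoeff hN, quad_symMat e] at h1
    have h2 := eq_zero_of_sum_smul_mono hh.indep (by
      simp [symCoeff, symMat, hypCoeff, hc]
      ring) h1
    rw [← sub_eq_zero, ← symMat_symCoeff hN, h2]
    ext i j
    fin_cases i <;> fin_cases j <;> simp [symMat]
  · rintro ⟨c, rfl⟩
    rw [quad_smul, hq, smul_zero]

theorem IsHyperbolic.spanGr_mem (e : Basis (Fin 6) ℂ V) {h : Fin 4 → ⋀[ℂ]^2 V}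
    (hh : IsHyperbolic h) (hli : LinearIndependent ℂ h) : spanGr h hli ∈ VV V := by
  rw [spanGr_mem_VV_iff]
  exact ⟨symMat hypCoeff, isSymm_symMat _, det_symMat_hypCoeff, fun M hM =>
    hh.quad_eq_zero_iff e hM⟩

theorem exists_isHyperbolic (e : Basis (Fin 6) ℂ V) {H : Gr 4 (⋀[ℂ]^2 V)} (hH : H ∈ VV V) :
    ∃ (h : Fin 4 → ⋀[ℂ]^2 V) (hh : IsHyperbolic h), spanGr h (hh.linearIndependent e) = H := by
  have := finiteDimensional_of_basis e
  obtain ⟨h, hh, rfl⟩ := exists_spanGr_eq H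
  obtain ⟨M₀, hM₀, hdet, hker⟩ := (spanGr_mem_VV_iff hh).1 hH
  obtain ⟨P, hP, rfl⟩ := exists_eq_mul_mul_transpose hM₀ (isSymm_symMat hypCoeff) hdet
    det_symMat_hypCoeff
  have hcancel : ∀ M N : Matrix (Fin 4) (Fin 4) ℂ, P * M * Pᵀ = P * N * Pᵀ → M = N := by
    intro M N hMN
    have hPt : IsUnit Pᵀ.det := by rwa [det_transpose]
    have h1 : ∀ M, P⁻¹ * (P * M * Pᵀ) * Pᵀ⁻¹ = M := fun M => by
      rw [Matrix.mul_assoc P, nonsing_inv_mul_cancel_left _ _ hP,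
        mul_nonsing_inv_cancel_right _ _ hPt]
    rw [← h1 M, hMN, h1]
  set h' : Fin 4 → ⋀[ℂ]^2 V := fun k => ∑ i, P i k • h i with hh'
  have hquad : ∀ M, quad h' M = quad h (P * M * Pᵀ) := quad_sum_smul h P
  have hyp : IsHyperbolic h' := by
    constructor
    · rw [← sub_eq_zero, ← sum_hypCoeff_smul_mono, ← quad_symMat e, hquad]
      exact (hker _ hM₀).2 ⟨1, (one_smul _ _).symm⟩
    · rw [Fintype.linearIndependent_iff]
      intro x hx
      -- A relation without x₀x₃ is still a multiple of `hypCoeff`, whose coefficient there is 1, so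
      -- the multiple is zero.
      let y : Fin 10 → ℂ := Fin.snoc x 0
      have hylast : y (Fin.last 9) = 0 := Fin.snoc_last (α := fun _ => ℂ) 0 x
      have hycast : ∀ l : Fin 9, y l.castSucc = x l := Fin.snoc_castSucc (α := fun _ => ℂ) 0 x
      have hy : quad h' (symMat y) = 0 := by
        rw [quad_symMat e, Fin.sum_univ_castSucc, hylast, zero_smul, add_zero]
        simp only [hycast, hx]
      rw [hquad] at hy
      have hs : (P * symMat y * Pᵀ).IsSymm := by
        rw [Matrix.IsSymm, transpose_mul, transpose_mul, transpose_transpose, (isSymm_symMat y).eq,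
          Matrix.mul_assoc]
      obtain ⟨c, hc⟩ := (hker _ hs).1 hy
      have hc' : y = c • hypCoeff := by
        apply symMat_injective
        apply hcancel
        rw [hc, symMat_smul, Matrix.mul_smul, Matrix.smul_mul]
      have hc0 : c = 0 := by
        have h9 := congrFun hc' (Fin.last 9)
        rw [hylast, Pi.smul_apply, hypCoeff_last, smul_eq_mul, mul_one] at h9
        exact h9.symm
      intro l
      have hl := congrFun hc' l.castSucc
      rw [hc0, zero_smul, hycast] at hl
      exact hl
  refine ⟨_, hyp, spanGr_congr _ _ fun k => ?_⟩
  exact Submodule.sum_mem _ fun i _ => Submodule.smul_mem _ _ (Submodule.subset_span ⟨i, rfl⟩)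

end Frames

/-! ### Smooth points of polynomial maps -/

section Smooth

open Filter Topology

theorem IsPoly.contDiff {n : ℕ} {f : (Fin n → ℂ) → ℂ} (hf : IsPoly f) : ContDiff ℂ 1 f := by
  refine IsPoly.induction (P := fun f => ContDiff ℂ 1 f) (fun c => contDiff_const)
    (fun φ => ?_) (fun f g hf hg => hf.add hg) (fun f g hf hg => hf.mul hg) hf
  exact (LinearMap.toContinuousLinearMap φ).contDiff

/-- The implicit function theorem in the classical topology: a map with surjective strict derivative
sends neighbourhoods onto neighbourhoods. The expansions `hder` along lines identify the derivative
with `f'`. -/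
theorem eventually_exists_of_surjective_aux {n m : ℕ} {f : (Fin n → ℂ) → (Fin m → ℂ)}
    (hf : IsPolyMap f) {f' : (Fin n → ℂ) →ₗ[ℂ] (Fin m → ℂ)} {x : Fin n → ℂ}
    (hder : ∀ y, ∃ r₀ r₁ : Fin m → ℂ, ∀ t : ℂ,
      f (x + t • y) = f x + t • f' y + t ^ 2 • r₀ + t ^ 3 • r₁)
    (hsurj : Function.Surjective f') {G : (Fin n → ℂ) → ℂ} (hG : IsPoly G) (hGx : G x ≠ 0) :
    ∀ᶠ y in 𝓝 (f x), ∃ x', G x' ≠ 0 ∧ f x' = y := by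
  have hcd : ContDiff ℂ 1 f := contDiff_pi.2 fun i => (hf (LinearMap.proj i)).contDiff
  have hd := hcd.contDiffAt.hasStrictFDerivAt (x := x) one_ne_zero
  have hfd : ∀ y, fderiv ℂ f x y = f' y := by
    intro y
    obtain ⟨r₀, r₁, hr⟩ := hder y
    have h1 : HasDerivAt (fun t : ℂ => f (x + t • y)) (fderiv ℂ f x y) 0 := by
      have h2 : HasDerivAt (fun t : ℂ => x + t • y) y 0 := by
        simpa using ((hasDerivAt_id (0 : ℂ)).smul_const y).const_add x
      have h3 : HasFDerivAt f (fderiv ℂ f x) (x + (0 : ℂ) • y) := by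
        simpa using hd.hasFDerivAt
      exact h3.comp_hasDerivAt 0 h2
    have h2 : HasDerivAt (fun t : ℂ => f (x + t • y)) (f' y) 0 := by
      simp only [hr]
      have h3 := ((((hasDerivAt_id (0 : ℂ)).smul_const (f' y)).const_add (f x)).add
        (((hasDerivAt_id (0 : ℂ)).pow 2).smul_const r₀)).add
        (((hasDerivAt_id (0 : ℂ)).pow 3).smul_const r₁)
      exact h3.congr_deriv (by simp)
    exact h1.unique h2
  have hrange : (fderiv ℂ f x).range = ⊤ := by
    rw [LinearMap.range_eq_top]
    intro z
    obtain ⟨y, hy⟩ := hsurj z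
    exact ⟨y, (hfd y).trans hy⟩
  have hmap := hd.map_nhds_eq_of_surj hrange
  have hU : ∀ᶠ x' in 𝓝 x, G x' ≠ 0 := hG.contDiff.continuous.continuousAt.eventually_ne hGx
  rw [← hmap, eventually_map]
  filter_upwards [hU] with x' hx'
  exact ⟨x', hx', rfl⟩

/-- Near a point where a polynomial map is submersive, the map takes all values in a prescribed
direction. -/
theorem eventually_exists_of_surjective {E F : Type*} [AddCommGroup E] [Module ℂ E]
    [FiniteDimensional ℂ E] [AddCommGroup F] [Module ℂ F] [FiniteDimensional ℂ F] {f : E → F}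
    (hf : IsPolyMap f) {f' : E →ₗ[ℂ] F} {x : E}
    (hder : ∀ y, ∃ r₀ r₁ : F, ∀ t : ℂ, f (x + t • y) = f x + t • f' y + t ^ 2 • r₀ + t ^ 3 • r₁)
    (hsurj : Function.Surjective f') {G : E → ℂ} (hG : IsPoly G) (hGx : G x ≠ 0) (z : F) :
    ∀ᶠ t : ℂ in 𝓝 0, ∃ x', G x' ≠ 0 ∧ f x' = f x + t • z := by
  let e₁ := (finBasis ℂ E).equivFun
  let e₂ := (finBasis ℂ F).equivFun
  have key := eventually_exists_of_surjective_aux (f := fun v => e₂ (f (e₁.symm v)))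
    (f' := e₂.toLinearMap ∘ₗ f' ∘ₗ e₁.symm.toLinearMap) (x := e₁ x) (G := fun v => G (e₁.symm v))
    ((IsPolyMap.linear e₂.toLinearMap).comp (hf.comp (IsPolyMap.linear e₁.symm.toLinearMap)))
    (fun y => by
      obtain ⟨r₀, r₁, hr⟩ := hder (e₁.symm y)
      refine ⟨e₂ r₀, e₂ r₁, fun t => ?_⟩
      rw [map_add, map_smul, LinearEquiv.symm_apply_apply, hr]
      simp)
    (e₂.surjective.comp (hsurj.comp e₁.symm.surjective))
    (hG.comp (IsPolyMap.linear e₁.symm.toLinearMap)) (by simpa using hGx)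
  rw [LinearEquiv.symm_apply_apply] at key
  have hcont : Tendsto (fun t : ℂ => e₂ (f x) + t • e₂ z) (𝓝 0) (𝓝 (e₂ (f x))) := by
    have : Continuous fun t : ℂ => e₂ (f x) + t • e₂ z := by fun_prop
    simpa using this.tendsto 0
  filter_upwards [hcont.eventually key] with t ht
  obtain ⟨x', hx', hfx'⟩ := ht
  refine ⟨e₁.symm x', hx', e₂.injective ?_⟩
  rw [hfx', map_add, map_smul]

end Smooth

/-! ### Approximation by frames with nonvanishing Pfaffian -/

section Approximation

variable {V : Type*} [AddCommGroup V] [Module ℂ V]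

/-- A multiple of the Pfaffian. -/
def pf (e : Basis (Fin 6) ℂ V) (a : ⋀[ℂ]^2 V) : ℂ := pr e (wedge V a a) a

theorem isPoly_pf [FiniteDimensional ℂ V] (e : Basis (Fin 6) ℂ V) : IsPoly (pf e) := by
  have h := IsPolyMap.bilin (pr e) (IsPolyMap.bilin (wedge V) IsPolyMap.id IsPolyMap.id)
    (IsPolyMap.id (M := ⋀[ℂ]^2 V))
  exact h LinearMap.id

theorem pf_add_smul (e : Basis (Fin 6) ℂ V) (a b : ⋀[ℂ]^2 V) (t : ℂ) :
    pf e (a + t • b) = pf e a + t * (3 * pr e (wedge V a a) b) +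
      t ^ 2 * (3 * pr e (wedge V b b) a) + t ^ 3 * pf e b := by
  have h1 : pr e (wedge V a b) a = pr e (wedge V a a) b := pr_wedge_swap e a b a
  have h2 : pr e (wedge V a b) b = pr e (wedge V b b) a := by
    rw [wedge_comm a b e, pr_wedge_swap]
  simp only [pf, map_add, map_smul, LinearMap.add_apply, LinearMap.smul_apply, smul_eq_mul,
    wedge_comm b a e, h1, h2]
  ring

/-- The relation `a ∧ d - b ∧ c`. -/
def relDefect (h : Fin 4 → ⋀[ℂ]^2 V) : ⋀[ℂ]^4 V := wedge V (h 0) (h 3) - wedge V (h 1) (h 2)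

theorem isPolyMap_relDefect [FiniteDimensional ℂ V] :
    IsPolyMap (relDefect : (Fin 4 → ⋀[ℂ]^2 V) → ⋀[ℂ]^4 V) :=
  (IsPolyMap.bilin _ (IsPolyMap.id.apply _) (IsPolyMap.id.apply _)).sub
    (IsPolyMap.bilin _ (IsPolyMap.id.apply _) (IsPolyMap.id.apply _))

theorem relDefect_add_smul (h y : Fin 4 → ⋀[ℂ]^2 V) (t : ℂ) :
    relDefect (h + t • y) = relDefect h + t • (wedge V (y 0) (h 3) + wedge V (h 0) (y 3) -
      wedge V (y 1) (h 2) - wedge V (h 1) (y 2)) + t ^ 2 • relDefect y := by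
  simp only [relDefect, Pi.add_apply, Pi.smul_apply, map_add, map_smul, LinearMap.add_apply,
    LinearMap.smul_apply]
  module

/-- The linear map `y ↦ (y₀ ∧ d + a ∧ y₃ - y₁ ∧ c - b ∧ y₂, 3 a ∧ a ∧ y₀)`. -/
def relDeriv (e : Basis (Fin 6) ℂ V) (h : Fin 4 → ⋀[ℂ]^2 V) :
    (Fin 4 → ⋀[ℂ]^2 V) →ₗ[ℂ] ⋀[ℂ]^4 V × ℂ :=
  LinearMap.prod
    ((wedge V).flip (h 3) ∘ₗ LinearMap.proj 0 + wedge V (h 0) ∘ₗ LinearMap.proj 3 -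
      (wedge V).flip (h 2) ∘ₗ LinearMap.proj 1 - wedge V (h 1) ∘ₗ LinearMap.proj 2)
    ((3 : ℂ) • (pr e (wedge V (h 0) (h 0)) ∘ₗ LinearMap.proj 0))

theorem relDeriv_fst (e : Basis (Fin 6) ℂ V) (h y : Fin 4 → ⋀[ℂ]^2 V) :
    (relDeriv e h y).1 = wedge V (y 0) (h 3) + wedge V (h 0) (y 3) - wedge V (y 1) (h 2) -
      wedge V (h 1) (y 2) := rfl

theorem relDeriv_snd (e : Basis (Fin 6) ℂ V) (h y : Fin 4 → ⋀[ℂ]^2 V) :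
    (relDeriv e h y).2 = 3 * pr e (wedge V (h 0) (h 0)) (y 0) := rfl

/-- A functional killing the image is a pair of a bivector g and a scalar μ. Varying y₃, y₂, y₁
shows that g annihilates `h 0`, `h 1`, `h 2`, so g = 0; varying y₀ then gives μ h₀ ∧ h₀ = 0. -/
theorem surjective_relDeriv (e : Basis (Fin 6) ℂ V) {h : Fin 4 → ⋀[ℂ]^2 V}
    (hreg : ∀ g, wedge V g (h 0) = 0 → wedge V g (h 1) = 0 → wedge V g (h 2) = 0 → g = 0)
    (h00 : wedge V (h 0) (h 0) ≠ 0) : Function.Surjective (relDeriv e h) := by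
  rw [← LinearMap.range_eq_top]
  by_contra hne
  obtain ⟨φ, hφ, hle⟩ := Submodule.exists_le_ker_of_lt_top _ (lt_top_iff_ne_top.2 hne)
  have hφ0 : ∀ y, φ (relDeriv e h y) = 0 := fun y => hle ⟨y, rfl⟩
  obtain ⟨g, hg⟩ := exists_pr_eq e (φ ∘ₗ LinearMap.inl ℂ _ _)
  have hsplit : ∀ y s, φ (y, s) = pr e y g + s * φ (0, 1) := by
    intro y s
    rw [← hg y]
    have : (y, s) = LinearMap.inl ℂ (⋀[ℂ]^4 V) ℂ y + s • ((0, 1) : ⋀[ℂ]^4 V × ℂ) := by simp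
    rw [this, map_add, map_smul, smul_eq_mul]
    rfl
  have happ : ∀ y : Fin 4 → ⋀[ℂ]^2 V, pr e (wedge V (y 0) (h 3) + wedge V (h 0) (y 3) -
      wedge V (y 1) (h 2) - wedge V (h 1) (y 2)) g + 3 * pr e (wedge V (h 0) (h 0)) (y 0) * φ (0, 1) = 0 := by
    intro y
    rw [← hsplit]
    exact hφ0 y
  have hg0 : wedge V g (h 0) = 0 := wedge_eq_zero_of_pr e fun x => by
    simpa using happ (Pi.single 3 x)
  have hg1 : wedge V g (h 1) = 0 := wedge_eq_zero_of_pr e fun x => by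
    simpa using happ (Pi.single 2 x)
  have hg2 : wedge V g (h 2) = 0 := wedge_eq_zero_of_pr e fun x => by
    rw [wedge_comm (h 2) x e]
    simpa using happ (Pi.single 1 x)
  have hgz := hreg g hg0 hg1 hg2
  have hμ : φ (0, 1) = 0 := by
    by_contra hμ
    apply h00
    apply pr_injective e
    refine LinearMap.ext fun x => ?_
    have := happ (Pi.single 0 x)
    rw [hgz] at this
    simpa [hμ] using this
  apply hφ
  refine LinearMap.ext fun ⟨y, s⟩ => ?_
  rw [hsplit, hgz, hμ]
  simp

/-- By submersivity the pair (relation, Pfaffian) can be moved in the direction (0, 1), which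
changes the Pfaffian alone; for small t ≠ 0 its new value is nonzero. -/
theorem exists_frame_pf_ne_zero [FiniteDimensional ℂ V] (e : Basis (Fin 6) ℂ V)
    {h : Fin 4 → ⋀[ℂ]^2 V} (hrel : relDefect h = 0)
    (hreg : ∀ g, wedge V g (h 0) = 0 → wedge V g (h 1) = 0 → wedge V g (h 2) = 0 → g = 0)
    (h00 : wedge V (h 0) (h 0) ≠ 0) {G : (Fin 4 → ⋀[ℂ]^2 V) → ℂ} (hG : IsPoly G) (hGh : G h ≠ 0) :
    ∃ h', G h' ≠ 0 ∧ relDefect h' = 0 ∧ pf e (h' 0) ≠ 0 := by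
  have hf : IsPolyMap fun h : Fin 4 → ⋀[ℂ]^2 V => (relDefect h, pf e (h 0)) := by
    intro φ
    have h1 : ∀ h : Fin 4 → ⋀[ℂ]^2 V, φ (relDefect h, pf e (h 0)) =
        (φ ∘ₗ LinearMap.inl ℂ _ _) (relDefect h) + pf e (h 0) * φ (0, 1) := by
      intro h
      have : (relDefect h, pf e (h 0)) = LinearMap.inl ℂ (⋀[ℂ]^4 V) ℂ (relDefect h) +
        pf e (h 0) • ((0, 1) : ⋀[ℂ]^4 V × ℂ) := by simp
      rw [this, map_add, map_smul, smul_eq_mul]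
      rfl
    simp only [h1]
    exact (isPolyMap_relDefect _).add (((isPoly_pf e).comp (IsPolyMap.id.apply 0)).mul
      (IsPoly.const _))
  have key := eventually_exists_of_surjective hf (f' := relDeriv e h) (x := h) (fun y =>
    ⟨(relDefect y, 3 * pr e (wedge V (y 0) (y 0)) (h 0)), (0, pf e (y 0)), fun t => by
      refine Prod.ext ?_ ?_
      · simpa [relDeriv_fst] using relDefect_add_smul h y t
      · simpa [relDeriv_snd] using pf_add_smul e (h 0) (y 0) t⟩)
    (surjective_relDeriv e hreg h00) hG hGh (0, 1)
  have hne : ∀ᶠ t : ℂ in nhdsWithin 0 {0}ᶜ, pf e (h 0) + t ≠ 0 := by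
    by_cases h0 : pf e (h 0) = 0
    · filter_upwards [self_mem_nhdsWithin] with t ht
      simpa [h0] using ht
    · apply Filter.Eventually.filter_mono nhdsWithin_le_nhds
      have : ContinuousAt (fun t : ℂ => pf e (h 0) + t) 0 := by fun_prop
      exact this.eventually_ne (by simpa using h0)
  obtain ⟨t, ⟨h', hG', hh'⟩, ht⟩ := ((key.filter_mono nhdsWithin_le_nhds).and hne).exists
  have h1 := congrArg Prod.fst hh'
  have h2 := congrArg Prod.snd hh'
  refine ⟨h', hG', ?_, ?_⟩
  · simpa [hrel] using h1
  · have h3 : pf e (h' 0) = pf e (h 0) + t := by simpa using h2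
    rwa [h3]

/-- Density of the planes with nonzero Pfaffian: at least one of the triples (a, b, c) and (d, b, c)
has no common annihilator, and the submersion argument applies to it. -/
theorem IsHyperbolic.exists_frame (hV : finrank ℂ V = 6) [FiniteDimensional ℂ V]
    (e : Basis (Fin 6) ℂ V)
    {h : Fin 4 → ⋀[ℂ]^2 V} (hh : IsHyperbolic h) {O : Set (Gr 4 (⋀[ℂ]^2 V))} (hO : IsOpen O)
    (hmem : spanGr h (hh.linearIndependent e) ∈ O) :
    ∃ (h' : Fin 4 → ⋀[ℂ]^2 V) (hli : LinearIndependent ℂ h'), spanGr h' hli ∈ O ∧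
      relDefect h' = 0 ∧ pf e (h' 0) ≠ 0 := by
  have hbc := indepPencil_of_mono hh.indep
  have main : ∀ h' (hli : LinearIndependent ℂ h'), spanGr h' hli ∈ O → relDefect h' = 0 →
      (∀ g, wedge V g (h' 0) = 0 → wedge V g (h' 1) = 0 → wedge V g (h' 2) = 0 → g = 0) →
      wedge V (h' 0) (h' 0) ≠ 0 → ∃ (h' : Fin 4 → ⋀[ℂ]^2 V) (hli : LinearIndependent ℂ h'),
        spanGr h' hli ∈ O ∧ relDefect h' = 0 ∧ pf e (h' 0) ≠ 0 := by
    intro h' hli hO' hrel hreg h00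
    obtain ⟨G, hG, hGh, hGO⟩ := exists_isPoly_of_isOpen hO h' hli hO'
    obtain ⟨G', hG', hGh', hli'⟩ := exists_isPoly_linearIndependent
      (F := fun i (h : Fin 4 → ⋀[ℂ]^2 V) => h i) (fun i => IsPolyMap.id.apply i) hli
    obtain ⟨h'', hne, hrel'', hpf⟩ := exists_frame_pf_ne_zero e hrel hreg h00 (hG.mul hG')
      (mul_ne_zero hGh hGh')
    exact ⟨h'', hli' _ (right_ne_zero_of_mul hne), hGO _ _ (left_ne_zero_of_mul hne), hrel'', hpf⟩
  by_cases hreg : ∀ g, wedge V g (h 0) = 0 → wedge V g (h 1) = 0 → wedge V g (h 2) = 0 → g = 0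
  · exact main h _ hmem (sub_eq_zero.2 hh.rel) hreg (hh.indep.ne_zero 0)
  · push Not at hreg
    obtain ⟨g, hg0, hg1, hg2, hg⟩ := hreg
    -- Exchanging a and d preserves the span and the relation. A common annihilator of d, b, c would
    -- be proportional to `g`, and `g` would annihilate the whole frame.
    let σ : Equiv.Perm (Fin 4) := Equiv.swap 0 3
    have hli : LinearIndependent ℂ (h ∘ σ) := (hh.linearIndependent e).comp _ σ.injective
    have hspan : spanGr (h ∘ σ) hli = spanGr h (hh.linearIndependent e) :=
      spanGr_congr _ _ fun i => Submodule.subset_span ⟨σ i, rfl⟩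
    refine main (h ∘ σ) hli (hspan ▸ hmem) ?_ ?_ (hh.indep.ne_zero 8)
    · change wedge V (h 3) (h 0) - wedge V (h 1) (h 2) = 0
      rw [wedge_comm (h 3) (h 0) e, hh.rel, sub_self]
    · intro g' (h0 : wedge V g' (h 3) = 0) (h1 : wedge V g' (h 1) = 0) (h2 : wedge V g' (h 2) = 0)
      obtain ⟨s, rfl⟩ := exists_smul_eq_of_annihilates hV hbc hg hg1 hg2 h1 h2
      by_contra hs
      have hs0 : s ≠ 0 := fun h => hs (by rw [h, zero_smul])
      have hg3 : wedge V g (h 3) = 0 := by simpa [hs0] using h0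
      refine hg (eq_zero_of_annihilates hV hh.indep hbc fun i => ?_)
      fin_cases i <;> assumption

end Approximation

/-! ### Polynomial maps and products -/

section Products

variable {M N T : Type*} [AddCommGroup M] [Module ℂ M] [AddCommGroup N] [Module ℂ N]
  [AddCommGroup T] [Module ℂ T]

theorem IsPolyMap.fst : IsPolyMap fun p : M × N => p.1 := IsPolyMap.linear (LinearMap.fst ℂ M N)

theorem IsPolyMap.snd : IsPolyMap fun p : M × N => p.2 := IsPolyMap.linear (LinearMap.snd ℂ M N)

theorem IsPolyMap.coe (S : Submodule ℂ N) : IsPolyMap fun x : S => (x : N) :=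
  IsPolyMap.linear S.subtype

theorem IsPolyMap.prodMk {F : T → M} {G : T → N} (hF : IsPolyMap F) (hG : IsPolyMap G) :
    IsPolyMap fun x => (F x, G x) := by
  have h := ((IsPolyMap.linear (LinearMap.inl ℂ M N)).comp hF).add
    ((IsPolyMap.linear (LinearMap.inr ℂ M N)).comp hG)
  simpa using h

end Products

/-! ### Polynomial families of linear maps -/

section Adjugate

variable {P W T : Type*} [AddCommGroup P] [Module ℂ P] [AddCommGroup W] [Module ℂ W]
  [FiniteDimensional ℂ W] [AddCommGroup T] [Module ℂ T] [FiniteDimensional ℂ T]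

/-- A polynomial inverse, up to a factor, of a family of linear maps depending linearly on a
parameter. -/
theorem exists_adjugate (A : P →ₗ[ℂ] W →ₗ[ℂ] T) (hWT : finrank ℂ W = finrank ℂ T) :
    ∃ (D : P → ℂ) (K : P → T →ₗ[ℂ] W), IsPolyMap (fun p : P × T => K p.1 p.2) ∧
      (∀ p w, K p (A p w) = D p • w) ∧ (∀ p y, A p (K p y) = D p • y) ∧
      ∀ p, Function.Injective (A p) → D p ≠ 0 := by
  let bW := finBasis ℂ W
  let bT := finBasisOfFinrankEq ℂ T hWT.symm
  let N : P → Matrix (Fin (finrank ℂ W)) (Fin (finrank ℂ W)) ℂ :=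
    fun p => LinearMap.toMatrix bW bT (A p)
  have hA : ∀ p, A p = Matrix.toLin bW bT (N p) := fun p => (Matrix.toLin_toMatrix _ _ _).symm
  refine ⟨fun p => (N p).det, fun p => Matrix.toLin bT bW (N p).adjugate, ?_, ?_, ?_, ?_⟩
  · intro φ
    have h1 : ∀ p : P × T, φ (Matrix.toLin bT bW (N p.1).adjugate p.2) =
        ∑ i, (∑ j, (N p.1).adjugate i j * bT.coord j p.2) * φ (bW i) := by
      intro p
      rw [Matrix.toLin_apply, map_sum]
      refine Finset.sum_congr rfl fun i _ => ?_
      rw [map_smul, smul_eq_mul]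
      rfl
    simp only [h1]
    refine IsPoly.sum _ fun i _ => IsPoly.mul (IsPoly.sum _ fun j _ => IsPoly.mul ?_ ?_)
      (IsPoly.const _)
    · refine IsPoly.adjugate (fun i j => ?_) i j
      have h2 : (fun p : P × T => N p.1 i j) = fun p =>
          (bT.coord i ∘ₗ A.flip (bW j) ∘ₗ LinearMap.fst ℂ P T) p := by
        funext p
        simp [N, LinearMap.toMatrix_apply]
      rw [h2]
      exact IsPoly.linear _
    · exact IsPoly.linear (bT.coord j ∘ₗ LinearMap.snd ℂ P T)
  · intro p w
    rw [hA, ← LinearMap.comp_apply, ← Matrix.toLin_mul, Matrix.adjugate_mul, map_smul,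
      Matrix.toLin_one, LinearMap.smul_apply, LinearMap.id_apply]
  · intro p y
    rw [hA, ← LinearMap.comp_apply, ← Matrix.toLin_mul, Matrix.mul_adjugate, map_smul,
      Matrix.toLin_one, LinearMap.smul_apply, LinearMap.id_apply]
  · intro p hp
    let E := LinearEquiv.ofBijective (A p)
      ⟨hp, (LinearMap.injective_iff_surjective_of_finrank_eq_finrank hWT).1 hp⟩
    exact (LinearEquiv.isUnit_det E bW bT).ne_zero

end Adjugate

/-! ### Four-planes with a relation modulo a subspace -/

section Incidence

variable {V : Type*} [AddCommGroup V] [Module ℂ V]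

/-- The four-planes spanned by frames `a, b, c, d` with `a` nondegenerate and `a ∧ d - b ∧ c`
in `M`. -/
def incid (e : Basis (Fin 6) ℂ V) (M : Submodule ℂ (⋀[ℂ]^4 V)) : Set (Gr 4 (⋀[ℂ]^2 V)) :=
  {H | ∃ (h : Fin 4 → ⋀[ℂ]^2 V) (hh : LinearIndependent ℂ h), spanGr h hh = H ∧
    pf e (h 0) ≠ 0 ∧ relDefect h ∈ M}

/-- The four-planes `H` such that `Sym² H` does not inject into the quotient by `M`. -/
def degen (M : Submodule ℂ (⋀[ℂ]^4 V)) : Set (Gr 4 (⋀[ℂ]^2 V)) :=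
  {H | ∃ (h : Fin 4 → ⋀[ℂ]^2 V) (hh : LinearIndependent ℂ h), spanGr h hh = H ∧
    ∃ x : Fin 10 → ℂ, x ≠ 0 ∧ ∑ l, x l • mono h l ∈ M}

theorem sum_hypCoeff_eq_relDefect (h : Fin 4 → ⋀[ℂ]^2 V) :
    ∑ l, hypCoeff l • mono h l = relDefect h := sum_hypCoeff_smul_mono h

theorem hypCoeff_ne_zero : hypCoeff ≠ 0 := fun h => by
  have := congrFun h (Fin.last 9)
  rw [hypCoeff_last] at this
  exact one_ne_zero this

theorem incid_subset_degen (e : Basis (Fin 6) ℂ V) (M : Submodule ℂ (⋀[ℂ]^4 V)) :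
    incid e M ⊆ degen M := by
  rintro H ⟨h, hh, rfl, -, hM⟩
  exact ⟨h, hh, rfl, hypCoeff, hypCoeff_ne_zero, by rwa [sum_hypCoeff_eq_relDefect]⟩

theorem incid_mono (e : Basis (Fin 6) ℂ V) {M M' : Submodule ℂ (⋀[ℂ]^4 V)} (hM : M ≤ M') :
    incid e M ⊆ incid e M' := by
  rintro H ⟨h, hh, rfl, hpf, hrel⟩
  exact ⟨h, hh, rfl, hpf, hM hrel⟩

theorem exists_matrix_of_spanGr_eq {k : ℕ} {W : Type*} [AddCommGroup W] [Module ℂ W]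
    {h h' : Fin k → W} {hh : LinearIndependent ℂ h} {hh' : LinearIndependent ℂ h'}
    (heq : spanGr h' hh' = spanGr h hh) :
    ∃ P : Matrix (Fin k) (Fin k) ℂ, IsUnit P.det ∧ h' = fun j => ∑ i, P i j • h i := by
  have hmem : ∀ j, h' j ∈ Submodule.span ℂ (Set.range h) := by
    intro j
    have h1 : Submodule.span ℂ (Set.range h') = Submodule.span ℂ (Set.range h) :=
      Subtype.ext_iff.1 heq
    rw [← h1]
    exact Submodule.subset_span ⟨j, rfl⟩
  simp only [Submodule.mem_span_range_iff_exists_fun] at hmem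
  choose c hc using hmem
  refine ⟨Matrix.of fun i j => c j i, ?_, funext fun j => (hc j).symm⟩
  rw [isUnit_iff_ne_zero]
  intro hdet
  obtain ⟨v, hv, hv0⟩ := Matrix.exists_mulVec_eq_zero_iff.2 hdet
  apply hv
  funext j
  refine Fintype.linearIndependent_iff.1 hh' v ?_ j
  simp only [← hc, Finset.smul_sum, smul_smul]
  rw [Finset.sum_comm]
  refine Finset.sum_eq_zero fun i _ => ?_
  rw [← Finset.sum_smul]
  have h2 := congrFun hv0 i
  simp only [Matrix.mulVec, dotProduct, Matrix.of_apply, Pi.zero_apply] at h2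
  simp only [mul_comm (c _ i)] at h2
  rw [h2, zero_smul]

/-- A change of frame acts on coefficient matrices by an invertible congruence, so testing one frame
suffices. -/
theorem not_mem_degen {M : Submodule ℂ (⋀[ℂ]^4 V)} (e : Basis (Fin 6) ℂ V)
    {h : Fin 4 → ⋀[ℂ]^2 V} (hh : LinearIndependent ℂ h)
    (hx : ∀ x : Fin 10 → ℂ, ∑ l, x l • mono h l ∈ M → x = 0) : spanGr h hh ∉ degen M := by
  rintro ⟨h', hh', heq, x, hx0, hxM⟩
  obtain ⟨P, hP, rfl⟩ := exists_matrix_of_spanGr_eq heq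
  rw [← quad_symMat e, quad_sum_smul] at hxM
  have hs : (P * symMat x * P.transpose).IsSymm := by
    rw [Matrix.IsSymm, Matrix.transpose_mul, Matrix.transpose_mul, Matrix.transpose_transpose,
      (isSymm_symMat x).eq, Matrix.mul_assoc]
  rw [← symMat_symCoeff hs, quad_symMat e] at hxM
  have h0 := hx _ hxM
  have h1 : P * symMat x * P.transpose = 0 := by
    rw [← symMat_symCoeff hs, h0]
    ext i j
    fin_cases i <;> fin_cases j <;> simp [symMat]
  apply hx0
  apply symMat_injective
  have hPt : IsUnit P.transpose.det := by rwa [Matrix.det_transpose]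
  have h2 : symMat x = P⁻¹ * (P * symMat x * P.transpose) * P.transpose⁻¹ := by
    rw [Matrix.mul_assoc P, Matrix.nonsing_inv_mul_cancel_left _ _ hP,
      Matrix.mul_nonsing_inv_cancel_right _ _ hPt]
  rw [h2, h1, Matrix.mul_zero, Matrix.zero_mul]
  ext i j
  fin_cases i <;> fin_cases j <;> simp [symMat]

/-- The complement is the locus where the ten monomials are independent modulo `M`, an open
condition on frames. -/
theorem isClosed_degen [FiniteDimensional ℂ V] (e : Basis (Fin 6) ℂ V)
    (M : Submodule ℂ (⋀[ℂ]^4 V)) : IsClosed (degen M) := by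
  rw [← isOpen_compl_iff]
  refine isOpen_of_forall_exists_isPoly fun H hH => ?_
  obtain ⟨h, hh, rfl⟩ := exists_spanGr_eq H
  have hli : ∀ h : Fin 4 → ⋀[ℂ]^2 V, LinearIndependent ℂ (fun l => M.mkQ (mono h l)) ↔
      ∀ x : Fin 10 → ℂ, ∑ l, x l • mono h l ∈ M → x = 0 := by
    intro h
    rw [Fintype.linearIndependent_iff]
    refine forall_congr' fun x => ?_
    rw [funext_iff]
    refine imp_congr_left ?_
    rw [← Submodule.Quotient.mk_eq_zero, ← Submodule.mkQ_apply, map_sum]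
    simp only [map_smul]
  have h1 : LinearIndependent ℂ (fun l => M.mkQ (mono h l)) := by
    rw [hli]
    intro x hx
    by_contra hx0
    exact hH ⟨h, hh, rfl, x, hx0, hx⟩
  obtain ⟨G, hG, hGh, hG'⟩ := exists_isPoly_linearIndependent
    (F := fun l (h : Fin 4 → ⋀[ℂ]^2 V) => M.mkQ (mono h l))
    (fun l => (IsPolyMap.linear M.mkQ).comp (isPolyMap_mono l)) h1
  exact ⟨h, hh, rfl, G, hG, hGh, fun h' hh' hne => not_mem_degen e hh' ((hli h').1 (hG' h' hne))⟩

/-- Writing m for the defect, a ∧ d = b ∧ c + m determines d because a ∧ · is invertible. The set is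
thus parametrized by the (a, b, c, m) in a nonempty open subset of a vector space. -/
theorem isPreirreducible_incid [FiniteDimensional ℂ V] (hV : finrank ℂ V = 6)
    (e : Basis (Fin 6) ℂ V) (M : Submodule ℂ (⋀[ℂ]^4 V)) : IsPreirreducible (incid e M) := by
  obtain ⟨D, K, hK, hKA, hAK, hD⟩ := exists_adjugate (wedge V)
    ((finrank_bivector e).trans (finrank_fourvector e).symm)
  have hDpf : ∀ a, pf e a ≠ 0 → D a ≠ 0 := fun a ha =>
    hD a (injective_wedge_of_pr_ne_zero hV e ha)
  -- `K a` is the adjugate rather than the inverse of a ∧ ·, which makes `Φ` polynomial; its last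
  -- vector is `D a` times d, with the same span.
  let Φ : (Fin 3 → ⋀[ℂ]^2 V) × M → Fin 4 → ⋀[ℂ]^2 V := fun p =>
    ![p.1 0, p.1 1, p.1 2, K (p.1 0) (wedge V (p.1 1) (p.1 2) + p.2)]
  have hproj : ∀ i, IsPolyMap fun p : (Fin 3 → ⋀[ℂ]^2 V) × M => p.1 i := fun i =>
    IsPolyMap.apply IsPolyMap.fst i
  have hΦ : IsPolyMap Φ := by
    refine IsPolyMap.pi fun i => ?_
    fin_cases i
    · exact hproj 0
    · exact hproj 1
    · exact hproj 2
    · have h1 : IsPolyMap fun p : (Fin 3 → ⋀[ℂ]^2 V) × M =>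
          wedge V (p.1 1) (p.1 2) + (p.2 : ⋀[ℂ]^4 V) :=
        (IsPolyMap.bilin (wedge V) (hproj 1) (hproj 2)).add
          ((IsPolyMap.coe M).comp IsPolyMap.snd)
      exact hK.comp ((hproj 0).prodMk h1)
  have hpoint : ∀ O : Set (Gr 4 (⋀[ℂ]^2 V)), IsOpen O → (incid e M ∩ O).Nonempty →
      ∃ (f : (Fin 3 → ⋀[ℂ]^2 V) × M → ℂ) (p : (Fin 3 → ⋀[ℂ]^2 V) × M), IsPoly f ∧ f p ≠ 0 ∧
        ∀ p', f p' ≠ 0 → ∃ hli : LinearIndependent ℂ (Φ p'), spanGr (Φ p') hli ∈ O ∧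
          pf e (p'.1 0) ≠ 0 := by
    rintro O hO ⟨_, ⟨h, hh, rfl, hpf, hrel⟩, hmem⟩
    let p : (Fin 3 → ⋀[ℂ]^2 V) × M := (![h 0, h 1, h 2], ⟨relDefect h, hrel⟩)
    let u : Fin 4 → ℂˣ := ![1, 1, 1, Units.mk0 (D (h 0)) (hDpf _ hpf)]
    have hp : Φ p = u • h := by
      funext i
      fin_cases i
      · exact (one_smul ℂ (h 0)).symm
      · exact (one_smul ℂ (h 1)).symm
      · exact (one_smul ℂ (h 2)).symm
      · change K (h 0) (wedge V (h 1) (h 2) + relDefect h) = D (h 0) • h 3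
        rw [relDefect, add_sub_cancel, hKA]
    have hli : LinearIndependent ℂ (Φ p) := by
      rw [hp]
      exact hh.units_smul u
    have hspan : spanGr (Φ p) hli = spanGr h hh := spanGr_congr _ _ fun i => by
      rw [hp]
      exact Submodule.smul_mem _ _ (Submodule.subset_span ⟨i, rfl⟩)
    obtain ⟨G, hG, hGh, hGO⟩ := exists_isPoly_of_isOpen hO (Φ p) hli (hspan ▸ hmem)
    obtain ⟨G', hG', hGh', hli'⟩ := exists_isPoly_linearIndependent
      (F := fun i (h : Fin 4 → ⋀[ℂ]^2 V) => h i) (fun i => IsPolyMap.id.apply i) hli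
    refine ⟨fun p => G (Φ p) * G' (Φ p) * pf e (p.1 0), p, ?_, ?_, ?_⟩
    · exact ((hG.comp hΦ).mul (hG'.comp hΦ)).mul ((isPoly_pf e).comp (hproj 0))
    · exact mul_ne_zero (mul_ne_zero hGh hGh') hpf
    · intro p' hp'
      have h1 := left_ne_zero_of_mul hp'
      have h2 := hli' _ (right_ne_zero_of_mul h1)
      exact ⟨h2, hGO _ h2 (left_ne_zero_of_mul h1), right_ne_zero_of_mul hp'⟩
  intro O₁ O₂ hO₁ hO₂ hne₁ hne₂
  obtain ⟨f₁, p₁, hf₁, hfp₁, hp₁⟩ := hpoint O₁ hO₁ hne₁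
  obtain ⟨f₂, p₂, hf₂, hfp₂, hp₂⟩ := hpoint O₂ hO₂ hne₂
  obtain ⟨p, hfp₁', hfp₂'⟩ := IsPoly.exists_ne_zero_of_mul hf₁ hf₂ hfp₁ hfp₂
  obtain ⟨hli, hmem₁, hpf⟩ := hp₁ p hfp₁'
  obtain ⟨_, hmem₂, _⟩ := hp₂ p hfp₂'
  refine ⟨spanGr (Φ p) hli, ?_, hmem₁, hmem₂⟩
  have hD0 := hDpf _ hpf
  -- Dividing by `D` recovers the vector d for which the defect is exactly `p.2`.
  let u : Fin 4 → ℂˣ := ![1, 1, 1, (Units.mk0 (D (p.1 0)) hD0)⁻¹]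
  have hli' : LinearIndependent ℂ (u • Φ p) := hli.units_smul u
  refine ⟨u • Φ p, hli', spanGr_congr _ _ fun i =>
    Submodule.smul_mem _ _ (Submodule.subset_span ⟨i, rfl⟩), ?_, ?_⟩
  · have h0 : (u • Φ p) 0 = p.1 0 := one_smul ℂ (p.1 0)
    rwa [h0]
  · have h0 : (u • Φ p) 0 = p.1 0 := one_smul ℂ (p.1 0)
    have h1 : (u • Φ p) 1 = p.1 1 := one_smul ℂ (p.1 1)
    have h2 : (u • Φ p) 2 = p.1 2 := one_smul ℂ (p.1 2)
    have h3 : (u • Φ p) 3 = (D (p.1 0))⁻¹ • K (p.1 0) (wedge V (p.1 1) (p.1 2) + p.2) := rfl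
    rw [relDefect, h0, h1, h2, h3, map_smul, hAK, inv_smul_smul₀ hD0, add_sub_cancel_left]
    exact p.2.2

end Incidence

/-! ### Equations of the locus near a hyperbolic frame -/

section Equations

open Matrix

variable {V : Type*} [AddCommGroup V] [Module ℂ V]

/-- The matrix of the first nine monomials in the coordinates `θ`. -/
def monoMat (θ : ⋀[ℂ]^4 V →ₗ[ℂ] (Fin 9 → ℂ)) (h : Fin 4 → ⋀[ℂ]^2 V) :
    Matrix (Fin 9) (Fin 9) ℂ :=
  Matrix.of fun i j => θ (mono h j.castSucc) i

/-- The coefficients of the relation between the monomials modulo the kernel of `θ`. -/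
def relVec (θ : ⋀[ℂ]^4 V →ₗ[ℂ] (Fin 9 → ℂ)) (h : Fin 4 → ⋀[ℂ]^2 V) : Fin 10 → ℂ :=
  -- Cramer's rule with the determinant cleared from the denominators, so the entries are polynomial
  -- in `h`.
  Fin.snoc (α := fun _ => ℂ)
    (fun l => -((monoMat θ h).adjugate *ᵥ θ (mono h (Fin.last 9))) l) (monoMat θ h).det

variable {θ : ⋀[ℂ]^4 V →ₗ[ℂ] (Fin 9 → ℂ)}

theorem relVec_last (h : Fin 4 → ⋀[ℂ]^2 V) : relVec θ h (Fin.last 9) = (monoMat θ h).det :=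
  Fin.snoc_last (α := fun _ => ℂ) _ _

theorem relVec_castSucc (h : Fin 4 → ⋀[ℂ]^2 V) (l : Fin 9) : relVec θ h l.castSucc =
    -((monoMat θ h).adjugate *ᵥ θ (mono h (Fin.last 9))) l :=
  Fin.snoc_castSucc (α := fun _ => ℂ) _ _ _

theorem map_sum_smul_mono (h : Fin 4 → ⋀[ℂ]^2 V) (x : Fin 10 → ℂ) :
    θ (∑ l, x l • mono h l) = monoMat θ h *ᵥ (fun l => x l.castSucc) +
      x (Fin.last 9) • θ (mono h (Fin.last 9)) := by
  rw [Fin.sum_univ_castSucc, map_add, map_smul, map_sum]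
  congr 1
  funext i
  simp only [map_smul, Finset.sum_apply, Pi.smul_apply, smul_eq_mul, mulVec, dotProduct, monoMat,
    Matrix.of_apply]
  exact Finset.sum_congr rfl fun j _ => mul_comm _ _

theorem map_sum_relVec (h : Fin 4 → ⋀[ℂ]^2 V) : θ (∑ l, relVec θ h l • mono h l) = 0 := by
  rw [map_sum_smul_mono, relVec_last]
  have h1 : (fun l : Fin 9 => relVec θ h l.castSucc) =
      -((monoMat θ h).adjugate *ᵥ θ (mono h (Fin.last 9))) := funext fun l => relVec_castSucc h l
  rw [h1, mulVec_neg, mulVec_mulVec, mul_adjugate, smul_mulVec, one_mulVec, neg_add_cancel]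

theorem eq_zero_of_map_sum_eq_zero {h : Fin 4 → ⋀[ℂ]^2 V} (hdet : (monoMat θ h).det ≠ 0)
    {x : Fin 10 → ℂ} (hx : x (Fin.last 9) = 0) (h0 : θ (∑ l, x l • mono h l) = 0) : x = 0 := by
  rw [map_sum_smul_mono, hx, zero_smul, add_zero] at h0
  have h1 := Matrix.eq_zero_of_mulVec_eq_zero hdet h0
  funext l
  exact Fin.lastCases hx (fun l => congrFun h1 l) l

/-- Relations modulo the kernel of `θ` form a line: the difference of the two sides has no x₀x₃
term, and the other nine monomials are independent under `θ`. -/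
theorem det_smul_eq_smul_relVec {h : Fin 4 → ⋀[ℂ]^2 V} (hdet : (monoMat θ h).det ≠ 0)
    {x : Fin 10 → ℂ} (h0 : θ (∑ l, x l • mono h l) = 0) :
    (monoMat θ h).det • x = x (Fin.last 9) • relVec θ h := by
  rw [← sub_eq_zero]
  refine eq_zero_of_map_sum_eq_zero hdet ?_ ?_
  · rw [Pi.sub_apply, Pi.smul_apply, Pi.smul_apply, relVec_last, smul_eq_mul, smul_eq_mul, mul_comm,
      sub_self]
  · have h1 : ∑ l, ((monoMat θ h).det • x - x (Fin.last 9) • relVec θ h) l • mono h l =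
        (monoMat θ h).det • (∑ l, x l • mono h l) -
          x (Fin.last 9) • ∑ l, relVec θ h l • mono h l := by
      rw [Finset.smul_sum, Finset.smul_sum, ← Finset.sum_sub_distrib]
      refine Finset.sum_congr rfl fun l _ => ?_
      rw [Pi.sub_apply, Pi.smul_apply, Pi.smul_apply, smul_eq_mul, smul_eq_mul]
      module
    rw [h1, map_sub, map_smul, map_smul, h0, map_sum_relVec, smul_zero, smul_zero, sub_zero]

theorem isPoly_monoMat [FiniteDimensional ℂ V] (i j : Fin 9) :
    IsPoly fun h : Fin 4 → ⋀[ℂ]^2 V => monoMat θ h i j :=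
  isPolyMap_mono j.castSucc (LinearMap.proj i ∘ₗ θ)

theorem isPoly_relVec [FiniteDimensional ℂ V] (l : Fin 10) :
    IsPoly fun h : Fin 4 → ⋀[ℂ]^2 V => relVec θ h l := by
  refine Fin.lastCases ?_ (fun l => ?_) l
  · simp only [relVec_last]
    exact IsPoly.det isPoly_monoMat
  · simp only [relVec_castSucc, mulVec, dotProduct]
    exact (IsPoly.sum _ fun j _ => (IsPoly.adjugate isPoly_monoMat l j).mul
      (isPolyMap_mono (Fin.last 9) (LinearMap.proj j ∘ₗ θ))).neg

theorem isPoly_det_symMat {M : Type*} [AddCommGroup M] [Module ℂ M] {x : M → Fin 10 → ℂ}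
    (hx : ∀ l, IsPoly fun p => x p l) : IsPoly fun p => (symMat (x p)).det := by
  refine IsPoly.det fun i j => ?_
  have h2 : ∀ l, IsPoly fun p => x p l / 2 := fun l => by
    simpa [div_eq_mul_inv] using (hx l).mul (IsPoly.const 2⁻¹)
  fin_cases i <;> fin_cases j <;> first | exact hx _ | exact h2 _

/-- The nonvanishing of this polynomial ensures that the relation modulo the kernel of `θ` is
unique and nondegenerate. -/
def nondegPoly (θ : ⋀[ℂ]^4 V →ₗ[ℂ] (Fin 9 → ℂ)) (h : Fin 4 → ⋀[ℂ]^2 V) : ℂ :=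
  (monoMat θ h).det * (symMat (relVec θ h)).det

theorem isPoly_nondegPoly [FiniteDimensional ℂ V] :
    IsPoly (nondegPoly θ : (Fin 4 → ⋀[ℂ]^2 V) → ℂ) :=
  (IsPoly.det isPoly_monoMat).mul (isPoly_det_symMat isPoly_relVec)

theorem spanGr_mem_VV_of_nondegPoly (e : Basis (Fin 6) ℂ V) {h : Fin 4 → ⋀[ℂ]^2 V}
    (hh : LinearIndependent ℂ h) (hg : nondegPoly θ h ≠ 0)
    (hrel : ∑ l, relVec θ h l • mono h l = 0) : spanGr h hh ∈ VV V := by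
  have hdet := left_ne_zero_of_mul hg
  rw [spanGr_mem_VV_iff]
  refine ⟨symMat (relVec θ h), isSymm_symMat _, right_ne_zero_of_mul hg, fun M hM => ⟨fun h0 => ?_,
    ?_⟩⟩
  · rw [← symMat_symCoeff hM, quad_symMat e] at h0
    have h1 := det_smul_eq_smul_relVec hdet (x := symCoeff M) (by rw [h0, map_zero])
    refine ⟨(monoMat θ h).det⁻¹ * symCoeff M (Fin.last 9), ?_⟩
    rw [← symMat_smul, mul_smul, ← h1, inv_smul_smul₀ hdet, symMat_symCoeff hM]
  · rintro ⟨c, rfl⟩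
    rw [quad_smul, quad_symMat e, hrel, smul_zero]

/-- Any genuine relation is proportional to `relVec`, so `relVec` is itself a genuine relation as
soon as one exists. -/
theorem spanGr_mem_VV_of_mem_degen (e : Basis (Fin 6) ℂ V) {h : Fin 4 → ⋀[ℂ]^2 V}
    (hh : LinearIndependent ℂ h) (hg : nondegPoly θ h ≠ 0)
    (hd : spanGr h hh ∈ degen (⊥ : Submodule ℂ (⋀[ℂ]^4 V))) : spanGr h hh ∈ VV V := by
  have hdet := left_ne_zero_of_mul hg
  refine spanGr_mem_VV_of_nondegPoly e hh hg ?_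
  by_contra hrel
  refine not_mem_degen e hh (fun x hx => ?_) hd
  rw [Submodule.mem_bot] at hx
  have h1 := det_smul_eq_smul_relVec hdet (x := x) (by rw [hx, map_zero])
  have hx9 : x (Fin.last 9) = 0 := by
    by_contra hx9
    apply hrel
    have h2 : relVec θ h = ((x (Fin.last 9))⁻¹ * (monoMat θ h).det) • x := by
      rw [mul_smul, h1, inv_smul_smul₀ hx9]
    have h3 : ∑ l, relVec θ h l • mono h l =
        ((x (Fin.last 9))⁻¹ * (monoMat θ h).det) • ∑ l, x l • mono h l := by
      rw [Finset.smul_sum]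
      refine Finset.sum_congr rfl fun l _ => ?_
      rw [h2, Pi.smul_apply, smul_eq_mul, mul_smul]
    rw [h3, hx, smul_zero]
  exact eq_zero_of_map_sum_eq_zero hdet hx9 (by rw [hx, map_zero])

theorem VV_subset_degen (e : Basis (Fin 6) ℂ V) :
    VV V ⊆ degen (⊥ : Submodule ℂ (⋀[ℂ]^4 V)) := by
  intro H hH
  obtain ⟨h, hh, rfl⟩ := exists_isHyperbolic e hH
  refine ⟨h, hh.linearIndependent e, rfl, hypCoeff, hypCoeff_ne_zero, ?_⟩
  rw [Submodule.mem_bot, sum_hypCoeff_smul_mono, hh.rel, sub_self]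

theorem monoMat_eq_one {h : Fin 4 → ⋀[ℂ]^2 V}
    (hθ : ∀ l : Fin 9, θ (mono h l.castSucc) = Pi.single l 1) : monoMat θ h = 1 := by
  ext i j
  simp [monoMat, hθ, Matrix.one_apply, Pi.single_apply]

theorem IsHyperbolic.relVec_eq {h : Fin 4 → ⋀[ℂ]^2 V} (hh : IsHyperbolic h)
    (hθ : ∀ l : Fin 9, θ (mono h l.castSucc) = Pi.single l 1) : relVec θ h = hypCoeff := by
  have h1 : (monoMat θ h).det = 1 := by rw [monoMat_eq_one hθ, det_one]
  have h0 : ∑ l, hypCoeff l • mono h l = 0 := by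
    rw [sum_hypCoeff_smul_mono, hh.rel, sub_self]
  have h2 := det_smul_eq_smul_relVec (θ := θ) (h := h) (by rw [h1]; exact one_ne_zero)
    (x := hypCoeff) (by rw [h0, map_zero])
  rw [h1, hypCoeff_last, one_smul, one_smul] at h2
  exact h2.symm

theorem IsHyperbolic.nondegPoly_ne_zero {h : Fin 4 → ⋀[ℂ]^2 V} (hh : IsHyperbolic h)
    (hθ : ∀ l : Fin 9, θ (mono h l.castSucc) = Pi.single l 1) : nondegPoly θ h ≠ 0 := by
  rw [nondegPoly, hh.relVec_eq hθ, monoMat_eq_one hθ, det_one, one_mul]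
  exact det_symMat_hypCoeff

/-- Expresses that `VV` is open in `degen ⊥`: near a hyperbolic frame, a plane with a relation has a
unique and non-degenerate one. -/
theorem isOpen_compl_degen_union_VV [FiniteDimensional ℂ V] (e : Basis (Fin 6) ℂ V) :
    IsOpen ((degen (⊥ : Submodule ℂ (⋀[ℂ]^4 V)))ᶜ ∪ VV V) := by
  refine isOpen_of_forall_exists_isPoly fun H hH => ?_
  rcases hH with hH | hH
  · obtain ⟨h, hh, rfl⟩ := exists_spanGr_eq H
    obtain ⟨G, hG, hGh, hGO⟩ := exists_isPoly_of_isOpen (isClosed_degen e ⊥).isOpen_compl h hh hH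
    exact ⟨h, hh, rfl, G, hG, hGh, fun h' hh' hne => Or.inl (hGO h' hh' hne)⟩
  · obtain ⟨h, hh, rfl⟩ := exists_isHyperbolic e hH
    obtain ⟨θ, hθ⟩ := exists_dual_family hh.indep
    refine ⟨h, hh.linearIndependent e, rfl, nondegPoly θ, isPoly_nondegPoly,
      hh.nondegPoly_ne_zero hθ, fun h' hh' hne => ?_⟩
    by_cases hd : spanGr h' hh' ∈ degen (⊥ : Submodule ℂ (⋀[ℂ]^4 V))
    · exact Or.inr (spanGr_mem_VV_of_mem_degen e hh' hne hd)
    · exact Or.inl hd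

theorem VV_eq_inter (e : Basis (Fin 6) ℂ V) :
    VV V = ((degen (⊥ : Submodule ℂ (⋀[ℂ]^4 V)))ᶜ ∪ VV V) ∩ degen ⊥ := by
  ext H
  constructor
  · exact fun hH => ⟨Or.inr hH, VV_subset_degen e hH⟩
  · rintro ⟨hH | hH, hd⟩
    · exact absurd hd hH
    · exact hH

theorem isLocallyClosed_VV [FiniteDimensional ℂ V] (e : Basis (Fin 6) ℂ V) :
    IsLocallyClosed (VV V) :=
  ⟨_, _, isOpen_compl_degen_union_VV e, isClosed_degen e ⊥, VV_eq_inter e⟩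

theorem inter_incid_nonempty [FiniteDimensional ℂ V] (hV : finrank ℂ V = 6)
    (e : Basis (Fin 6) ℂ V) {O : Set (Gr 4 (⋀[ℂ]^2 V))} (hO : IsOpen O)
    (hne : (VV V ∩ O).Nonempty) : (incid e ⊥ ∩ O).Nonempty := by
  obtain ⟨H, hH, hHO⟩ := hne
  obtain ⟨h, hh, rfl⟩ := exists_isHyperbolic e hH
  obtain ⟨h', hli, hmem, hrel, hpf⟩ := hh.exists_frame hV e hO hHO
  exact ⟨_, ⟨h', hli, rfl, hpf, (Submodule.mem_bot ℂ).2 hrel⟩, hmem⟩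

theorem VV_subset_closure_incid [FiniteDimensional ℂ V] (hV : finrank ℂ V = 6)
    (e : Basis (Fin 6) ℂ V) : VV V ⊆ closure (incid e ⊥) := by
  intro H hH
  rw [mem_closure_iff]
  intro O hO hHO
  rw [Set.inter_comm]
  exact inter_incid_nonempty hV e hO ⟨H, hH, hHO⟩

/-- Irreducibility passes from `incid e ⊥` because its points in the open set of
`isOpen_compl_degen_union_VV` lie in `VV`, and it meets every open set that meets `VV`. -/
theorem isIrreducible_VV [FiniteDimensional ℂ V] (hV : finrank ℂ V = 6)
    (e : Basis (Fin 6) ℂ V) : IsIrreducible (VV V) := by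
  have hO := isOpen_compl_degen_union_VV e
  refine ⟨⟨_, (isHyperbolic_exampleFrame e).spanGr_mem e
    ((isHyperbolic_exampleFrame e).linearIndependent e)⟩, fun O₁ O₂ hO₁ hO₂ hne₁ hne₂ => ?_⟩
  have hsub : ∀ O : Set (Gr 4 (⋀[ℂ]^2 V)), IsOpen O → (VV V ∩ O).Nonempty →
      (incid e ⊥ ∩ (O ∩ ((degen (⊥ : Submodule ℂ (⋀[ℂ]^4 V)))ᶜ ∪ VV V))).Nonempty := by
    rintro O hO' ⟨H, hH, hHO⟩
    exact inter_incid_nonempty hV e (hO'.inter hO) ⟨H, hH, hHO, Or.inr hH⟩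
  obtain ⟨H, hH, ⟨hH₁, hHV⟩, hH₂, -⟩ := isPreirreducible_incid hV e ⊥ _ _ (hO₁.inter hO)
    (hO₂.inter hO) (hsub O₁ hO₁ hne₁) (hsub O₂ hO₂ hne₂)
  refine ⟨H, ?_, hH₁, hH₂⟩
  rw [VV_eq_inter e]
  exact ⟨hHV, incid_subset_degen e ⊥ hH⟩

end Equations

/-! ### Dimension -/

section Krull

open TopologicalSpace

theorem topologicalKrullDim_mono {X : Type*} [TopologicalSpace X] {Y Z : Set X} (h : Y ⊆ Z) :
    topologicalKrullDim Y ≤ topologicalKrullDim Z :=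
  (Topology.IsEmbedding.inclusion h).isInducing.topologicalKrullDim_le

/-- Chains in `Y`, after taking closures in `Z`, can be topped by `Z` itself; the last inclusion is
strict because `Y` is closed and proper. `WithTop` adds this top element. -/
theorem topologicalKrullDim_add_one_le {X : Type*} [TopologicalSpace X] {Y Z : Set X}
    (hY : IsClosed Y) (hYne : Y.Nonempty) (hZ : IsPreirreducible Z) (h : Y ⊂ Z) :
    topologicalKrullDim Y + 1 ≤ topologicalKrullDim Z := by
  have hind : Topology.IsInducing (Set.inclusion h.subset) :=
    (Topology.IsEmbedding.inclusion h.subset).isInducing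
  have := hYne.to_subtype
  have hZne : Nonempty Z := (hYne.mono h.subset).to_subtype
  have hZ' := Subtype.preirreducibleSpace hZ
  have : Nonempty (IrreducibleCloseds Y) :=
    ⟨⟨closure {Classical.arbitrary Y}, isIrreducible_singleton.closure, isClosed_closure⟩⟩
  let f := IrreducibleCloseds.map (Set.inclusion h.subset) hind.continuous
  have hf : StrictMono f := IrreducibleCloseds.map_strictMono_of_isInducing hind
  let t : IrreducibleCloseds Z :=
    ⟨Set.univ, ⟨Set.univ_nonempty, hZ'.isPreirreducible_univ⟩, isClosed_univ⟩
  have htop : ∀ C, f C < t := by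
    intro C
    obtain ⟨z, hzZ, hzY⟩ := Set.exists_of_ssubset h
    have hsub : (f C : Set Z) ⊆ {z : Z | (z : X) ∈ Y} := by
      refine closure_minimal ?_ (hY.preimage continuous_subtype_val)
      rintro _ ⟨y, -, rfl⟩
      exact y.2
    refine lt_of_le_of_ne (fun _ _ => trivial) fun heq => hzY ?_
    have h1 : (⟨z, hzZ⟩ : Z) ∈ (f C : Set Z) := by
      rw [heq]
      trivial
    exact hsub h1
  let g : WithTop (IrreducibleCloseds Y) → IrreducibleCloseds Z := fun C =>
    WithTop.recTopCoe t f C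
  have hg : StrictMono g := by
    intro C C' hC
    induction C using WithTop.recTopCoe with
    | top => exact absurd hC not_top_lt
    | coe C =>
      induction C' using WithTop.recTopCoe with
      | top => exact htop C
      | coe C' => exact hf (WithTop.coe_lt_coe.1 hC)
  have h1 := Order.krullDim_le_of_strictMono g hg
  rwa [Order.krullDim_WithTop] at h1

end Krull

/-! ### The upper bound: a chain of irreducible closed sets above the locus. -/

section UpperBound

variable {V : Type*} [AddCommGroup V] [Module ℂ V]

/-- Replacing d by d + t w with a ∧ w = m changes the defect from 0 to t m. For general t the only
relation modulo the kernel of `θ` is still x₀x₃ − x₁x₂, and its value t m lies outside `M`. -/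
theorem exists_mem_incid_not_mem_degen [FiniteDimensional ℂ V] (hV : finrank ℂ V = 6)
    (e : Basis (Fin 6) ℂ V) {h : Fin 4 → ⋀[ℂ]^2 V} (hh : IsHyperbolic h) (hpf : pf e (h 0) ≠ 0)
    {θ : ⋀[ℂ]^4 V →ₗ[ℂ] (Fin 9 → ℂ)} (hθ : ∀ l : Fin 9, θ (mono h l.castSucc) = Pi.single l 1)
    {M M' : Submodule ℂ (⋀[ℂ]^4 V)} (hM : M ≤ LinearMap.ker θ) {m : ⋀[ℂ]^4 V}
    (hm : m ∈ LinearMap.ker θ) (hmM : m ∉ M) (hmM' : m ∈ M') :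
    ∃ H ∈ incid e M', H ∉ degen M := by
  obtain ⟨w, rfl⟩ : ∃ w, wedge V (h 0) w = m :=
    (LinearMap.injective_iff_surjective_of_finrank_eq_finrank
      ((finrank_bivector e).trans (finrank_fourvector e).symm)).1
      (injective_wedge_of_pr_ne_zero hV e hpf) m
  let F : ℂ → Fin 4 → ⋀[ℂ]^2 V := fun t =>
    h + t • (Pi.single 3 w : Fin 4 → ⋀[ℂ]^2 V)
  have hF : IsPolyMap F := (IsPolyMap.const h).add
    (IsPolyMap.smul (IsPoly.linear LinearMap.id) (IsPolyMap.const _))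
  have hF0 : F 0 = h := by simp [F]
  have hF0' : ∀ t, F t 0 = h 0 := fun t => by simp [F]
  have hdef : ∀ t, relDefect (F t) = t • wedge V (h 0) w := by
    intro t
    have h0 : relDefect h = 0 := sub_eq_zero.2 hh.rel
    have h1 := relDefect_add_smul h (Pi.single 3 w) t
    rw [h0] at h1
    have h2 : relDefect (Pi.single 3 w : Fin 4 → ⋀[ℂ]^2 V) = 0 := by simp [relDefect]
    rw [h2] at h1
    simpa using h1
  obtain ⟨t, ht, ht0⟩ := IsPoly.exists_ne_zero_of_mul
    (f := fun t => (monoMat θ (F t)).det) (g := fun t : ℂ => t)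
    (IsPoly.det fun i j => (isPoly_monoMat i j).comp hF) (IsPoly.linear LinearMap.id)
    (x := 0) (y := 1) (by rw [hF0, monoMat_eq_one hθ, Matrix.det_one]; exact one_ne_zero)
    one_ne_zero
  have hli : LinearIndependent ℂ (F t) :=
    linearIndependent_of_mono e (linearIndependent_of_det_ne_zero θ ht)
  refine ⟨spanGr (F t) hli, ⟨F t, hli, rfl, by rwa [hF0'], ?_⟩, not_mem_degen e hli fun x hx => ?_⟩
  · rw [hdef]
    exact M'.smul_mem t hmM'
  · have h1 : x - x (Fin.last 9) • hypCoeff = 0 := by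
      refine eq_zero_of_map_sum_eq_zero ht ?_ ?_
      · rw [Pi.sub_apply, Pi.smul_apply, hypCoeff_last, smul_eq_mul, mul_one, sub_self]
      · have h2 : ∑ l, (x - x (Fin.last 9) • hypCoeff) l • mono (F t) l =
            ∑ l, x l • mono (F t) l - x (Fin.last 9) • ∑ l, hypCoeff l • mono (F t) l := by
          rw [Finset.smul_sum, ← Finset.sum_sub_distrib]
          refine Finset.sum_congr rfl fun l _ => ?_
          rw [Pi.sub_apply, Pi.smul_apply, smul_eq_mul]
          module
        rw [h2, map_sub, LinearMap.mem_ker.1 (hM hx), sum_hypCoeff_eq_relDefect, hdef, map_smul,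
          map_smul, LinearMap.mem_ker.1 hm, smul_zero, smul_zero, sub_zero]
    rw [sub_eq_zero] at h1
    have h2 : ∑ l, x l • mono (F t) l = x (Fin.last 9) • t • wedge V (h 0) w := by
      rw [← hdef, ← sum_hypCoeff_eq_relDefect, Finset.smul_sum]
      refine Finset.sum_congr rfl fun l _ => ?_
      conv_lhs => rw [h1]
      rw [Pi.smul_apply, smul_eq_mul, mul_smul]
    rw [h2] at hx
    by_contra hx0
    have hx9 : x (Fin.last 9) ≠ 0 := fun h0 => hx0 (by rw [h1, h0, zero_smul])
    exact hmM ((M.smul_mem_iff ht0).1 ((M.smul_mem_iff hx9).1 hx))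

theorem incid_nonempty [FiniteDimensional ℂ V] (e : Basis (Fin 6) ℂ V)
    (M : Submodule ℂ (⋀[ℂ]^4 V)) : (incid e M).Nonempty := by
  have hh := isHyperbolic_exampleFrame e
  refine ⟨_, exampleFrame e, hh.linearIndependent e, rfl, pr_exampleFrame e, ?_⟩
  have : relDefect (exampleFrame e) = 0 := sub_eq_zero.2 hh.rel
  rw [this]
  exact M.zero_mem

theorem finrank_ker_of_dual (e : Basis (Fin 6) ℂ V) {h : Fin 4 → ⋀[ℂ]^2 V}
    {θ : ⋀[ℂ]^4 V →ₗ[ℂ] (Fin 9 → ℂ)} (hθ : ∀ l : Fin 9, θ (mono h l.castSucc) = Pi.single l 1) :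
    finrank ℂ (LinearMap.ker θ) = 6 := by
  have := finiteDimensional_of_basis e
  have hs : LinearMap.range θ = ⊤ := by
    rw [LinearMap.range_eq_top]
    intro c
    refine ⟨∑ l, c l • mono h l.castSucc, ?_⟩
    rw [map_sum]
    simp only [map_smul, hθ]
    exact (pi_eq_sum_univ' c).symm
  have h1 := θ.finrank_range_add_finrank_ker
  rw [hs, finrank_top, finrank_fin_fun, finrank_fourvector e] at h1
  omega

/-- Enlarging `M` by one vector of the six-dimensional kernel of `θ` enlarges the irreducible set
`closure (incid e M)` strictly, and six such steps stay inside a Grassmannian of dimension 44. -/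
theorem topologicalKrullDim_VV_add_le [FiniteDimensional ℂ V] (hV : finrank ℂ V = 6)
    (e : Basis (Fin 6) ℂ V) : topologicalKrullDim (VV V) + 6 ≤ 44 := by
  have hh := isHyperbolic_exampleFrame e
  obtain ⟨θ, hθ⟩ := exists_dual_family hh.indep
  have hker := finrank_ker_of_dual e hθ
  have main : ∀ n : ℕ, n ≤ 6 → ∃ M ≤ LinearMap.ker θ, finrank ℂ M ≤ n ∧
      topologicalKrullDim (VV V) + n ≤ topologicalKrullDim (closure (incid e M)) := by
    intro n
    induction n with
    | zero =>
      intro _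
      refine ⟨⊥, bot_le, by simp, ?_⟩
      simpa using topologicalKrullDim_mono (VV_subset_closure_incid hV e)
    | succ n ih =>
      intro hn
      obtain ⟨M, hM, hMn, hdim⟩ := ih (by omega)
      -- The bound on the dimension of `M` leaves room for a new vector as long as n < 6.
      have hlt : M < LinearMap.ker θ := lt_of_le_of_ne hM fun heq => by
        rw [heq, hker] at hMn
        omega
      obtain ⟨m, hm, hmM⟩ := SetLike.exists_of_lt hlt
      refine ⟨M ⊔ Submodule.span ℂ {m}, sup_le hM (by simpa using hm), ?_, ?_⟩
      · have h1 := Submodule.finrank_add_le_finrank_add_finrank M (Submodule.span ℂ {m})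
        have h2 := finrank_span_le_card (R := ℂ) ({m} : Set (⋀[ℂ]^4 V))
        simp only [Set.toFinset_singleton, Finset.card_singleton] at h2
        omega
      · have hss : closure (incid e M) ⊂ closure (incid e (M ⊔ Submodule.span ℂ {m})) := by
          refine ⟨closure_mono (incid_mono e le_sup_left), fun hsub => ?_⟩
          obtain ⟨H, hH, hHM⟩ := exists_mem_incid_not_mem_degen hV e hh (pr_exampleFrame e) hθ hM
            (M' := M ⊔ Submodule.span ℂ {m}) hm hmM
            (Submodule.mem_sup_right (Submodule.mem_span_singleton_self m))
          exact hHM (closure_minimal (incid_subset_degen e M) (isClosed_degen e M)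
            (hsub (subset_closure hH)))
        have h1 := topologicalKrullDim_add_one_le isClosed_closure (incid_nonempty e M).closure
          (isPreirreducible_incid hV e (M ⊔ Submodule.span ℂ {m})).closure hss
        refine le_trans ?_ h1
        rw [Nat.cast_add, Nat.cast_one, ← add_assoc]
        gcongr
  obtain ⟨M, -, -, hdim⟩ := main 6 le_rfl
  refine (hdim.trans (topologicalKrullDim_subspace_le _ _)).trans ?_
  have h1 := topologicalKrullDim_gr_le 4 (⋀[ℂ]^2 V)
  rw [finrank_bivector e] at h1
  exact h1

end UpperBound

/-! ### The lower bound: six local equations. -/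

section LowerBound

variable {V : Type*} [AddCommGroup V] [Module ℂ V]

theorem exists_coordinates_on_ker {T F : Type*} [AddCommGroup T] [Module ℂ T]
    [FiniteDimensional ℂ T] [AddCommGroup F] [Module ℂ F] (θ : T →ₗ[ℂ] F) {n : ℕ}
    (hn : finrank ℂ (LinearMap.ker θ) = n) :
    ∃ θ' : T →ₗ[ℂ] (Fin n → ℂ), ∀ y, θ y = 0 → θ' y = 0 → y = 0 := by
  obtain ⟨r, hr⟩ := LinearMap.exists_leftInverse_of_injective (LinearMap.ker θ).subtype
    (Submodule.ker_subtype _)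
  let b := finBasisOfFinrankEq ℂ (LinearMap.ker θ) hn
  refine ⟨b.equivFun.toLinearMap ∘ₗ r, fun y hy hy' => ?_⟩
  have h1 : r y = ⟨y, hy⟩ := LinearMap.congr_fun hr ⟨y, hy⟩
  have h2 : r y = 0 := b.equivFun.map_eq_zero_iff.1 hy'
  rw [h1] at h2
  exact Subtype.ext_iff.1 h2

/-- In a chart around the example, where `nondegPoly` is nonzero, the value of `relVec` on the
monomials always lies in the kernel of `θ`. Its six coordinates `θ'` there are the only equations
needed to land in `VV`. -/
theorem le_topologicalKrullDim_VV_add [FiniteDimensional ℂ V] (e : Basis (Fin 6) ℂ V) :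
    44 ≤ topologicalKrullDim (VV V) + 6 := by
  have hh := isHyperbolic_exampleFrame e
  set h := exampleFrame e
  have hli := hh.linearIndependent e
  obtain ⟨θ, hθ⟩ := exists_dual_family hh.indep
  obtain ⟨θ', hθ'⟩ : ∃ θ' : ⋀[ℂ]^4 V →ₗ[ℂ] (Fin 6 → ℂ), ∀ y, θ y = 0 → θ' y = 0 → y = 0 :=
    exists_coordinates_on_ker θ (finrank_ker_of_dual e hθ)
  obtain ⟨π, hπ⟩ := exists_dual_frame hli
  obtain ⟨E⟩ := exists_chartEquiv (n := 44) hπ (by rw [finrank_bivector e])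
  let F : (Fin 44 → ℂ) → Fin 4 → ⋀[ℂ]^2 V := fun x j => h j + (E x j : ⋀[ℂ]^2 V)
  have hF : IsPolyMap F := isPolyMap_chartFrame E
  have hF0 : F 0 = h := by
    funext j
    simp [F]
  have hrelpoly : ∀ k, IsPoly fun x => θ' (∑ l, relVec θ (F x) l • mono (F x) l) k := by
    intro k
    have h1 : IsPolyMap fun h : Fin 4 → ⋀[ℂ]^2 V => ∑ l, relVec θ h l • mono h l :=
      IsPolyMap.sum _ fun l _ => IsPolyMap.smul (isPoly_relVec l) (isPolyMap_mono l)
    exact (h1.comp hF) (LinearMap.proj k ∘ₗ θ')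
  choose p hp using fun k => (hrelpoly k).exists_eval
  obtain ⟨g, hg⟩ := ((isPoly_nondegPoly (θ := θ)).comp hF).exists_eval
  have key := le_topologicalKrullDim_zeroLocus (Set.range p) g ⟨0⟩ (by
    rintro _ ⟨k, rfl⟩
    rw [affEval, ← hp, hF0, hh.relVec_eq hθ, sum_hypCoeff_smul_mono, hh.rel, sub_self, map_zero]
    rfl) (by
    rw [affEval, ← hg, hF0]
    exact hh.nondegPoly_ne_zero hθ)
  set S := {y : AffSp 44 | (∀ f ∈ Set.range p, affEval y f = 0) ∧ affEval y g ≠ 0} with hS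
  have hmem : ∀ y : S, chart hπ E y ∈ VV V := by
    rintro ⟨y, hy, hyg⟩
    refine spanGr_mem_VV_of_nondegPoly (θ := θ) e _ ?_
      (hθ' _ (map_sum_relVec _) (funext fun k => ?_))
    · rwa [affEval, ← hg] at hyg
    · have h1 := hy _ ⟨k, rfl⟩
      rwa [affEval, ← hp] at h1
  have hind : Topology.IsInducing (fun y : S => (⟨chart hπ E y, hmem y⟩ : VV V)) := by
    have h1 : Topology.IsInducing (fun y : S => chart hπ E y) :=
      (isOpenEmbedding_chart hπ E).isInducing.comp Topology.IsInducing.subtypeVal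
    exact Topology.IsInducing.of_comp_iff Topology.IsInducing.subtypeVal |>.1 h1
  have hcard : (Set.range p).encard ≤ 6 := by
    rw [← Set.image_univ]
    refine (Set.encard_image_le p Set.univ).trans ?_
    simp
  calc (44 : WithBot ℕ∞) = ((44 : ℕ) : WithBot ℕ∞) := by norm_cast
    _ ≤ _ := key
    _ ≤ topologicalKrullDim (VV V) + 6 := by
      refine add_le_add hind.topologicalKrullDim_le ?_
      exact WithBot.coe_le_coe.2 hcard

end LowerBound

end SkewForms

end

theorem theorem2p2 (V : Type*) [AddCommGroup V] [Module ℂ V] [FiniteDimensional ℂ V]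
    (hV : Module.finrank ℂ V = 6) :
    IsLocallyClosed (SkewForms.VV V) ∧ IsIrreducible (SkewForms.VV V) ∧
      topologicalKrullDim (SkewForms.VV V) = 38 := by
  let e := finBasisOfFinrankEq ℂ V hV
  refine ⟨SkewForms.isLocallyClosed_VV e, SkewForms.isIrreducible_VV hV e, ?_⟩
  have h1 := SkewForms.topologicalKrullDim_VV_add_le hV e
  have h2 := SkewForms.le_topologicalKrullDim_VV_add e
  -- The two bounds give dimension + 6 = 44; the summand 6 is finite, so it cancels once the value ⊥
  -- is excluded.
  have h3 : topologicalKrullDim (SkewForms.VV V) + 6 = 38 + 6 :=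
    (le_antisymm h1 h2).trans (by norm_num)
  generalize topologicalKrullDim (SkewForms.VV V) = d at h3
  induction d using WithBot.recBotCoe with
  | bot => exact absurd h3 (by decide)
  | coe d =>
    have h4 : d + 6 = 38 + 6 := WithBot.coe_injective h3
    exact congrArg WithBot.some ((ENat.add_left_injective_of_ne_top (by decide)) h4)
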